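/- **Conventions.** Locally convex spaces are real and Hausdorff. Smooth means smooth in the sense of Michal–Bastiani: $f$ is $C^0$ if it is continuous, and $C^{n+1}$ if it is continuous, has all directional derivatives and $(x,w)\mapsto df(x;w)$ is $C^n$. Manifolds are Hausdorff manifolds modelled on locally convex spaces (possibly different ones in different charts), Lie groups are groups in this category. A submanifold is a subset which near each of its points is given, in some chart of the maximal atlas, by a closed linear subspace. A submersion is a smooth map which near each point is, in suitable charts, a linear projection $A\times B\to B$. A locally convex space is Mackey complete if every smooth curve $\mathbb R\to X$ has an antiderivative. **Setting.** Let $G$ be a Lie group with Lie algebra $\mathfrak g$ and let $(M,\omega)$ be a symplectic $G$-manifold, i.e. $G$ acts smoothly on the manifold $M$ and preserves $\omega$, a smooth closed 2-form that is weakly non-degenerate ($\omega_m(v,\cdot)=0\Rightarrow v=0$). Let the action be proper: $G\times M\to M\times M$, $(g,m)\mapsto(g\cdot m,m)$, is a closed map with compact fibres. Let $G^*$ be an abelian Lie group (written additively) with Lie algebra $\mathfrak g^*$, and let $\kappa:\mathfrak g^*\times\mathfrak g\to\mathbb R$ be a continuous bilinear map which is non-degenerate on both sides. Let $G^*$ carry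 a coconjugation action, i.e. a smooth $G$-action $\Upsilon$ with $\kappa(\delta_\eta\Upsilon_g(\eta\cdot\nu),\xi)=\kappa(\nu,\mathrm{Ad}_{g^{-1}}\xi)$, where $\delta$ is the logarithmic derivative and $\eta\cdot\nu\in T_\eta G^*$ is the translate of $\nu\in\mathfrak g^*$. Let $J:M\to G^*$ be a $G$-equivariant momentum map: $J$ is smooth and $\omega_m(\xi\cdot m,v)+\kappa(\delta_mJ(v),\xi)=0$ for all $m\in M$, $v\in T_mM$, $\xi\in\mathfrak g$. **Slices.** Let $G_\mu$ be the stabilizer of $\mu\in G^*$; it acts on $M_\mu:=J^{-1}(\mu)$. Orbit types $(H)$ are always taken for the $G_\mu$-action: the orbit type of $m$ is the $G_\mu$-conjugacy class of its stabilizer, and $(K)\le(H)$ means that a conjugate of $K$ lies in $H$. If $J(m)=\mu$ then $G_m\subseteq G_\mu$. A slice at $m$ for the $G_\mu$-action is a submanifold $S\ni m$ of $M$ such that: $G_m\cdot S\subseteq S$; if $g\in G_\mu$ and $g\cdot S\cap S\neq\emptyset$ then $g\in G_m$; $G_m$ is a submanifold of $G_\mu$, $G_\mu\to G_\mu/G_m$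 is a locally trivial smooth principal bundle, and it has a smooth section $\chi$ on an open neighbourhood $W$ of $[e]$ for which $W\times S\to M$, $([g],s)\mapsto\chi([g])\cdot s$, is a diffeomorphism onto an open neighbourhood of $m$; the points of $S$ of the same orbit type as $m$ form a closed submanifold of $S$; and $S$ is $G_m$-equivariantly diffeomorphic to a $G_m$-invariant open neighbourhood of $0$ in a continuous linear representation of $G_m$ on a locally convex space, with $m$ corresponding to $0$. **Normal forms.** Let $H$ be a compact Lie group whose Lie algebra $\mathfrak h$ is identified with a subalgebra of $\mathfrak g$. An MGS (Marle–Guillemin–Sternberg) normal form consists of locally convex spaces with continuous linear $H$-actions and topological $H$-invariant decompositions $X=\mathrm{Ker}\oplus\mathrm{Coim}$ and $\mathfrak g^*=\mathrm{Coker}\oplus\mathrm{Im}$, where $\kappa$ is a non-degenerate pairing of $\mathrm{Coker}$ with $\mathfrak h$ ("$\mathrm{Coker}=\mathfrak h^*$"); an $H$-equivariant topological isomorphism $\hat J:\mathrm{Coim}\to\mathrm{Im}$; a smooth $H$-equivariant map $J_{\mathrm{sing}}:U\to\mathrm{Coker}$ on an $H$-invariant open neighbourhood $U$ of $0$ in $X$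 with $J_{\mathrm{sing}}(0,x_2)=0$ for $(0,x_2)\in U$ and $T_0J_{\mathrm{sing}}=0$; and a smooth closed $H$-invariant 2-form $\bar\omega$ on $U\cap\mathrm{Ker}$ with $\bar\omega_0$ non-degenerate, such that $\bar\omega_x(\xi\cdot x,w)+\kappa(T_xJ_{\mathrm{sing}}(w),\xi)=0$ for all $x\in U\cap\mathrm{Ker}$, $w\in\mathrm{Ker}$, $\xi\in\mathfrak h$. It is strong if $\bar\omega_x=\bar\omega_0$ and $\kappa(J_{\mathrm{sing}}(x),\xi)=\tfrac12\bar\omega_0(x,\xi\cdot x)$ for all $x\in U\cap\mathrm{Ker}$, $\xi\in\mathfrak h$. $J$ can be brought into this normal form at $m\in M_\mu$ if $H=G_m$ and there are a slice $S$ at $m$ for the $G_\mu$-action, a $G_m$-equivariant diffeomorphism $\iota_S:U\to S$ with $\iota_S(0)=m$, and a $G_m$-equivariant chart $\rho$ of $G^*$ around $\mu$ onto an open subset of $\mathfrak g^*$, with $\rho(\mu)=0$ and with $J(S)$ in its domain, such that $$J(g\cdot\iota_S(x_1,x_2))=g\cdot\rho^{-1}\bigl(\hat J(x_2)+J_{\mathrm{sing}}(x_1,x_2)\bigr)\qquad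 (g\in G_\mu,\ (x_1,x_2)\in U)$$ and the restriction of $\iota_S^*\omega$ to $U\cap\mathrm{Ker}$ is $\bar\omega$. Such a normal form has the approximation property if for every orbit type $(K)$ of the $G_\mu$-action on $M_\mu$ with $(K)\le(G_m)$ there is $x\in U\cap\mathrm{Ker}$ with $J_{\mathrm{sing}}(x)=0$ whose stabilizer in $G_m$ is $G_\mu$-conjugate to $K$. **Theorem (Singular Reduction Theorem).** In this setting let $\mu\in G^*$. Assume that $G_\mu$ is a Lie subgroup (a submanifold) of $G$, and that for every $m\in M_\mu$ the subspace $\mathfrak g\cdot m\subseteq T_mM$ is symplectically closed, i.e. closed in some locally convex topology on $T_mM$ whose continuous linear functionals are exactly the $\omega_m(v,\cdot)$, $v\in T_mM$. Suppose that $J$ can be brought into an MGS normal form at every point of $M_\mu$. For an orbit type $(H)$ of the $G_\mu$-action on $M_\mu$, let $M_{(H),\mu}\subseteq M_\mu$ be the set of points of this orbit type. Then: 1. For every orbit type $(H)$ of the $G_\mu$-action on $M_\mu$, $M_{(H),\mu}$ is a submanifold of $M$, and there is a unique manifold structure on $\check M_{(H),\mu}:=M_{(H),\mu}/G_\mu$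 such that the projection $\pi_{(H),\mu}:M_{(H),\mu}\to\check M_{(H),\mu}$ is a smooth submersion. 2. If, additionally, the MGS normal forms at the points of $M_\mu$ can be chosen to be strong and to have the approximation property, then the decompositions of $M_\mu$ into the $M_{(H),\mu}$ and of $\check M_\mu:=M_\mu/G_\mu$ (with the quotient topology) into the $\check M_{(H),\mu}$ are stratifications: the total space is Hausdorff, every piece is locally closed and is a manifold whose topology is the relative topology, and any two distinct pieces $Z,Z'$ with $Z\cap\overline{Z'}\neq\emptyset$ satisfy $Z\subseteq\overline{Z'}\setminus Z'$ and $Z'\cap\overline{Z}=\emptyset$. 3. If the tangent spaces of $M$ are Mackey complete (for instance, if $M$ is a Fréchet manifold), then for every orbit type $(H)$ of the $G_\mu$-action on $M_\mu$ there is a symplectic form $\check\omega_{(H),\mu}$ on $\check M_{(H),\mu}$, uniquely determined by $\pi_{(H),\mu}^*\check\omega_{(H),\mu}=\iota_{(H),\mu}^*\omega$, where $\iota_{(H),\mu}:M_{(H),\mu}\to M$ is the inclusion. -/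

import Mathlib

open Set Filter Topology

universe u v

noncomputable section

namespace LCRed

/-! ### Locally convex spaces and Michal-Bastiani calculus -/

/-- A Hausdorff locally convex real topological vector space. -/
structure LCS : Type (u + 1) where
  carrier : Type u
  [grp : AddCommGroup carrier]
  [mod : Module ℝ carrier]
  [top : TopologicalSpace carrier]
  [addGrp : IsTopologicalAddGroup carrier]
  [smul : ContinuousSMul ℝ carrier]
  [convex : LocallyConvexSpace ℝ carrier]
  [t2 : T2Space carrier]

instance : CoeSort LCS.{u} (Type u) := ⟨LCS.carrier⟩

attribute [instance] LCS.grp LCS.mod LCS.top LCS.addGrp LCS.smul LCS.convex LCS.t2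

/-- The product of two locally convex spaces. -/
def LCS.prod (E F : LCS.{u}) : LCS.{u} := ⟨E × F⟩

/-- A linear subspace of a locally convex space, with the induced topology. -/
def LCS.sub (E : LCS.{u}) (Y : Submodule ℝ E) : LCS.{u} := ⟨Y⟩

section Calculus

variable {E : Type u} [AddCommGroup E] [Module ℝ E] [TopologicalSpace E]
variable {F : Type v} [AddCommGroup F] [Module ℝ F] [TopologicalSpace F]

/-- `y` is the directional derivative of `f` at `x` in the direction `w`. -/
def HasDirDeriv (f : E → F) (x w : E) (y : F) : Prop :=
  Tendsto (fun t : ℝ => t⁻¹ • (f (x + t • w) - f x)) (𝓝[≠] 0) (𝓝 y)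

open Classical in
/-- The directional derivative of `f` at `x` in the direction `w` (zero if it does not exist). -/
def dirDeriv (f : E → F) (x w : E) : F :=
  if h : ∃ y, HasDirDeriv f x w y then h.choose else 0

end Calculus

/-- `f` is of class `C^n` on the open set `U` in the sense of Michal-Bastiani: `C^0` means
continuous, and `f` is `C^(n+1)` if it is continuous, all directional derivatives exist on `U`,
and the derivative `(x, w) ↦ df(x; w)` is of class `C^n` on `U × E`. -/
def BContDiffOn {F : Type v} [AddCommGroup F] [Module ℝ F] [TopologicalSpace F] :
    (n : ℕ) → {E : Type u} → [AddCommGroup E] → [Module ℝ E] → [TopologicalSpace E] →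
      Set E → (E → F) → Prop
  | 0, _, _, _, _, U, f => ContinuousOn f U
  | n + 1, E, _, _, _, U, f =>
      ContinuousOn f U ∧ (∀ x ∈ U, ∀ w : E, ∃ y, HasDirDeriv f x w y) ∧
        BContDiffOn n (U ×ˢ (univ : Set E)) (fun p : E × E => dirDeriv f p.1 p.2)

/-- Michal-Bastiani smoothness on an open set. -/
def BSmoothOn {E : Type u} [AddCommGroup E] [Module ℝ E] [TopologicalSpace E]
    {F : Type v} [AddCommGroup F] [Module ℝ F] [TopologicalSpace F]
    (U : Set E) (f : E → F) : Prop :=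
  ∀ n, BContDiffOn n U f

/-- Mackey completeness: every smooth curve has an antiderivative. -/
def IsMackeyComplete (E : LCS.{u}) : Prop :=
  ∀ γ : ℝ → E, BSmoothOn univ γ → ∃ η : ℝ → E, ∀ t, HasDirDeriv η t 1 (γ t)

/-! ### Manifolds -/

/-- A chart of a topological space: a homeomorphism from an open subset onto an open subset of
some locally convex space. The model space may vary from chart to chart. -/
structure LCChart (M : Type u) [TopologicalSpace M] : Type (u + 1) where
  model : LCS.{u}
  hom : OpenPartialHomeomorph M model

/-- A set of charts on a topological space. -/
class LCAtlas (M : Type u) [TopologicalSpace M] : Type (u + 1) where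
  charts : Set (LCChart M)

/-- The coordinate change from `φ` to `ψ` is smooth. -/
def SmoothTransition {M : Type u} [TopologicalSpace M] (φ ψ : LCChart M) : Prop :=
  BSmoothOn (φ.hom.target ∩ φ.hom.symm ⁻¹' ψ.hom.source) (fun x => ψ.hom (φ.hom.symm x))

/-- A smooth (Hausdorff) manifold modelled on locally convex spaces. -/
class IsLCManifold (M : Type u) [TopologicalSpace M] [LCAtlas M] : Prop where
  t2 : T2Space M
  cover : ∀ m : M, ∃ φ ∈ LCAtlas.charts (M := M), m ∈ φ.hom.source
  compatible : ∀ φ ∈ LCAtlas.charts (M := M), ∀ ψ ∈ LCAtlas.charts (M := M), SmoothTransition φ ψ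

/-- A chart of the maximal atlas. -/
def IsSmoothChart {M : Type u} [TopologicalSpace M] [LCAtlas M] (φ : LCChart M) : Prop :=
  ∀ ψ ∈ LCAtlas.charts (M := M), SmoothTransition φ ψ ∧ SmoothTransition ψ φ

/-- A chart with empty domain. -/
def LCChart.empty {M : Type u} [TopologicalSpace M] (m : M) : LCChart M where
  model := ⟨PUnit⟩
  hom :=
    { toFun := fun _ => PUnit.unit
      invFun := fun _ => m
      source := ∅
      target := ∅
      map_source' := by simp
      map_target' := by simp
      left_inv' := by simp
      right_inv' := by simp
      continuousOn_toFun := by simp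
      continuousOn_invFun := by simp
      open_source := isOpen_empty
      open_target := isOpen_empty }

open Classical in
/-- A chosen chart of the atlas around `m` (the empty chart if there is none, which does not
happen on a manifold). -/
def chartAt {M : Type u} [TopologicalSpace M] [LCAtlas M] (m : M) : LCChart M :=
  if h : ∃ φ ∈ LCAtlas.charts (M := M), m ∈ φ.hom.source then h.choose else LCChart.empty m

/-- The tangent space of `M` at `m`, realised as the model space of the chosen chart at `m`. -/
def tangent {M : Type u} [TopologicalSpace M] [LCAtlas M] (m : M) : LCS.{u} := (chartAt m).model

/-- A locally convex space is a manifold, with the identity as its only chart. -/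
instance LCS.instAtlas (E : LCS.{u}) : LCAtlas E := ⟨{⟨E, OpenPartialHomeomorph.refl E⟩}⟩

/-- The product of two charts. -/
def LCChart.prod {M N : Type u} [TopologicalSpace M] [TopologicalSpace N]
    (φ : LCChart M) (ψ : LCChart N) : LCChart (M × N) where
  model := φ.model.prod ψ.model
  hom := φ.hom.prod ψ.hom

/-- The product atlas. -/
instance instAtlasProd (M N : Type u) [TopologicalSpace M] [TopologicalSpace N]
    [LCAtlas M] [LCAtlas N] : LCAtlas (M × N) :=
  ⟨{χ | ∃ φ ∈ LCAtlas.charts (M := M), ∃ ψ ∈ LCAtlas.charts (M := N), χ = φ.prod ψ}⟩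

section Maps

variable {M N : Type u} [TopologicalSpace M] [LCAtlas M] [TopologicalSpace N] [LCAtlas N]

/-- `f` is smooth on the open set `W`: it is continuous and smooth in all charts. -/
def SmoothOn (f : M → N) (W : Set M) : Prop :=
  ContinuousOn f W ∧ ∀ φ ∈ LCAtlas.charts (M := M), ∀ ψ ∈ LCAtlas.charts (M := N),
    BSmoothOn (φ.hom.target ∩ φ.hom.symm ⁻¹' (W ∩ f ⁻¹' ψ.hom.source))
      (fun x => ψ.hom (f (φ.hom.symm x)))

/-- `f` is smooth. -/
def Smooth (f : M → N) : Prop := SmoothOn f univ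

/-- `f` restricts to a diffeomorphism from the open set `W` onto an open subset of `N`. -/
def IsOpenDiffeoOn (f : M → N) (W : Set M) : Prop :=
  IsOpen W ∧ IsOpen (f '' W) ∧ SmoothOn f W ∧
    ∃ g : N → M, SmoothOn g (f '' W) ∧ ∀ x ∈ W, g (f x) = x

/-- The tangent map of `f` at `x`, as a map from the tangent space at `x` to the tangent space at
`y`, where `y = f x`. -/
def tmap (f : M → N) (x : M) (y : N) (w : tangent x) : tangent y :=
  dirDeriv (fun e => (chartAt y).hom (f ((chartAt x).hom.symm e))) ((chartAt x).hom x) w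

/-- `f` is a smooth submersion: it is smooth, and near every point it is, in suitable charts, a
linear projection `A × B → B`. -/
def IsSmoothSubmersion (f : M → N) : Prop :=
  Smooth f ∧ ∀ m : M, ∃ (A B : LCS.{u}) (φ : OpenPartialHomeomorph M (A.prod B))
    (ψ : OpenPartialHomeomorph N B),
      IsSmoothChart ⟨A.prod B, φ⟩ ∧ IsSmoothChart ⟨B, ψ⟩ ∧ m ∈ φ.source ∧
      ∀ x ∈ φ.source, f x ∈ ψ.source ∧ ψ (f x) = (show A × B from φ x).2

end Maps

/-! ### Submanifolds -/

section Submanifolds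

variable {M : Type u} [TopologicalSpace M]

/-- In the chart `φ`, the set `S` is given by the linear subspace `Y`. -/
def IsAdapted (S : Set M) (φ : LCChart M) (Y : Submodule ℝ φ.model) : Prop :=
  φ.hom '' (φ.hom.source ∩ S) = φ.hom.target ∩ (Y : Set φ.model)

theorem IsAdapted.mem {S : Set M} {φ : LCChart M} {Y : Submodule ℝ φ.model}
    (h : IsAdapted S φ Y) {s : M} (hs : s ∈ S) (hs' : s ∈ φ.hom.source) : φ.hom s ∈ Y :=
  (h.le ⟨s, ⟨hs', hs⟩, rfl⟩).2

theorem IsAdapted.symm_mem {S : Set M} {φ : LCChart M} {Y : Submodule ℝ φ.model}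
    (h : IsAdapted S φ Y) {y : φ.model} (hy : y ∈ Y) (hy' : y ∈ φ.hom.target) :
    φ.hom.symm y ∈ S := by
  obtain ⟨s, ⟨hs, hs'⟩, rfl⟩ := h.ge ⟨hy', hy⟩
  rwa [φ.hom.left_inv hs]

open Classical in
/-- The restriction of the adapted chart `φ` to `S`, as a map onto an open subset of `Y`. -/
def LCChart.restrictHom {S : Set M} (s₀ : S) (φ : LCChart M) (Y : Submodule ℝ φ.model)
    (h : IsAdapted S φ Y) : OpenPartialHomeomorph S Y where
  toFun := fun s => if hs : (s : M) ∈ φ.hom.source then ⟨φ.hom s, h.mem s.2 hs⟩ else 0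
  invFun := fun y => if hy : (y : φ.model) ∈ φ.hom.target
    then ⟨φ.hom.symm y, h.symm_mem y.2 hy⟩ else s₀
  source := Subtype.val ⁻¹' φ.hom.source
  target := Subtype.val ⁻¹' φ.hom.target
  map_source' := by
    intro s hs
    have hs' : (s : M) ∈ φ.hom.source := hs
    rw [dif_pos hs']
    exact φ.hom.map_source hs'
  map_target' := by
    intro y hy
    have hy' : (y : φ.model) ∈ φ.hom.target := hy
    rw [dif_pos hy']
    exact φ.hom.map_target hy'
  left_inv' := by
    intro s hs
    have hs' : (s : M) ∈ φ.hom.source := hs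
    rw [dif_pos hs', dif_pos (φ.hom.map_source hs')]
    exact Subtype.ext (φ.hom.left_inv hs')
  right_inv' := by
    intro y hy
    have hy' : (y : φ.model) ∈ φ.hom.target := hy
    rw [dif_pos hy', dif_pos (φ.hom.map_target hy')]
    exact Subtype.ext (φ.hom.right_inv hy')
  continuousOn_toFun := by
    have key : ContinuousOn (fun s : S => φ.hom s) (Subtype.val ⁻¹' φ.hom.source) :=
      φ.hom.continuousOn.comp continuous_subtype_val.continuousOn (fun _ hs => hs)
    refine Topology.IsInducing.subtypeVal.continuousOn_iff.2 (key.congr ?_)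
    intro s hs
    have hs' : (s : M) ∈ φ.hom.source := hs
    simp [hs']
  continuousOn_invFun := by
    have key : ContinuousOn (fun y : Y => φ.hom.symm y) (Subtype.val ⁻¹' φ.hom.target) :=
      φ.hom.continuousOn_symm.comp continuous_subtype_val.continuousOn (fun _ hy => hy)
    refine Topology.IsInducing.subtypeVal.continuousOn_iff.2 (key.congr ?_)
    intro y hy
    have hy' : (y : φ.model) ∈ φ.hom.target := hy
    simp [hy']
  open_source := φ.hom.open_source.preimage continuous_subtype_val
  open_target := φ.hom.open_target.preimage continuous_subtype_val

/-- The chart of `S` obtained by restricting the adapted chart `φ`. -/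
def LCChart.restrict {S : Set M} (s₀ : S) (φ : LCChart M) (Y : Submodule ℝ φ.model)
    (h : IsAdapted S φ Y) : LCChart S where
  model := φ.model.sub Y
  hom := φ.restrictHom s₀ Y h

variable [LCAtlas M]

/-- `S` is a submanifold: around each of its points there is a chart of `M` in which `S` is a
closed linear subspace. -/
def IsSubmanifold (S : Set M) : Prop :=
  ∀ s ∈ S, ∃ (φ : LCChart M) (Y : Submodule ℝ φ.model),
    IsSmoothChart φ ∧ s ∈ φ.hom.source ∧ IsClosed (Y : Set φ.model) ∧ IsAdapted S φ Y

/-- The atlas of a submanifold, consisting of the restrictions of all adapted charts. -/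
instance instAtlasSubset (S : Set M) : LCAtlas S :=
  ⟨{χ | ∃ (s₀ : S) (φ : LCChart M) (Y : Submodule ℝ φ.model) (h : IsAdapted S φ Y),
    IsSmoothChart φ ∧ IsClosed (Y : Set φ.model) ∧ χ = φ.restrict s₀ Y h}⟩

/-- The atlas of a subgroup that is a submanifold. -/
instance instAtlasSubgroup {G : Type u} [Group G] [TopologicalSpace G] [LCAtlas G]
    (H : Subgroup G) : LCAtlas H :=
  instAtlasSubset (H : Set G)

end Submanifolds

/-! ### Smooth structures on a set -/

/-- A manifold structure (topology and smooth atlas) on the set `Q`. -/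
structure SmoothStructure (Q : Type u) : Type (u + 1) where
  top : TopologicalSpace Q
  atlas : LCAtlas Q
  manifold : IsLCManifold Q

/-- The set `Q` endowed with the structure `𝒮`. -/
def SmoothStructure.Carrier {Q : Type u} (_ : SmoothStructure Q) : Type u := Q

instance {Q : Type u} (𝒮 : SmoothStructure Q) : TopologicalSpace 𝒮.Carrier := 𝒮.top

instance {Q : Type u} (𝒮 : SmoothStructure Q) : LCAtlas 𝒮.Carrier := 𝒮.atlas

/-- The identity, as a map into `Q` endowed with the structure `𝒮`. -/
def SmoothStructure.into {Q : Type u} (𝒮 : SmoothStructure Q) (q : Q) : 𝒮.Carrier := q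

/-- The identity, as a map out of `Q` endowed with the structure `𝒮`. -/
def SmoothStructure.out {Q : Type u} (𝒮 : SmoothStructure Q) (q : 𝒮.Carrier) : Q := q

/-- Two manifold structures on a set coincide: the identity is a diffeomorphism. -/
def SmoothStructure.Same {Q : Type u} (𝒮 𝒮' : SmoothStructure Q) : Prop :=
  Smooth (fun q : 𝒮.Carrier => 𝒮'.into (𝒮.out q)) ∧
    Smooth (fun q : 𝒮'.Carrier => 𝒮.into (𝒮'.out q))

/-! ### Lie groups and actions -/

/-- A Lie group modelled on a locally convex space. -/
class IsLCLieGroup (G : Type u) [Group G] [TopologicalSpace G] [LCAtlas G] : Prop extends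
    IsLCManifold G where
  smooth_mul : Smooth (fun p : G × G => p.1 * p.2)
  smooth_inv : Smooth (fun g : G => g⁻¹)

/-- An abelian Lie group, written additively, modelled on a locally convex space. -/
class IsLCAddLieGroup (A : Type u) [AddCommGroup A] [TopologicalSpace A] [LCAtlas A] : Prop extends
    IsLCManifold A where
  smooth_add : Smooth (fun p : A × A => p.1 + p.2)
  smooth_neg : Smooth (fun a : A => -a)

/-- The Lie algebra of `G` (as a locally convex space). -/
abbrev lieAlg (G : Type u) [Group G] [TopologicalSpace G] [LCAtlas G] : LCS.{u} := tangent (1 : G)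

/-- The Lie algebra of the additively written abelian Lie group `A`. -/
abbrev lieAlgAdd (A : Type u) [AddCommGroup A] [TopologicalSpace A] [LCAtlas A] : LCS.{u} :=
  tangent (0 : A)

section Groups

variable {G : Type u} [Group G] [TopologicalSpace G] [LCAtlas G]
variable {M : Type u} [TopologicalSpace M] [LCAtlas M]
variable {A : Type u} [AddCommGroup A] [TopologicalSpace A] [LCAtlas A]

/-- The adjoint action of `g` on the Lie algebra. -/
def adj (g : G) (ξ : lieAlg G) : lieAlg G := tmap (fun a : G => g * a * g⁻¹) 1 1 ξ

/-- The infinitesimal action `ξ · m`. -/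
def infAct [MulAction G M] (ξ : lieAlg G) (m : M) : tangent m := tmap (fun g : G => g • m) 1 m ξ

/-- The (left) logarithmic derivative of a map into an abelian Lie group. -/
def logDeriv (φ : M → A) (m : M) (w : tangent m) : lieAlgAdd A :=
  tmap (fun a : A => -φ m + a) (φ m) 0 (tmap φ m (φ m) w)

/-- A weakly non-degenerate, jointly continuous pairing of two locally convex spaces. -/
structure IsDualPairing {Y X : LCS.{u}} (κ : Y →ₗ[ℝ] X →ₗ[ℝ] ℝ) : Prop where
  continuous : Continuous (fun p : Y × X => κ p.1 p.2)
  left : ∀ η, (∀ ξ, κ η ξ = 0) → η = 0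
  right : ∀ ξ, (∀ η, κ η ξ = 0) → ξ = 0

/-- A smooth action of `G` on `A` that integrates the coadjoint action, the latter being defined by
`κ (Ad*_g ν, ξ) = κ (ν, Ad_{g⁻¹} ξ)`. -/
structure IsCoconjugation [MulAction G A] (κ : lieAlgAdd A →ₗ[ℝ] lieAlg G →ₗ[ℝ] ℝ) : Prop where
  smooth : Smooth (fun p : G × A => p.1 • p.2)
  integrates : ∀ (g : G) (η : A) (ν : lieAlgAdd A) (ξ : lieAlg G),
    κ (logDeriv (fun ζ : A => g • ζ) η (tmap (fun ζ : A => η + ζ) 0 η ν)) ξ = κ ν (adj g⁻¹ ξ)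

/-- The conjugacy class of a subgroup. -/
def conjClass (L : Subgroup G) : Set (Subgroup G) :=
  {L' | ∃ a : G, L' = L.map (MulAut.conj a).toMonoidHom}

variable (G) in
/-- The orbit type of `m`: the conjugacy class of its stabilizer. -/
def orbitType [MulAction G M] (m : M) : Set (Subgroup G) := conjClass (MulAction.stabilizer G m)

/-- The order of orbit types: some representative of `c` is contained in some representative of
`c'`. -/
def TypeLE (c c' : Set (Subgroup G)) : Prop := ∃ L ∈ c, ∃ L' ∈ c', L ≤ L'

variable (G) in
/-- The equivalence relation on `S` of lying on the same `G`-orbit. -/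
def orbitSetoid [MulAction G M] (S : Set M) : Setoid S :=
  (MulAction.orbitRel G M).comap (Subtype.val : S → M)

variable (G) in
/-- The quotient `S / G` of a `G`-invariant set `S`. -/
abbrev OrbitQuotient [MulAction G M] (S : Set M) : Type u := Quotient (orbitSetoid G S)

variable (G) in
/-- The map `S / G → T / G` induced by an inclusion `S ⊆ T`. -/
def orbitInclusion [MulAction G M] {S T : Set M} (h : S ⊆ T) :
    OrbitQuotient G S → OrbitQuotient G T :=
  Quotient.map' (s₁ := orbitSetoid G S) (s₂ := orbitSetoid G T) (Set.inclusion h)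
    (fun _ _ hab => hab)

/-- The Lie subgroup `H` of `G` is principal: `G → G / H` is a locally trivial principal bundle. -/
def IsPrincipal (H : Subgroup G) [LCAtlas (G ⧸ H)] : Prop :=
  IsLCManifold (G ⧸ H) ∧ IsSubmanifold (H : Set G) ∧
    ∀ q : G ⧸ H, ∃ (W : Set (G ⧸ H)) (σ : G ⧸ H → G), IsOpen W ∧ q ∈ W ∧
      (∀ w ∈ W, (σ w : G ⧸ H) = w) ∧
      IsOpenDiffeoOn (fun p : (G ⧸ H) × H => σ p.1 * (p.2 : G)) (W ×ˢ univ) ∧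
      (fun p : (G ⧸ H) × H => σ p.1 * (p.2 : G)) '' (W ×ˢ univ) = {g : G | (g : G ⧸ H) ∈ W}

/-- `ι` is an equivariant diffeomorphism from the `H`-invariant open neighbourhood `U` of `0` in
the linear space `X` (with action `a`) onto `S`, mapping `0` to `m`. -/
structure IsSliceDiffeo [MulAction G M] (m : M) (S : Set M)
    {X : Type u} [Zero X] [TopologicalSpace X] [LCAtlas X]
    (a : MulAction.stabilizer G m → X → X) (U : Set X) (ι : X → S) : Prop where
  zero_mem : 0 ∈ U
  invariant : ∀ h, ∀ x ∈ U, a h x ∈ U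
  map_zero : (ι 0 : M) = m
  onto : ι '' U = univ
  diffeo : IsOpenDiffeoOn ι U
  equivariant : ∀ h, ∀ x ∈ U, (ι (a h x) : M) = (h : G) • (ι x : M)

/-- `S` is a slice at `m` for the action of `G` on `M`. -/
structure IsSlice (G : Type u) [Group G] [TopologicalSpace G] [LCAtlas G] [MulAction G M]
    (m : M) (S : Set M) : Prop where
  submanifold : IsSubmanifold S
  mem : m ∈ S
  invariant : ∀ g ∈ MulAction.stabilizer G m, ∀ s ∈ S, g • s ∈ S
  stabilizer : ∀ g : G, (∃ s ∈ S, g • s ∈ S) → g ∈ MulAction.stabilizer G m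
  section_tube : ∃ _ : LCAtlas (G ⧸ MulAction.stabilizer G m),
    IsPrincipal (MulAction.stabilizer G m) ∧
      ∃ (W : Set (G ⧸ MulAction.stabilizer G m)) (χ : G ⧸ MulAction.stabilizer G m → G),
        IsOpen W ∧ ((1 : G) : G ⧸ MulAction.stabilizer G m) ∈ W ∧ SmoothOn χ W ∧
        (∀ w ∈ W, (χ w : G ⧸ MulAction.stabilizer G m) = w) ∧
        IsOpenDiffeoOn (fun p : (G ⧸ MulAction.stabilizer G m) × S => χ p.1 • (p.2 : M))
          (W ×ˢ univ) ∧
        m ∈ (fun p : (G ⧸ MulAction.stabilizer G m) × S => χ p.1 • (p.2 : M)) '' (W ×ˢ univ)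
  partial_slice : IsClosed {s : S | orbitType G (s : M) = orbitType G m} ∧
    IsSubmanifold {s : S | orbitType G (s : M) = orbitType G m}
  linear : ∃ (X : LCS.{u}) (ρ : Representation ℝ (MulAction.stabilizer G m) X) (U : Set X)
    (ι : X → S), Continuous (fun p : MulAction.stabilizer G m × X => ρ p.1 p.2) ∧
      IsSliceDiffeo m S (fun h x => ρ h x) U ι

end Groups

/-! ### Symplectic forms -/

section Forms

/-- `β` is a smooth closed 2-form on the open subset `U` of a locally convex space. -/
structure IsClosedTwoFormOn {E : Type u} [AddCommGroup E] [Module ℝ E] [TopologicalSpace E]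
    (U : Set E) (β : E → E → E → ℝ) : Prop where
  bilinear : ∀ x ∈ U, ∃ B : E →ₗ[ℝ] E →ₗ[ℝ] ℝ, ∀ w₁ w₂, β x w₁ w₂ = B w₁ w₂
  alternating : ∀ x ∈ U, ∀ w, β x w w = 0
  smooth : BSmoothOn (U ×ˢ (univ : Set (E × E))) (fun p : E × E × E => β p.1 p.2.1 p.2.2)
  closed : ∀ x ∈ U, ∀ w₁ w₂ w₃,
    dirDeriv (fun y => β y w₂ w₃) x w₁ + dirDeriv (fun y => β y w₃ w₁) x w₂ +
      dirDeriv (fun y => β y w₁ w₂) x w₃ = 0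

variable {M : Type u} [TopologicalSpace M] [LCAtlas M]

/-- A field of bilinear forms on the tangent spaces. -/
abbrev BilinField (M : Type u) [TopologicalSpace M] [LCAtlas M] : Type u :=
  ∀ m : M, tangent m →ₗ[ℝ] tangent m →ₗ[ℝ] ℝ

/-- The expression of `ω` in the chart `φ`. -/
def localRep (ω : BilinField M) (φ : LCChart M) (x w₁ w₂ : φ.model) : ℝ :=
  ω (φ.hom.symm x)
    (dirDeriv (fun e => (chartAt (φ.hom.symm x)).hom (φ.hom.symm e)) x w₁)
    (dirDeriv (fun e => (chartAt (φ.hom.symm x)).hom (φ.hom.symm e)) x w₂)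

/-- `ω` is a (weakly) symplectic form on the manifold `M`. -/
structure IsSymplectic (ω : BilinField M) : Prop where
  closed : ∀ φ ∈ LCAtlas.charts (M := M), IsClosedTwoFormOn φ.hom.target (localRep ω φ)
  nondegenerate : ∀ (m : M) (w : tangent m), (∀ w', ω m w w' = 0) → w = 0

/-- The linear subspace `V` of the symplectic vector space `(X, ω)` is closed with respect to some
locally convex topology for which the continuous functionals are exactly the `ω(x, ·)`. -/
def IsSymplecticallyClosed {X : LCS.{u}} (ω : X →ₗ[ℝ] X →ₗ[ℝ] ℝ) (V : Set X) : Prop :=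
  ∃ τ : TopologicalSpace X, @IsTopologicalAddGroup X τ _ ∧ @ContinuousSMul ℝ X _ _ τ ∧
    @LocallyConvexSpace ℝ X _ _ _ _ τ ∧
    (∀ α : X →ₗ[ℝ] ℝ, Continuous[τ, _] α ↔ ∃ x, α = ω x) ∧ IsClosed[τ] V

variable {G : Type u} [Group G] [TopologicalSpace G] [LCAtlas G] [MulAction G M]

/-- `(M, ω)` is a symplectic `G`-manifold. -/
structure IsSymplecticAction (ω : BilinField M) (G : Type u) [Group G] [TopologicalSpace G]
    [LCAtlas G] [MulAction G M] : Prop where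
  symplectic : IsSymplectic ω
  smooth : Smooth (fun p : G × M => p.1 • p.2)
  preserves : ∀ (g : G) (m : M) (w₁ w₂ : tangent m),
    ω (g • m) (tmap (fun x : M => g • x) m (g • m) w₁) (tmap (fun x : M => g • x) m (g • m) w₂) =
      ω m w₁ w₂

variable {Gs : Type u} [AddCommGroup Gs] [TopologicalSpace Gs] [LCAtlas Gs]

/-- `J` is a group-valued momentum map with respect to the duality `κ`. -/
structure IsMomentumMap (ω : BilinField M) (κ : lieAlgAdd Gs →ₗ[ℝ] lieAlg G →ₗ[ℝ] ℝ)
    (J : M → Gs) : Prop where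
  smooth : Smooth J
  momentum : ∀ (m : M) (w : tangent m) (ξ : lieAlg G),
    ω m (infAct ξ m) w + κ (logDeriv J m w) ξ = 0

end Forms

/-! ### Normal forms -/

/-- The infinitesimal action `ξ · x` of a linear representation. -/
def infRep {H : Type u} [Group H] [TopologicalSpace H] [LCAtlas H] {E : LCS.{u}}
    (ρ : Representation ℝ H E) (ξ : lieAlg H) (x : E) : E :=
  dirDeriv (fun e => ρ ((chartAt (1 : H)).hom.symm e) x) ((chartAt (1 : H)).hom 1) ξ

/-- The stabilizer of a vector under a linear representation. -/
def linStabilizer {H : Type u} [Group H] {E : LCS.{u}} (ρ : Representation ℝ H E) (x : E) :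
    Subgroup H where
  carrier := {h | ρ h x = x}
  mul_mem' := by
    intro a b ha hb
    simp only [mem_ofPred_eq] at ha hb ⊢
    rw [map_mul, Module.End.mul_apply, hb, ha]
  one_mem' := by simp
  inv_mem' := by
    intro a ha
    simp only [mem_ofPred_eq] at ha ⊢
    calc ρ a⁻¹ x = ρ a⁻¹ (ρ a x) := by rw [ha]
      _ = x := by rw [← Module.End.mul_apply, ← map_mul]; simp

/-- An abstract equivariant normal form `(H, X, Y, f̂, f_sing)` with `X = Ker ⊕ Coim` and
`Y = Coker ⊕ Im`. -/
structure EquivariantNormalForm (H : Type u) [Group H] [TopologicalSpace H] [LCAtlas H]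
    (Y : LCS.{u}) : Type (u + 1) where
  lie : IsLCLieGroup H
  compact : CompactSpace H
  Ker : LCS.{u}
  Coim : LCS.{u}
  Coker : Submodule ℝ Y
  Im : Submodule ℝ Y
  decomposition : IsHomeomorph (fun p : Coker × Im => (p.1 : Y) + (p.2 : Y))
  repKer : Representation ℝ H Ker
  repCoim : Representation ℝ H Coim
  repY : Representation ℝ H Y
  continuous_repKer : Continuous (fun p : H × Ker => repKer p.1 p.2)
  continuous_repCoim : Continuous (fun p : H × Coim => repCoim p.1 p.2)
  continuous_repY : Continuous (fun p : H × Y => repY p.1 p.2)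
  invariant_Coker : ∀ h, ∀ y ∈ Coker, repY h y ∈ Coker
  invariant_Im : ∀ h, ∀ y ∈ Im, repY h y ∈ Im
  core : Coim ≃L[ℝ] Im
  equivariant_core : ∀ h x, (core (repCoim h x) : Y) = repY h (core x)
  U : Set (Ker × Coim)
  isOpen_U : IsOpen U
  zero_mem : 0 ∈ U
  invariant_U : ∀ h, ∀ x ∈ U, (repKer h x.1, repCoim h x.2) ∈ U
  sing : Ker × Coim → Y
  sing_mem : ∀ x ∈ U, sing x ∈ Coker
  smooth_sing : BSmoothOn U sing
  equivariant_sing : ∀ h, ∀ x ∈ U, sing (repKer h x.1, repCoim h x.2) = repY h (sing x)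
  sing_zero : ∀ x₂ : Coim, (0, x₂) ∈ U → sing (0, x₂) = 0
  deriv_sing : ∀ w, dirDeriv sing 0 w = 0

/-- The linear `H`-action on `X = Ker ⊕ Coim`. -/
def EquivariantNormalForm.act {H : Type u} [Group H] [TopologicalSpace H] [LCAtlas H] {Y : LCS.{u}}
    (𝒩 : EquivariantNormalForm H Y) (h : H) (x : 𝒩.Ker × 𝒩.Coim) : 𝒩.Ker × 𝒩.Coim :=
  (𝒩.repKer h x.1, 𝒩.repCoim h x.2)

/-- An abstract Marle-Guillemin-Sternberg normal form `(H, X, 𝔤*, Ĵ, J_sing, ω̄)`, with respect to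
a pairing `κ` of `𝔤*` and `𝔤` and an identification `j` of the Lie algebra of `H` with a subspace
of `𝔤`. The condition `Coker = 𝔥*` says that `κ` puts `Coker` and `𝔥` in duality. -/
structure MGSNormalForm (H : Type u) [Group H] [TopologicalSpace H] [LCAtlas H]
    {Y 𝔤 : LCS.{u}} (κ : Y →ₗ[ℝ] 𝔤 →ₗ[ℝ] ℝ) (j : lieAlg H → 𝔤) : Type (u + 1) extends
    EquivariantNormalForm H Y where
  coker_left : ∀ η ∈ Coker, (∀ ξ, κ η (j ξ) = 0) → η = 0
  coker_right : ∀ ξ, (∀ η ∈ Coker, κ η (j ξ) = 0) → ξ = 0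
  form : Ker → Ker →ₗ[ℝ] Ker →ₗ[ℝ] ℝ
  closed_form : IsClosedTwoFormOn {x : Ker | (x, (0 : Coim)) ∈ U} (fun x w₁ w₂ => form x w₁ w₂)
  invariant_form : ∀ h, ∀ x : Ker, (x, (0 : Coim)) ∈ U → ∀ w₁ w₂ : Ker,
    form (repKer h x) (repKer h w₁) (repKer h w₂) = form x w₁ w₂
  symplectic_zero : ∀ w : Ker, (∀ w', form 0 w w' = 0) → w = 0
  momentum : ∀ x : Ker, (x, (0 : Coim)) ∈ U → ∀ (w : Ker) (ξ : lieAlg H),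
    form x (infRep repKer ξ x) w + κ (dirDeriv sing (x, (0 : Coim)) (w, (0 : Coim))) (j ξ) = 0

/-- A strong normal form. -/
def MGSNormalForm.IsStrong {H : Type u} [Group H] [TopologicalSpace H] [LCAtlas H]
    {Y 𝔤 : LCS.{u}} {κ : Y →ₗ[ℝ] 𝔤 →ₗ[ℝ] ℝ} {j : lieAlg H → 𝔤} (𝒩 : MGSNormalForm H κ j) : Prop :=
  ∀ x : 𝒩.Ker, (x, (0 : 𝒩.Coim)) ∈ 𝒩.U → 𝒩.form x = 𝒩.form 0 ∧
    ∀ ξ : lieAlg H, κ (𝒩.sing (x, 0)) (j ξ) = 1 / 2 * 𝒩.form 0 x (infRep 𝒩.repKer ξ x)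

section Pieces

variable {M G Gs : Type u} [Group G] [MulAction G M] [MulAction G Gs]

/-- The points of `J⁻¹(μ)` of orbit type `c` for the action of `G_μ`. -/
def piece (J : M → Gs) (μ : Gs) (c : Set (Subgroup (MulAction.stabilizer G μ))) : Set M :=
  {m | orbitType (MulAction.stabilizer G μ) m = c} ∩ J ⁻¹' {μ}

theorem piece_subset (J : M → Gs) (μ : Gs) (c : Set (Subgroup (MulAction.stabilizer G μ))) :
    piece J μ c ⊆ J ⁻¹' {μ} := inter_subset_right

end Pieces

section Reduction

variable {M G Gs : Type u} [TopologicalSpace M] [LCAtlas M]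
  [Group G] [TopologicalSpace G] [LCAtlas G] [AddCommGroup Gs] [TopologicalSpace Gs] [LCAtlas Gs]
  [MulAction G M] [MulAction G Gs]

variable (G) in
/-- The stabilizer `G_μ`. -/
abbrev StabMu (μ : Gs) : Type u := MulAction.stabilizer G μ

variable (G) in
/-- The stabilizer of `m` in `G_μ`. For `μ = J m` with `J` equivariant, it coincides with `G_m`. -/
abbrev StabPt (μ : Gs) (m : M) : Type u := MulAction.stabilizer (StabMu G μ) m

variable (G) in
/-- The embedding of the Lie algebra of `G_m` into that of `G`. -/
def stabLie (μ : Gs) (m : M) (ξ : lieAlg (StabPt G μ m)) : lieAlg G :=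
  tmap (fun h : StabPt G μ m => ((h : StabMu G μ) : G)) 1 1 ξ

/-- `J` can be brought into the normal form `𝒩` at the point `m` with `J m = μ`. -/
def IsBroughtInto (ω : BilinField M) {κ : lieAlgAdd Gs →ₗ[ℝ] lieAlg G →ₗ[ℝ] ℝ} (J : M → Gs) {μ : Gs}
    {m : M} (𝒩 : MGSNormalForm (StabPt G μ m) κ (stabLie G μ m)) : Prop :=
  ∃ (S : Set M) (ι : 𝒩.Ker × 𝒩.Coim → S) (ρ : OpenPartialHomeomorph Gs (lieAlgAdd Gs)),
    IsSlice (StabMu G μ) m S ∧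
    IsSliceDiffeo m S 𝒩.act 𝒩.U ι ∧
    -- `ρ` is an equivariant chart at `μ`
    IsSmoothChart ⟨lieAlgAdd Gs, ρ⟩ ∧ μ ∈ ρ.source ∧ ρ μ = 0 ∧
    (∀ (h : StabPt G μ m), ∀ η ∈ ρ.source, ((h : StabMu G μ) : G) • η ∈ ρ.source ∧
      ρ (((h : StabMu G μ) : G) • η) = 𝒩.repY h (ρ η)) ∧
    (∀ s ∈ S, J s ∈ ρ.source) ∧
    -- the normal form diagram
    (∀ x ∈ 𝒩.U, (𝒩.core x.2 : lieAlgAdd Gs) + 𝒩.sing x ∈ ρ.target ∧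
      ∀ g : StabMu G μ, J (g • (ι x : M)) =
        (g : G) • ρ.symm ((𝒩.core x.2 : lieAlgAdd Gs) + 𝒩.sing x)) ∧
    -- the pull-back of `ω` to `Ker` is the form of `𝒩`
    ∀ x : 𝒩.Ker, (x, (0 : 𝒩.Coim)) ∈ 𝒩.U → ∀ w₁ w₂ : 𝒩.Ker,
      ω (ι (x, 0))
        (dirDeriv (fun y : 𝒩.Ker => (chartAt (ι (x, 0) : M)).hom (ι (y, 0))) x w₁)
        (dirDeriv (fun y : 𝒩.Ker => (chartAt (ι (x, 0) : M)).hom (ι (y, 0))) x w₂) =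
      𝒩.form x w₁ w₂

variable (G) in
/-- `c` is an orbit type of the action of `G_μ` on `J⁻¹(μ)`. -/
def IsLevelType (J : M → Gs) (μ : Gs) (c : Set (Subgroup (StabMu G μ))) : Prop :=
  ∃ m : M, J m = μ ∧ orbitType (StabMu G μ) m = c

/-- The approximation property. -/
def HasApproximation (J : M → Gs) {μ : Gs} {κ : lieAlgAdd Gs →ₗ[ℝ] lieAlg G →ₗ[ℝ] ℝ}
    {m : M} (𝒩 : MGSNormalForm (StabPt G μ m) κ (stabLie G μ m)) : Prop :=
  ∀ c, IsLevelType G J μ c → TypeLE c (orbitType (StabMu G μ) m) →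
    ∃ x : 𝒩.Ker, (x, (0 : 𝒩.Coim)) ∈ 𝒩.U ∧ 𝒩.sing (x, 0) = 0 ∧
      conjClass ((linStabilizer 𝒩.repKer x).map
        (MulAction.stabilizer (StabMu G μ) m).subtype) = c

/-- The projection of `piece J μ c` onto its quotient by `G_μ`, the latter with the manifold
structure `𝒮`. -/
def pieceProj (J : M → Gs) (μ : Gs) (c : Set (Subgroup (StabMu G μ)))
    (𝒮 : SmoothStructure (OrbitQuotient (StabMu G μ) (piece J μ c))) :
    piece J μ c → 𝒮.Carrier :=
  fun s => 𝒮.into (Quotient.mk (orbitSetoid (StabMu G μ) (piece J μ c)) s)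

end Reduction

/-- The manifolds `N i`, embedded by the maps `j i` as subsets of the space `X`, form a
stratification of `X`. -/
structure IsStratification (X : Type u) [TopologicalSpace X] {I : Type v} (N : I → Type u)
    [∀ i, TopologicalSpace (N i)] [∀ i, LCAtlas (N i)] (j : ∀ i, N i → X) : Prop where
  t2 : T2Space X
  nonempty : ∀ i, Nonempty (N i)
  disjoint : ∀ i i', i ≠ i' → Disjoint (range (j i)) (range (j i'))
  cover : ⋃ i, range (j i) = univ
  manifold : ∀ i, IsLCManifold (N i)
  embedding : ∀ i, IsEmbedding (j i)
  locallyClosed : ∀ i, IsLocallyClosed (range (j i))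
  frontier : ∀ i i', i ≠ i' → (range (j i) ∩ closure (range (j i'))).Nonempty →
    range (j i) ⊆ closure (range (j i')) \ range (j i') ∧
      Disjoint (range (j i')) (closure (range (j i)))

end LCRed

end

open LCRed

/-!
# Singular reduction from local normal forms

The whole theorem is local on the level set, and the local model is read off from a tube. Near a
point `m` with `J m = μ`, the slice and the normal form combine to a chart of `M` whose inverse is
`(a, x) ↦ χ a • ι x`, where `χ` is a section of the orbit directions and `x` runs through the slice
representation of the compact group `H`, the stabilizer of `m` (`NormalTube`,
`IsBroughtInto.nonempty_normalTube`). In this chart the level set is given by `x₂ = 0` and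
`sing x₁ = 0`, and the stabilizer of `ι x` is the stabilizer of `x` in `H`. A compact Lie group is
not conjugate to a proper subgroup of itself (`conj_mem_of_conj_le`), so a point of the level set
has the orbit type of `m` exactly when `x` is fixed by `H`. On fixed vectors the momentum relation
forces the derivative of `sing` to vanish, hence `sing` itself
(`MGSNormalForm.exists_sing_eq_zero`). The piece is therefore `A × Ker^H` in the chart, and the orbit
projection is the second projection. This makes the piece a submanifold and gives the charts of the
quotient (`NormalTube.quotChart`, `QuotChart.smoothStructure`); the smooth structure is unique
because a submersion has smooth local sections (`IsSmoothSubmersion.smooth_of_comp`).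

For the stratification, points near `m` have orbit type at most that of `m`
(`eventually_typeLE`). A strong normal form has a homogeneous quadratic `sing`, so a point supplied by
the approximation property can be moved along its ray into `m` without leaving the zero set or
changing its stabilizer (`mem_closure_piece`). So the closure of a piece contains every piece of
larger orbit type that it meets. The order on orbit types is antisymmetric, by the same fact on
compact groups, and this gives the frontier condition (`frontier_of_antisymm`). Properness
of the action makes the quotient Hausdorff.

For the symplectic form, the restriction of `ω` to the piece does not see the orbit directions (the
momentum relation, as `J` is constant on the piece) and is invariant, so in the tube it is the form
of the normal model in the second coordinate (`apply_chartDeriv_val`). It descends to the quotient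
(`reducedForm`), where it is closed because the model form is. It is non-degenerate on fixed
vectors by averaging over `H`: a vector orthogonal to all fixed vectors is orthogonal to the average
of every vector, and so to every vector (`eq_zero_of_form_fixed`). The averages exist because
Mackey completeness yields integrals of smooth curves (`IsMackeyComplete.exists_average`).
-/

universe w

set_option linter.unusedSectionVars false

noncomputable section

namespace LCRed

/-! ### Directional derivatives -/

section DirDeriv

variable {E : Type u} [AddCommGroup E] [Module ℝ E] [TopologicalSpace E]
variable {F : Type v} [AddCommGroup F] [Module ℝ F] [TopologicalSpace F]
variable {Z : Type w} [AddCommGroup Z] [Module ℝ Z] [TopologicalSpace Z]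

theorem HasDirDeriv.dirDeriv_eq [T2Space F] {f : E → F} {x w : E} {y : F}
    (h : HasDirDeriv f x w y) : dirDeriv f x w = y := by
  have hex : ∃ y, HasDirDeriv f x w y := ⟨y, h⟩
  rw [dirDeriv, dif_pos hex]
  exact tendsto_nhds_unique hex.choose_spec h

theorem hasDirDeriv_dirDeriv {f : E → F} {x w : E} (h : ∃ y, HasDirDeriv f x w y) :
    HasDirDeriv f x w (dirDeriv f x w) := by
  rw [dirDeriv, dif_pos h]
  exact h.choose_spec

theorem tendsto_add_smul [ContinuousAdd E] [ContinuousSMul ℝ E] (x w : E) :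
    Tendsto (fun t : ℝ => x + t • w) (𝓝 0) (𝓝 x) := by
  have : Continuous (fun t : ℝ => x + t • w) := by fun_prop
  simpa using this.tendsto 0

theorem HasDirDeriv.congr [ContinuousAdd E] [ContinuousSMul ℝ E] {f g : E → F} {x w : E} {y : F}
    (h : HasDirDeriv f x w y) (hfg : f =ᶠ[𝓝 x] g) : HasDirDeriv g x w y := by
  refine Tendsto.congr' ?_ h
  have h1 := (tendsto_add_smul x w).eventually hfg
  filter_upwards [nhdsWithin_le_nhds h1] with t ht
  rw [ht, hfg.eq_of_nhds]

theorem dirDeriv_congr [ContinuousAdd E] [ContinuousSMul ℝ E] {f g : E → F} {x w : E}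
    (hfg : f =ᶠ[𝓝 x] g) : dirDeriv f x w = dirDeriv g x w := by
  have : HasDirDeriv f x w = HasDirDeriv g x w := by
    funext y
    exact propext ⟨fun h => h.congr hfg, fun h => h.congr hfg.symm⟩
  unfold dirDeriv
  congr!

theorem HasDirDeriv.smul_dir [ContinuousSMul ℝ F] {f : E → F} {x w : E} {y : F}
    (h : HasDirDeriv f x w y) (c : ℝ) : HasDirDeriv f x (c • w) (c • y) := by
  rcases eq_or_ne c 0 with rfl | hc
  · simp only [HasDirDeriv, zero_smul, smul_zero, add_zero, sub_self]
    exact tendsto_const_nhds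
  · have h1 : Tendsto (fun t : ℝ => t * c) (𝓝[≠] 0) (𝓝[≠] 0) := by
      refine tendsto_nhdsWithin_iff.2 ⟨?_, ?_⟩
      · have : Continuous (fun t : ℝ => t * c) := by fun_prop
        simpa using (this.tendsto 0).mono_left nhdsWithin_le_nhds
      · filter_upwards [self_mem_nhdsWithin] with t ht
        exact mul_ne_zero ht hc
    have h2 := (h.comp h1).const_smul c
    refine h2.congr fun t => ?_
    simp only [Function.comp, smul_smul, mul_inv]
    congr 1
    field_simp

theorem hasDirDeriv_const [ContinuousSMul ℝ F] (c : F) (x w : E) :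
    HasDirDeriv (fun _ : E => c) x w 0 := by
  simp only [HasDirDeriv, sub_self, smul_zero]
  exact tendsto_const_nhds

theorem dirDeriv_const [ContinuousSMul ℝ F] [T2Space F] (c : F) (x w : E) :
    dirDeriv (fun _ : E => c) x w = 0 :=
  (hasDirDeriv_const c x w).dirDeriv_eq

theorem hasDirDeriv_clm (L : E →L[ℝ] F) (x w : E) :
    HasDirDeriv L x w (L w) := by
  refine tendsto_const_nhds.congr' ?_
  filter_upwards [self_mem_nhdsWithin] with t (ht : t ≠ 0)
  simp [smul_smul, inv_mul_cancel₀ ht]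

theorem HasDirDeriv.clm_comp {f : E → F} {x w : E} {y : F} (h : HasDirDeriv f x w y)
    (L : F →L[ℝ] Z) : HasDirDeriv (fun e => L (f e)) x w (L y) := by
  refine ((L.continuous.tendsto y).comp h).congr fun t => ?_
  simp

theorem HasDirDeriv.comp_clm {L : E →L[ℝ] F} {f : F → Z} {x w : E} {y : Z}
    (h : HasDirDeriv f (L x) (L w) y) : HasDirDeriv (fun e => f (L e)) x w y := by
  refine Tendsto.congr (fun t => ?_) h
  simp

theorem HasDirDeriv.prodMk {f : E → F} {g : E → Z} {x w : E} {y : F} {z : Z}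
    (hf : HasDirDeriv f x w y) (hg : HasDirDeriv g x w z) :
    HasDirDeriv (fun e => (f e, g e)) x w (y, z) :=
  Tendsto.prodMk_nhds hf hg

theorem HasDirDeriv.add [ContinuousAdd F] {f g : E → F} {x w : E} {y z : F}
    (hf : HasDirDeriv f x w y) (hg : HasDirDeriv g x w z) :
    HasDirDeriv (fun e => f e + g e) x w (y + z) := by
  refine (Tendsto.add hf hg).congr fun t => ?_
  rw [← smul_add, add_sub_add_comm]

theorem HasDirDeriv.const_smul [ContinuousConstSMul ℝ F] {f : E → F} {x w : E} {y : F}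
    (hf : HasDirDeriv f x w y) (c : ℝ) : HasDirDeriv (fun e => c • f e) x w (c • y) := by
  refine (Tendsto.const_smul hf c).congr fun t => ?_
  rw [smul_comm, smul_sub]

/-- The restriction of `f` to the line through `x` in the direction `w`. -/
theorem HasDirDeriv.line {f : E → F} {x w : E} {t : ℝ} {y : F}
    (h : HasDirDeriv f (x + t • w) w y) : HasDirDeriv (fun s : ℝ => f (x + s • w)) t 1 y := by
  refine Tendsto.congr (fun s => ?_) h
  simp only [smul_eq_mul, mul_one, add_smul, add_assoc]

theorem HasDirDeriv.hasDerivAt {g : ℝ → ℝ} {t y : ℝ} (h : HasDirDeriv g t 1 y) :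
    HasDerivAt g y t := by
  rw [hasDerivAt_iff_tendsto_slope_zero]
  simpa [HasDirDeriv] using h

theorem HasDirDeriv.continuousAt [IsTopologicalAddGroup F] [ContinuousSMul ℝ F]
    {g : ℝ → F} {t : ℝ} {y : F} (h : HasDirDeriv g t 1 y) : ContinuousAt g t := by
  have h1 : Tendsto (fun s : ℝ => s) (𝓝[≠] 0) (𝓝 0) := nhdsWithin_le_nhds
  have h2 : Tendsto (fun s : ℝ => g (t + s)) (𝓝[≠] 0) (𝓝 (g t)) := by
    have := (h1.smul h).add_const (g t)
    rw [zero_smul, zero_add] at this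
    refine this.congr' ?_
    filter_upwards [self_mem_nhdsWithin] with s (hs : s ≠ 0)
    simp [smul_smul, mul_inv_cancel₀ hs]
  have h3 : Tendsto (fun s : ℝ => g (t + s)) (𝓝 0) (𝓝 (g t)) := by
    rw [← nhdsNE_sup_pure, tendsto_sup]
    refine ⟨h2, ?_⟩
    rw [tendsto_pure_left]
    intro s hs
    simpa using mem_of_mem_nhds hs
  have h4 : Tendsto (fun s : ℝ => s - t) (𝓝 t) (𝓝 0) := by
    have : Continuous (fun s : ℝ => s - t) := by fun_prop
    simpa using this.tendsto t
  simpa [ContinuousAt, Function.comp_def] using h3.comp h4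

end DirDeriv

/-! ### The mean value theorem in locally convex spaces -/

section MeanValue

variable {E : Type u} [AddCommGroup E] [Module ℝ E] [TopologicalSpace E]
  [IsTopologicalAddGroup E] [ContinuousSMul ℝ E] [LocallyConvexSpace ℝ E]
variable {F : Type v} [AddCommGroup F] [Module ℝ F] [TopologicalSpace F]
  [IsTopologicalAddGroup F] [ContinuousSMul ℝ F] [LocallyConvexSpace ℝ F] [T2Space F]

theorem tendsto_of_seminorm {ι : Type*} {l : Filter ι} {f : ι → F} {y : F}
    (h : ∀ q : Seminorm ℝ F, Continuous q → ∀ ε > 0, ∀ᶠ i in l, q (f i - y) < ε) :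
    Tendsto f l (𝓝 y) := by
  have hw := with_gaugeSeminormFamily (𝕜 := ℝ) (E := F)
  rw [hw.tendsto_nhds]
  exact fun i ε hε => h _ (hw.continuous_seminorm i) ε hε

theorem eq_zero_of_seminorm {y : F} (h : ∀ q : Seminorm ℝ F, Continuous q → q y = 0) : y = 0 := by
  have h1 : Tendsto (fun _ : ℕ => y) atTop (𝓝 0) :=
    tendsto_of_seminorm fun q hq ε hε => Eventually.of_forall fun _ => by
      simpa [h q hq] using hε
  exact tendsto_nhds_unique tendsto_const_nhds h1

/-- By the Hahn-Banach theorem, every value of a continuous seminorm is attained by a continuous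
functional that it dominates. -/
theorem exists_dual_seminorm (q : Seminorm ℝ F) (hq : Continuous q) (y : F) :
    ∃ l : F →L[ℝ] ℝ, l y = q y ∧ ∀ z, |l z| ≤ q z := by
  rcases eq_or_ne y 0 with rfl | hy
  · exact ⟨0, by simp, fun z => by simp⟩
  obtain ⟨g, hg, hgq⟩ := Module.Dual.exists_extension_of_le_seminorm_real (ℝ ∙ y)
    (q y • (LinearEquiv.coord ℝ F y hy).toLinearMap) (p := q) (by
      rintro ⟨x, hx⟩
      obtain ⟨c, rfl⟩ := Submodule.mem_span_singleton.1 hx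
      have : LinearEquiv.coord ℝ F y hy ⟨c • y, hx⟩ = c := by
        have h1 : (⟨c • y, hx⟩ : ℝ ∙ y) = c • ⟨y, Submodule.mem_span_singleton_self y⟩ := rfl
        rw [h1, map_smul, LinearEquiv.coord_self, smul_eq_mul, mul_one]
      simp only [LinearMap.smul_apply, LinearEquiv.coe_coe, this, smul_eq_mul, map_smul_eq_mul,
        Real.norm_eq_abs]
      rw [mul_comm]
      exact mul_le_mul_of_nonneg_right (le_abs_self c) (apply_nonneg q y))
  have hgc : Continuous g := by
    refine continuous_of_continuousAt_zero g ?_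
    rw [ContinuousAt, map_zero]
    have h0 : Tendsto q (𝓝 0) (𝓝 0) := by simpa using hq.tendsto 0
    refine squeeze_zero_norm (fun z => ?_) h0
    exact hgq z
  refine ⟨⟨g, hgc⟩, ?_, hgq⟩
  have := hg ⟨y, Submodule.mem_span_singleton_self y⟩
  simpa [LinearEquiv.coord_self] using this

/-- The mean value theorem for a continuous seminorm. -/
theorem seminorm_sub_le (q : Seminorm ℝ F) (hq : Continuous q) {g g' : ℝ → F} {C : ℝ}
    (hg : ∀ t ∈ Icc (0 : ℝ) 1, HasDirDeriv g t 1 (g' t))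
    (hC : ∀ t ∈ Icc (0 : ℝ) 1, q (g' t) ≤ C) : q (g 1 - g 0) ≤ C := by
  obtain ⟨l, hl, hlq⟩ := exists_dual_seminorm q hq (g 1 - g 0)
  have h1 : ∀ t ∈ Icc (0 : ℝ) 1,
      HasDerivWithinAt (fun s => l (g s)) (l (g' t)) (Icc 0 1) t := fun t ht =>
    ((hg t ht).clm_comp l).hasDerivAt.hasDerivWithinAt
  have h2 := norm_image_sub_le_of_norm_deriv_le_segment_01' h1
    (fun t ht => (hlq (g' t)).trans (hC t (Ico_subset_Icc_self ht)))
  rw [← hl, map_sub]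
  exact (le_abs_self _).trans h2

/-- A map with zero derivative along a segment takes the same value at its endpoints. -/
theorem eq_of_dirDeriv_eq_zero {f : E → F} {x w : E}
    (h : ∀ t ∈ Icc (0 : ℝ) 1, HasDirDeriv f (x + t • w) w 0) : f (x + w) = f x := by
  refine sub_eq_zero.1 (eq_zero_of_seminorm fun q hq => ?_)
  have h1 := seminorm_sub_le q hq (g := fun s => f (x + s • w)) (g' := fun _ => 0) (C := 0)
    (fun t ht => (h t ht).line) (by simp)
  simp only [one_smul, zero_smul, add_zero] at h1
  exact le_antisymm h1 (apply_nonneg q _)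

end MeanValue

/-! ### Maps of class `C^n` -/

section ContDiff

variable {E : Type u} [AddCommGroup E] [Module ℝ E] [TopologicalSpace E]
  [IsTopologicalAddGroup E] [ContinuousSMul ℝ E] [LocallyConvexSpace ℝ E]
variable {F : Type v} [AddCommGroup F] [Module ℝ F] [TopologicalSpace F]
  [IsTopologicalAddGroup F] [ContinuousSMul ℝ F] [LocallyConvexSpace ℝ F] [T2Space F]
variable {Z : Type w} [AddCommGroup Z] [Module ℝ Z] [TopologicalSpace Z]
  [IsTopologicalAddGroup Z] [ContinuousSMul ℝ Z] [LocallyConvexSpace ℝ Z] [T2Space Z]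

theorem BContDiffOn.continuousOn {n : ℕ} {U : Set E} {f : E → F} (h : BContDiffOn n U f) :
    ContinuousOn f U := by
  cases n with
  | zero => exact h
  | succ n => exact h.1

theorem BContDiffOn.mono : ∀ (n : ℕ) {E : Type u} [AddCommGroup E] [Module ℝ E]
    [TopologicalSpace E] {U V : Set E} {f : E → F}, BContDiffOn n U f → V ⊆ U →
      BContDiffOn n V f
  | 0, _, _, _, _, _, _, _, h, hV => ContinuousOn.mono h hV
  | n + 1, _, _, _, _, _, _, _, h, hV =>
    ⟨h.1.mono hV, fun x hx => h.2.1 x (hV hx),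
      BContDiffOn.mono n h.2.2 (prod_mono hV Subset.rfl)⟩

theorem BContDiffOn.of_succ : ∀ (n : ℕ) {E : Type u} [AddCommGroup E] [Module ℝ E]
    [TopologicalSpace E] {U : Set E} {f : E → F}, BContDiffOn (n + 1) U f → BContDiffOn n U f
  | 0, _, _, _, _, _, _, h => h.1
  | n + 1, _, _, _, _, _, _, h => ⟨h.1, h.2.1, BContDiffOn.of_succ n h.2.2⟩

theorem BContDiffOn.one_of_succ {n : ℕ} {U : Set E} {f : E → F} (h : BContDiffOn (n + 1) U f) :
    BContDiffOn 1 U f :=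
  ⟨h.1, h.2.1, h.2.2.continuousOn⟩

theorem BContDiffOn.congr : ∀ (n : ℕ) {E : Type u} [AddCommGroup E] [Module ℝ E]
    [TopologicalSpace E] [IsTopologicalAddGroup E] [ContinuousSMul ℝ E] {U : Set E} {f g : E → F},
      BContDiffOn n U f → IsOpen U → EqOn f g U → BContDiffOn n U g
  | 0, _, _, _, _, _, _, _, _, _, h, _, hfg => ContinuousOn.congr h hfg.symm
  | n + 1, _, _, _, _, _, _, _, f, g, h, hU, hfg => by
    have key : ∀ x ∈ _, f =ᶠ[𝓝 x] g := fun x hx => hfg.eventuallyEq_of_mem (hU.mem_nhds hx)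
    refine ⟨h.1.congr hfg.symm, fun x hx w => ?_, ?_⟩
    · obtain ⟨y, hy⟩ := h.2.1 x hx w
      exact ⟨y, hy.congr (key x hx)⟩
    · exact BContDiffOn.congr n h.2.2 (hU.prod isOpen_univ) fun p hp => dirDeriv_congr (key _ hp.1)

theorem BContDiffOn.of_locally : ∀ (n : ℕ) {E : Type u} [AddCommGroup E] [Module ℝ E]
    [TopologicalSpace E] {U : Set E} {f : E → F},
      (∀ x ∈ U, ∃ V, IsOpen V ∧ x ∈ V ∧ BContDiffOn n (U ∩ V) f) → BContDiffOn n U f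
  | 0, _, _, _, _, _, _, h => fun x hx => by
    obtain ⟨V, hV, hxV, hf⟩ := h x hx
    exact (hf x ⟨hx, hxV⟩).mono_of_mem_nhdsWithin
      (inter_mem self_mem_nhdsWithin (mem_nhdsWithin_of_mem_nhds (hV.mem_nhds hxV)))
  | n + 1, _, _, _, _, U, f, h => by
    refine ⟨BContDiffOn.of_locally 0 fun x hx => ?_, fun x hx w => ?_,
      BContDiffOn.of_locally n fun p hp => ?_⟩
    · obtain ⟨V, hV, hxV, hf⟩ := h x hx
      exact ⟨V, hV, hxV, hf.1⟩
    · obtain ⟨V, hV, hxV, hf⟩ := h x hx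
      exact hf.2.1 x ⟨hx, hxV⟩ w
    · obtain ⟨V, hV, hxV, hf⟩ := h p.1 hp.1
      refine ⟨V ×ˢ univ, hV.prod isOpen_univ, ⟨hxV, trivial⟩, ?_⟩
      rw [prod_inter_prod, univ_inter]
      exact hf.2.2

/-- The difference quotients of a `C^1` map converge uniformly in base point and direction. -/
theorem BContDiffOn.tendsto_quotient {U : Set E} {f : E → F} (hf : BContDiffOn 1 U f)
    (hU : IsOpen U) {x w : E} (hx : x ∈ U) {ι : Type*} {l : Filter ι} {a b : ι → E} {t : ι → ℝ}
    (ha : Tendsto a l (𝓝 x)) (hb : Tendsto b l (𝓝 w)) (ht : Tendsto t l (𝓝[≠] 0)) :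
    Tendsto (fun i => (t i)⁻¹ • (f (a i + t i • b i) - f (a i))) l (𝓝 (dirDeriv f x w)) := by
  refine tendsto_of_seminorm fun q hq ε hε => ?_
  have hcont : ContinuousAt (fun p : E × E => dirDeriv f p.1 p.2) (x, w) :=
    (show ContinuousOn _ _ from hf.2.2).continuousAt
      ((hU.prod isOpen_univ).mem_nhds ⟨hx, trivial⟩)
  have hq' : Continuous (fun y => q (y - dirDeriv f x w)) := by fun_prop
  have h1 : ∀ᶠ p : E × E in 𝓝 (x, w), q (dirDeriv f p.1 p.2 - dirDeriv f x w) < ε / 2 := by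
    have := (hq'.tendsto _).comp hcont
    refine this.eventually (gt_mem_nhds ?_)
    simpa using hε
  rw [nhds_prod_eq] at h1
  obtain ⟨N₁, hN₁, N₂, hN₂, hN⟩ := Filter.mem_prod_iff.1 h1
  obtain ⟨N, ⟨hNx, hNc⟩, hNs⟩ := (LocallyConvexSpace.convex_basis (𝕜 := ℝ) x).mem_iff.1
    (inter_mem hN₁ (hU.mem_nhds hx))
  have ht0 : Tendsto t l (𝓝 0) := ht.mono_right nhdsWithin_le_nhds
  have hab : Tendsto (fun i => a i + t i • b i) l (𝓝 x) := by
    simpa using ha.add (ht0.smul hb)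
  filter_upwards [ha hNx, hab hNx, hb hN₂, ht self_mem_nhdsWithin] with i h1 h2 h3 h4
  have h4 : t i ≠ 0 := h4
  have hseg : ∀ s ∈ Icc (0 : ℝ) 1, a i + s • (t i • b i) ∈ N := fun s hs =>
    hNc.add_smul_mem h1 h2 hs
  have key := seminorm_sub_le q hq
    (g := fun s : ℝ => (t i)⁻¹ • f (a i + s • (t i • b i)) + s • (- dirDeriv f x w))
    (g' := fun s => dirDeriv f (a i + s • (t i • b i)) (b i) + - dirDeriv f x w) (C := ε / 2)
    (fun s hs => by
      refine HasDirDeriv.add ?_ ?_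
      · have h5 := (hasDirDeriv_dirDeriv
          (hf.2.1 _ (hNs (hseg s hs)).2 (b i))).smul_dir (t i)
        have h6 := h5.line.const_smul (t i)⁻¹
        rwa [smul_smul, inv_mul_cancel₀ h4, one_smul] at h6
      · have h7 := hasDirDeriv_clm
          ((ContinuousLinearMap.id ℝ ℝ).smulRight (- dirDeriv f x w)) s 1
        rw [ContinuousLinearMap.smulRight_apply, ContinuousLinearMap.id_apply, one_smul] at h7
        exact h7)
    (fun s hs => by
      rw [← sub_eq_add_neg]
      exact (hN (mk_mem_prod (hNs (hseg s hs)).1 h3)).le)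
  refine lt_of_le_of_lt (le_of_eq ?_) (lt_of_le_of_lt key (half_lt_self hε))
  congr 1
  simp only [one_smul, zero_smul, add_zero, smul_sub]
  abel

theorem BContDiffOn.dirDeriv_add {U : Set E} {f : E → F} (hf : BContDiffOn 1 U f)
    (hU : IsOpen U) {x : E} (hx : x ∈ U) (v w : E) :
    dirDeriv f x (v + w) = dirDeriv f x v + dirDeriv f x w := by
  have ht : Tendsto (fun t : ℝ => t) (𝓝[≠] 0) (𝓝[≠] 0) := tendsto_id
  have h1 := hf.tendsto_quotient hU hx
    ((tendsto_add_smul x v).mono_left nhdsWithin_le_nhds) (tendsto_const_nhds (x := w)) ht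
  have h2 := hasDirDeriv_dirDeriv (hf.2.1 x hx v)
  refine HasDirDeriv.dirDeriv_eq ((Tendsto.add h2 h1).congr fun t => ?_)
  rw [← smul_add]
  congr 1
  rw [smul_add, ← add_assoc]
  abel

theorem BContDiffOn.dirDeriv_smul {U : Set E} {f : E → F} (hf : BContDiffOn 1 U f)
    {x : E} (hx : x ∈ U) (c : ℝ) (w : E) :
    dirDeriv f x (c • w) = c • dirDeriv f x w :=
  ((hasDirDeriv_dirDeriv (hf.2.1 x hx w)).smul_dir c).dirDeriv_eq

/-- The derivative of a `C^1` map at a point, as a continuous linear map. -/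
def BContDiffOn.derivAt {U : Set E} {f : E → F} (hf : BContDiffOn 1 U f)
    (hU : IsOpen U) {x : E} (hx : x ∈ U) : E →L[ℝ] F where
  toFun := dirDeriv f x
  map_add' := hf.dirDeriv_add hU hx
  map_smul' := hf.dirDeriv_smul hx
  cont := (show ContinuousOn _ _ from hf.2.2).comp_continuous
    (f := fun w => (x, w)) (by fun_prop) (fun _ => ⟨hx, trivial⟩)

theorem BContDiffOn.hasDirDeriv_comp {V : Set F} {g : F → Z} (hg : BContDiffOn 1 V g)
    (hV : IsOpen V) {f : E → F} {x w : E} {y : F} (hx : f x ∈ V) (hf : HasDirDeriv f x w y) :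
    HasDirDeriv (fun e => g (f e)) x w (dirDeriv g (f x) y) := by
  have h1 := hg.tendsto_quotient hV hx (tendsto_const_nhds (x := f x)) hf
    (show Tendsto (fun t : ℝ => t) (𝓝[≠] 0) (𝓝[≠] 0) from tendsto_id)
  refine h1.congr' ?_
  filter_upwards [self_mem_nhdsWithin] with t (ht : t ≠ 0)
  simp [smul_smul, mul_inv_cancel₀ ht]

theorem BContDiffOn.comp_clm : ∀ (n : ℕ) {E : Type u} [AddCommGroup E] [Module ℝ E]
    [TopologicalSpace E] {F : Type v} [AddCommGroup F] [Module ℝ F] [TopologicalSpace F]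
    (L : E →L[ℝ] F) {U : Set F} {f : F → Z},
      BContDiffOn n U f → BContDiffOn n (L ⁻¹' U) (fun e => f (L e))
  | 0, _, _, _, _, _, _, _, _, L, _, _, h =>
    ContinuousOn.comp h L.continuous.continuousOn (mapsTo_preimage _ _)
  | n + 1, _, _, _, _, _, _, _, _, L, U, f, h => by
    refine ⟨h.1.comp L.continuous.continuousOn (mapsTo_preimage _ _), fun x hx w => ?_, ?_⟩
    · obtain ⟨y, hy⟩ := h.2.1 (L x) hx (L w)
      exact ⟨y, hy.comp_clm⟩
    · have h1 := BContDiffOn.comp_clm n (L.prodMap L) h.2.2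
      have h2 : (L.prodMap L) ⁻¹' (U ×ˢ univ) = (L ⁻¹' U) ×ˢ univ := by ext; simp
      have h3 : ∀ x w, dirDeriv (fun e => f (L e)) x w = dirDeriv f (L x) (L w) := fun x w => by
        have : HasDirDeriv (fun e => f (L e)) x w = HasDirDeriv f (L x) (L w) := by
          funext y
          simp [HasDirDeriv]
        unfold dirDeriv
        congr!
      rw [h2] at h1
      simp only [h3]
      exact h1

theorem BContDiffOn.clm_comp : ∀ (n : ℕ) {E : Type u} [AddCommGroup E] [Module ℝ E]
    [TopologicalSpace E] [IsTopologicalAddGroup E] [ContinuousSMul ℝ E]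
    (L : F →L[ℝ] Z) {U : Set E} {f : E → F},
      BContDiffOn n U f → IsOpen U → BContDiffOn n U (fun e => L (f e))
  | 0, _, _, _, _, _, _, L, _, _, h, _ => L.continuous.comp_continuousOn h
  | n + 1, _, _, _, _, _, _, L, _, _, h, hU => by
    refine ⟨L.continuous.comp_continuousOn h.1, fun x hx w => ?_, ?_⟩
    · obtain ⟨y, hy⟩ := h.2.1 x hx w
      exact ⟨_, hy.clm_comp L⟩
    · refine BContDiffOn.congr n (BContDiffOn.clm_comp n L h.2.2 (hU.prod isOpen_univ))
        (hU.prod isOpen_univ) fun p hp => ?_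
      exact ((hasDirDeriv_dirDeriv (h.2.1 p.1 hp.1 p.2)).clm_comp L).dirDeriv_eq.symm

theorem BContDiffOn.prodMk : ∀ (n : ℕ) {E : Type u} [AddCommGroup E] [Module ℝ E]
    [TopologicalSpace E] [IsTopologicalAddGroup E] [ContinuousSMul ℝ E]
    {U : Set E} {f : E → F} {g : E → Z},
      BContDiffOn n U f → BContDiffOn n U g → IsOpen U → BContDiffOn n U (fun e => (f e, g e))
  | 0, _, _, _, _, _, _, _, _, _, hf, hg, _ => ContinuousOn.prodMk hf hg
  | n + 1, _, _, _, _, _, _, _, _, _, hf, hg, hU => by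
    refine ⟨hf.1.prodMk hg.1, fun x hx w => ?_, ?_⟩
    · obtain ⟨y, hy⟩ := hf.2.1 x hx w
      obtain ⟨z, hz⟩ := hg.2.1 x hx w
      exact ⟨_, hy.prodMk hz⟩
    · refine BContDiffOn.congr n (BContDiffOn.prodMk n hf.2.2 hg.2.2 (hU.prod isOpen_univ))
        (hU.prod isOpen_univ) fun p hp => ?_
      exact ((hasDirDeriv_dirDeriv (hf.2.1 p.1 hp.1 p.2)).prodMk
        (hasDirDeriv_dirDeriv (hg.2.1 p.1 hp.1 p.2))).dirDeriv_eq.symm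

theorem BContDiffOn.clm : ∀ (n : ℕ) {E : Type u} [AddCommGroup E] [Module ℝ E]
    [TopologicalSpace E] (L : E →L[ℝ] F) (U : Set E), BContDiffOn n U L
  | 0, _, _, _, _, L, _ => L.continuous.continuousOn
  | n + 1, E, _, _, _, L, U => by
    refine ⟨L.continuous.continuousOn, fun x _ w => ⟨_, hasDirDeriv_clm L x w⟩, ?_⟩
    have hd : ∀ x w, dirDeriv L x w = L w := fun x w => (hasDirDeriv_clm L x w).dirDeriv_eq
    simp only [hd]
    exact BContDiffOn.clm n (L.comp (ContinuousLinearMap.snd ℝ E E)) _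

theorem BContDiffOn.const (c : F) (U : Set E) : ∀ n : ℕ, BContDiffOn n U (fun _ => c)
  | 0 => continuousOn_const
  | n + 1 => by
    refine ⟨continuousOn_const, fun x _ w => ⟨0, hasDirDeriv_const c x w⟩, ?_⟩
    simp only [dirDeriv_const]
    exact BContDiffOn.clm n (0 : E × E →L[ℝ] F) _

theorem BContDiffOn.comp : ∀ (n : ℕ) {E : Type u} [AddCommGroup E] [Module ℝ E]
    [TopologicalSpace E] [IsTopologicalAddGroup E] [ContinuousSMul ℝ E] [LocallyConvexSpace ℝ E]
    {F : Type v} [AddCommGroup F] [Module ℝ F] [TopologicalSpace F]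
    [IsTopologicalAddGroup F] [ContinuousSMul ℝ F] [LocallyConvexSpace ℝ F] [T2Space F]
    {U : Set E} {V : Set F} {f : E → F} {g : F → Z},
      BContDiffOn n V g → BContDiffOn n U f → IsOpen U → IsOpen V → MapsTo f U V →
        BContDiffOn n U (fun e => g (f e))
  | 0, _, _, _, _, _, _, _, _, _, _, _, _, _, _, _, _, _, _, _, hg, hf, _, _, h =>
    ContinuousOn.comp hg hf h
  | n + 1, E, _, _, _, _, _, _, F, _, _, _, _, _, _, _, U, V, f, g, hg, hf, hU, hV, h => by
    have hd : ∀ x ∈ U, ∀ w, HasDirDeriv (fun e => g (f e)) x w (dirDeriv g (f x) (dirDeriv f x w)) :=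
      fun x hx w => hg.one_of_succ.hasDirDeriv_comp hV (h hx)
        (hasDirDeriv_dirDeriv (hf.2.1 x hx w))
    refine ⟨hg.1.comp hf.1 h, fun x hx w => ⟨_, hd x hx w⟩, ?_⟩
    have h1 : BContDiffOn n (U ×ˢ (univ : Set E)) (fun p : E × E => f p.1) :=
      ((BContDiffOn.of_succ n hf).comp_clm n (ContinuousLinearMap.fst ℝ E E)).mono n
        (fun p hp => hp.1)
    have h2 := BContDiffOn.prodMk n h1 hf.2.2 (hU.prod isOpen_univ)
    refine BContDiffOn.congr n (BContDiffOn.comp n hg.2.2 h2 (hU.prod isOpen_univ)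
      (hV.prod isOpen_univ) (fun p hp => ⟨h hp.1, trivial⟩)) (hU.prod isOpen_univ) fun p hp => ?_
    exact (hd p.1 hp.1 p.2).dirDeriv_eq.symm

theorem BContDiffOn.add {n : ℕ} {U : Set E} {f g : E → F} (hf : BContDiffOn n U f)
    (hg : BContDiffOn n U g) (hU : IsOpen U) : BContDiffOn n U (fun e => f e + g e) :=
  (BContDiffOn.prodMk n hf hg hU).clm_comp n
    (ContinuousLinearMap.fst ℝ F F + ContinuousLinearMap.snd ℝ F F) hU

end ContDiff

/-! ### Smooth maps between locally convex spaces -/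

section BSmooth

variable {E : Type u} [AddCommGroup E] [Module ℝ E] [TopologicalSpace E]
  [IsTopologicalAddGroup E] [ContinuousSMul ℝ E] [LocallyConvexSpace ℝ E]
variable {F : Type v} [AddCommGroup F] [Module ℝ F] [TopologicalSpace F]
  [IsTopologicalAddGroup F] [ContinuousSMul ℝ F] [LocallyConvexSpace ℝ F] [T2Space F]
variable {Z : Type w} [AddCommGroup Z] [Module ℝ Z] [TopologicalSpace Z]
  [IsTopologicalAddGroup Z] [ContinuousSMul ℝ Z] [LocallyConvexSpace ℝ Z] [T2Space Z]

theorem BSmoothOn.continuousOn {U : Set E} {f : E → F} (h : BSmoothOn U f) : ContinuousOn f U :=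
  (h 0).continuousOn

theorem BSmoothOn.mono {U V : Set E} {f : E → F} (h : BSmoothOn U f) (hV : V ⊆ U) :
    BSmoothOn V f := fun n => (h n).mono n hV

theorem BSmoothOn.congr {U : Set E} {f g : E → F} (h : BSmoothOn U f) (hU : IsOpen U)
    (hfg : EqOn f g U) : BSmoothOn U g := fun n => (h n).congr n hU hfg

theorem BSmoothOn.of_locally {U : Set E} {f : E → F}
    (h : ∀ x ∈ U, ∃ V, IsOpen V ∧ x ∈ V ∧ BSmoothOn (U ∩ V) f) : BSmoothOn U f := fun n =>
  BContDiffOn.of_locally n fun x hx => by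
    obtain ⟨V, hV, hxV, hf⟩ := h x hx
    exact ⟨V, hV, hxV, hf n⟩

theorem BSmoothOn.comp {U : Set E} {V : Set F} {f : E → F} {g : F → Z} (hg : BSmoothOn V g)
    (hf : BSmoothOn U f) (hU : IsOpen U) (hV : IsOpen V) (h : MapsTo f U V) :
    BSmoothOn U (fun e => g (f e)) := fun n => (hg n).comp n (hf n) hU hV h

theorem BSmoothOn.prodMk {U : Set E} {f : E → F} {g : E → Z} (hf : BSmoothOn U f)
    (hg : BSmoothOn U g) (hU : IsOpen U) : BSmoothOn U (fun e => (f e, g e)) := fun n =>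
  (hf n).prodMk n (hg n) hU

theorem bSmoothOn_clm (L : E →L[ℝ] F) (U : Set E) : BSmoothOn U L := fun n => BContDiffOn.clm n L U

theorem bSmoothOn_id [T2Space E] (U : Set E) : BSmoothOn U (fun e : E => e) :=
  bSmoothOn_clm (ContinuousLinearMap.id ℝ E) U

theorem bSmoothOn_const (c : F) (U : Set E) : BSmoothOn U (fun _ => c) := fun n =>
  BContDiffOn.const c U n

theorem BSmoothOn.clm_comp {U : Set E} {f : E → F} (hf : BSmoothOn U f) (hU : IsOpen U)
    (L : F →L[ℝ] Z) : BSmoothOn U (fun e => L (f e)) := fun n => (hf n).clm_comp n L hU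

theorem BSmoothOn.comp_clm {U : Set F} {f : F → Z} (hf : BSmoothOn U f) (L : E →L[ℝ] F) :
    BSmoothOn (L ⁻¹' U) (fun e => f (L e)) := fun n => (hf n).comp_clm n L

theorem BSmoothOn.prodMap [T2Space E] {E' : Type u} [AddCommGroup E'] [Module ℝ E']
    [TopologicalSpace E'] [IsTopologicalAddGroup E'] [ContinuousSMul ℝ E']
    [LocallyConvexSpace ℝ E'] [T2Space E']
    {U : Set E} {V : Set E'} {f : E → F} {g : E' → Z}
    (hf : BSmoothOn U f) (hg : BSmoothOn V g) (hU : IsOpen U) (hV : IsOpen V) :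
    BSmoothOn (U ×ˢ V) (fun p : E × E' => (f p.1, g p.2)) :=
  ((hf.comp_clm (ContinuousLinearMap.fst ℝ E E')).mono fun _ hp => hp.1).prodMk
    ((hg.comp_clm (ContinuousLinearMap.snd ℝ E E')).mono fun _ hp => hp.2) (hU.prod hV)

/-- A `C^n` map with values in a closed subspace is `C^n` as a map into that subspace. -/
theorem BContDiffOn.of_coe {Y : Submodule ℝ F} (hY : IsClosed (Y : Set F)) :
    ∀ (n : ℕ) {E : Type u} [AddCommGroup E] [Module ℝ E] [TopologicalSpace E]
      [IsTopologicalAddGroup E] [ContinuousSMul ℝ E] {U : Set E} {f : E → Y}, IsOpen U →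
      BContDiffOn n U (fun e => (f e : F)) → BContDiffOn n U f
  | 0, _, _, _, _, _, _, _, _, _, h => Topology.IsInducing.subtypeVal.continuousOn_iff.2 h
  | n + 1, _, _, _, _, _, _, U, f, hU, h => by
    have key : ∀ x ∈ U, ∀ w, ∃ y, HasDirDeriv f x w y := fun x hx w => by
      obtain ⟨y, hy⟩ := h.2.1 x hx w
      have hyY : y ∈ Y := hY.mem_of_tendsto hy (Eventually.of_forall fun t =>
        Y.smul_mem _ (Y.sub_mem (f _).2 (f _).2))
      exact ⟨⟨y, hyY⟩, tendsto_subtype_rng.2 hy⟩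
    refine ⟨Topology.IsInducing.subtypeVal.continuousOn_iff.2 h.1, key,
      BContDiffOn.of_coe hY n (hU.prod isOpen_univ)
        (BContDiffOn.congr n h.2.2 (hU.prod isOpen_univ) fun p hp => ?_)⟩
    exact ((hasDirDeriv_dirDeriv (key p.1 hp.1 p.2)).clm_comp Y.subtypeL).dirDeriv_eq

theorem BSmoothOn.of_coe {Y : Submodule ℝ F} (hY : IsClosed (Y : Set F)) {U : Set E} {f : E → Y}
    (hU : IsOpen U) (h : BSmoothOn U (fun e => (f e : F))) : BSmoothOn U f := fun n =>
  BContDiffOn.of_coe hY n hU (h n)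

end BSmooth

/-! ### Smooth maps in charts -/

section Charts

variable {M N P : Type u} [TopologicalSpace M] [LCAtlas M] [TopologicalSpace N] [LCAtlas N]
  [TopologicalSpace P] [LCAtlas P]

/-- The coordinate expression of `f` with respect to the charts `φ` and `ψ`. -/
def chartRep (φ : LCChart M) (ψ : LCChart N) (f : M → N) : φ.model → ψ.model :=
  fun x => ψ.hom (f (φ.hom.symm x))

/-- The image of `O` in the chart `φ`. -/
def LCChart.img (φ : LCChart M) (O : Set M) : Set φ.model := φ.hom.target ∩ φ.hom.symm ⁻¹' O

theorem LCChart.isOpen_img (φ : LCChart M) {O : Set M} (hO : IsOpen O) : IsOpen (φ.img O) :=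
  φ.hom.isOpen_inter_preimage_symm hO

theorem LCChart.apply_mem_img (φ : LCChart M) {O : Set M} {x : M} (hx : x ∈ φ.hom.source)
    (hO : x ∈ O) : φ.hom x ∈ φ.img O :=
  ⟨φ.hom.map_source hx, by rwa [mem_preimage, φ.hom.left_inv hx]⟩

theorem LCChart.img_mono (φ : LCChart M) {O O' : Set M} (h : O ⊆ O') : φ.img O ⊆ φ.img O' :=
  inter_subset_inter_right _ (preimage_mono h)

theorem isSmoothChart_of_mem [IsLCManifold M] {φ : LCChart M} (h : φ ∈ LCAtlas.charts (M := M)) :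
    IsSmoothChart φ := fun ψ hψ =>
  ⟨IsLCManifold.compatible φ h ψ hψ, IsLCManifold.compatible ψ hψ φ h⟩

theorem chartAt_mem_charts [IsLCManifold M] (m : M) : chartAt m ∈ LCAtlas.charts (M := M) := by
  have h := IsLCManifold.cover m
  rw [chartAt, dif_pos h]
  exact h.choose_spec.1

theorem mem_chartAt_source [IsLCManifold M] (m : M) : m ∈ (chartAt m).hom.source := by
  have h := IsLCManifold.cover m
  rw [chartAt, dif_pos h]
  exact h.choose_spec.2

theorem isSmoothChart_chartAt [IsLCManifold M] (m : M) : IsSmoothChart (chartAt m) :=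
  isSmoothChart_of_mem (chartAt_mem_charts m)

theorem IsSmoothChart.smoothTransition [IsLCManifold M] {φ ψ : LCChart M} (hφ : IsSmoothChart φ)
    (hψ : IsSmoothChart ψ) : SmoothTransition φ ψ := by
  refine BSmoothOn.of_locally fun x hx => ?_
  obtain ⟨θ, hθ, hxθ⟩ := IsLCManifold.cover (φ.hom.symm x)
  refine ⟨φ.img θ.hom.source, φ.isOpen_img θ.hom.open_source, ⟨hx.1, hxθ⟩, ?_⟩
  have hopen : IsOpen (φ.img ψ.hom.source ∩ φ.img θ.hom.source) :=
    (φ.isOpen_img ψ.hom.open_source).inter (φ.isOpen_img θ.hom.open_source)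
  refine BSmoothOn.congr (BSmoothOn.comp (hψ θ hθ).2
    (BSmoothOn.mono (hφ θ hθ).1 inter_subset_right) hopen
    (θ.isOpen_img ψ.hom.open_source) ?_) hopen ?_
  · rintro y ⟨hy, hy'⟩
    exact θ.apply_mem_img hy'.2 hy.2
  · rintro y ⟨hy, hy'⟩
    simp only [θ.hom.left_inv hy'.2]

theorem BSmoothOn.change_charts [IsLCManifold M] [IsLCManifold N] {φ φ' : LCChart M}
    {ψ ψ' : LCChart N} (hφ : IsSmoothChart φ) (hφ' : IsSmoothChart φ') (hψ : IsSmoothChart ψ)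
    (hψ' : IsSmoothChart ψ') {f : M → N} {O : Set M} (hO : IsOpen O)
    (hOφ : O ⊆ φ.hom.source) (hfO : MapsTo f O ψ.hom.source)
    (h : BSmoothOn (φ.img O) (chartRep φ ψ f))
    (hfO' : MapsTo f O ψ'.hom.source) : BSmoothOn (φ'.img O) (chartRep φ' ψ' f) := by
  have h1 : BSmoothOn (φ'.img O) (fun x => φ.hom (φ'.hom.symm x)) :=
    BSmoothOn.mono (hφ'.smoothTransition hφ) (φ'.img_mono hOφ)
  have m1 : MapsTo (fun x => φ.hom (φ'.hom.symm x)) (φ'.img O) (φ.img O) :=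
    fun x hx => φ.apply_mem_img (hOφ hx.2) hx.2
  have m2 : MapsTo (chartRep φ ψ f) (φ.img O) (ψ.img ψ'.hom.source) :=
    fun x hx => ψ.apply_mem_img (hfO hx.2) (hfO' hx.2)
  refine BSmoothOn.congr (BSmoothOn.comp (hψ.smoothTransition hψ')
    (BSmoothOn.comp h h1 (φ'.isOpen_img hO) (φ.isOpen_img hO) m1) (φ'.isOpen_img hO)
    (ψ.isOpen_img ψ'.hom.open_source) (fun x hx => m2 (m1 hx))) (φ'.isOpen_img hO) ?_
  intro x hx
  simp only [chartRep, φ.hom.left_inv (hOφ hx.2), ψ.hom.left_inv (hfO hx.2)]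

theorem SmoothOn.isOpen_inter_preimage {f : M → N} {W : Set M} (hf : SmoothOn f W)
    (hW : IsOpen W) {V : Set N} (hV : IsOpen V) : IsOpen (W ∩ f ⁻¹' V) :=
  hf.1.isOpen_inter_preimage hW hV

/-- Smoothness may be tested in one pair of smooth charts around every point. -/
theorem SmoothOn.of_charts [IsLCManifold M] [IsLCManifold N] {f : M → N} {W : Set M}
    (h : ∀ x ∈ W, ∃ (φ : LCChart M) (ψ : LCChart N) (O : Set M), IsSmoothChart φ ∧
      IsSmoothChart ψ ∧ IsOpen O ∧ x ∈ O ∧ O ⊆ φ.hom.source ∧ MapsTo f O ψ.hom.source ∧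
      BSmoothOn (φ.img O) (chartRep φ ψ f)) : SmoothOn f W := by
  have hc : ContinuousOn f W := fun x hx => by
    obtain ⟨φ, ψ, O, hφ, hψ, hO, hxO, hOφ, hfO, hs⟩ := h x hx
    have h1 : ContinuousOn (fun y => ψ.hom.symm (chartRep φ ψ f (φ.hom y))) O :=
      ψ.hom.continuousOn_symm.comp (hs.continuousOn.comp (φ.hom.continuousOn.mono hOφ)
        (fun y hy => φ.apply_mem_img (hOφ hy) hy)) (fun y hy => by
          simp only [chartRep, φ.hom.left_inv (hOφ hy)]
          exact ψ.hom.map_source (hfO hy))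
    have h2 : ContinuousOn f O := h1.congr fun y hy => by
      simp only [chartRep, φ.hom.left_inv (hOφ hy), ψ.hom.left_inv (hfO hy)]
    exact (h2.continuousAt (hO.mem_nhds hxO)).continuousWithinAt
  refine ⟨hc, fun φ' hφ' ψ' hψ' => BSmoothOn.of_locally fun x hx => ?_⟩
  obtain ⟨φ, ψ, O, hφ, hψ, hO, hxO, hOφ, hfO, hs⟩ := h _ hx.2.1
  have hc' : ContinuousOn f O := by
    have h1 : ContinuousOn (fun y => ψ.hom.symm (chartRep φ ψ f (φ.hom y))) O :=
      ψ.hom.continuousOn_symm.comp (hs.continuousOn.comp (φ.hom.continuousOn.mono hOφ)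
        (fun y hy => φ.apply_mem_img (hOφ hy) hy)) (fun y hy => by
          simp only [chartRep, φ.hom.left_inv (hOφ hy)]
          exact ψ.hom.map_source (hfO hy))
    exact h1.congr fun y hy => by
      simp only [chartRep, φ.hom.left_inv (hOφ hy), ψ.hom.left_inv (hfO hy)]
  have hO' : IsOpen (O ∩ f ⁻¹' ψ'.hom.source) :=
    hc'.isOpen_inter_preimage hO ψ'.hom.open_source
  refine ⟨φ'.img (O ∩ f ⁻¹' ψ'.hom.source), φ'.isOpen_img hO', ⟨hx.1, hxO, hx.2.2⟩,
    BSmoothOn.mono (BSmoothOn.change_charts hφ (isSmoothChart_of_mem hφ') hψ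
      (isSmoothChart_of_mem hψ') hO' (inter_subset_left.trans hOφ) (hfO.mono_left inter_subset_left)
      (hs.mono (φ.img_mono inter_subset_left)) (fun y hy => hy.2)) inter_subset_right⟩

theorem SmoothOn.rep [IsLCManifold M] [IsLCManifold N] {f : M → N} {W : Set M}
    (hf : SmoothOn f W) (hW : IsOpen W) {φ : LCChart M} {ψ : LCChart N} (hφ : IsSmoothChart φ)
    (hψ : IsSmoothChart ψ) : BSmoothOn (φ.img (W ∩ f ⁻¹' ψ.hom.source)) (chartRep φ ψ f) := by
  refine BSmoothOn.of_locally fun x hx => ?_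
  obtain ⟨φ', hφ', hxφ'⟩ := IsLCManifold.cover (φ.hom.symm x)
  obtain ⟨ψ', hψ', hxψ'⟩ := IsLCManifold.cover (f (φ.hom.symm x))
  set O : Set M := (W ∩ f ⁻¹' (ψ.hom.source ∩ ψ'.hom.source)) ∩ φ'.hom.source with hOdef
  have hO : IsOpen O := (hf.isOpen_inter_preimage hW
    (ψ.hom.open_source.inter ψ'.hom.open_source)).inter φ'.hom.open_source
  refine ⟨φ.img O, φ.isOpen_img hO, ⟨hx.1, ⟨hx.2.1, hx.2.2, hxψ'⟩, hxφ'⟩, ?_⟩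
  refine BSmoothOn.mono (BSmoothOn.change_charts (isSmoothChart_of_mem hφ') hφ
    (isSmoothChart_of_mem hψ') hψ hO inter_subset_right (fun y hy => hy.1.2.2) ?_
    (fun y hy => hy.1.2.1)) inter_subset_right
  refine BSmoothOn.mono (hf.2 φ' hφ' ψ' hψ') (φ'.img_mono ?_)
  exact fun y hy => ⟨hy.1.1, hy.1.2.2⟩

theorem SmoothOn.mono {f : M → N} {W V : Set M} (hf : SmoothOn f W) (hV : V ⊆ W) :
    SmoothOn f V :=
  ⟨hf.1.mono hV, fun φ hφ ψ hψ => BSmoothOn.mono (hf.2 φ hφ ψ hψ)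
    (inter_subset_inter_right _ (preimage_mono (inter_subset_inter_left _ hV)))⟩

theorem Smooth.smoothOn {f : M → N} (hf : Smooth f) (W : Set M) : SmoothOn f W :=
  SmoothOn.mono hf (subset_univ _)

theorem Smooth.continuous {f : M → N} (hf : Smooth f) : Continuous f :=
  continuousOn_univ.1 hf.1

theorem SmoothOn.congr {f g : M → N} {W : Set M} (hf : SmoothOn f W) (hW : IsOpen W)
    (hfg : EqOn f g W) : SmoothOn g W := by
  refine ⟨hf.1.congr hfg.symm, fun φ hφ ψ hψ => ?_⟩
  have h1 : W ∩ g ⁻¹' ψ.hom.source = W ∩ f ⁻¹' ψ.hom.source := by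
    ext x
    simp only [mem_inter_iff, mem_preimage]
    exact and_congr_right fun hx => by rw [hfg hx]
  rw [h1]
  refine BSmoothOn.congr (hf.2 φ hφ ψ hψ)
    (φ.isOpen_img (hf.isOpen_inter_preimage hW ψ.hom.open_source)) fun x hx => ?_
  simp only [hfg hx.2.1]

theorem SmoothOn.of_locally {f : M → N} {W : Set M}
    (h : ∀ x ∈ W, ∃ V, IsOpen V ∧ x ∈ V ∧ SmoothOn f (W ∩ V)) : SmoothOn f W := by
  refine ⟨fun x hx => ?_, fun φ hφ ψ hψ => BSmoothOn.of_locally fun x hx => ?_⟩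
  · obtain ⟨V, hV, hxV, hf⟩ := h x hx
    exact (hf.1 x ⟨hx, hxV⟩).mono_of_mem_nhdsWithin
      (inter_mem self_mem_nhdsWithin (mem_nhdsWithin_of_mem_nhds (hV.mem_nhds hxV)))
  · obtain ⟨V, hV, hxV, hf⟩ := h _ hx.2.1
    refine ⟨φ.img V, φ.isOpen_img hV, ⟨hx.1, hxV⟩, BSmoothOn.mono (hf.2 φ hφ ψ hψ) ?_⟩
    exact fun y hy => ⟨hy.1.1, ⟨hy.1.2.1, hy.2.2⟩, hy.1.2.2⟩

theorem SmoothOn.comp [IsLCManifold M] [IsLCManifold N] [IsLCManifold P] {f : M → N} {g : N → P}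
    {W : Set M} {V : Set N} (hg : SmoothOn g V) (hf : SmoothOn f W) (hW : IsOpen W)
    (hV : IsOpen V) (h : MapsTo f W V) : SmoothOn (fun x => g (f x)) W := by
  refine SmoothOn.of_charts fun x hx => ?_
  obtain ⟨φ, hφ, hxφ⟩ := IsLCManifold.cover x
  obtain ⟨ψ, hψ, hxψ⟩ := IsLCManifold.cover (f x)
  obtain ⟨χ, hχ, hxχ⟩ := IsLCManifold.cover (g (f x))
  have h1 : IsOpen (V ∩ g ⁻¹' χ.hom.source ∩ ψ.hom.source) :=
    (hg.isOpen_inter_preimage hV χ.hom.open_source).inter ψ.hom.open_source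
  have h2 := (hf.isOpen_inter_preimage hW h1).inter φ.hom.open_source
  refine ⟨φ, χ, _, isSmoothChart_of_mem hφ, isSmoothChart_of_mem hχ, h2,
    ⟨⟨hx, ⟨h hx, hxχ⟩, hxψ⟩, hxφ⟩, inter_subset_right, fun y hy => hy.1.2.1.2, ?_⟩
  refine BSmoothOn.congr (BSmoothOn.comp (hg.2 ψ hψ χ hχ)
    (BSmoothOn.mono (hf.2 φ hφ ψ hψ) (φ.img_mono fun y hy => ⟨hy.1.1, hy.1.2.2⟩))
    (φ.isOpen_img h2)
    (ψ.isOpen_img (hg.isOpen_inter_preimage hV χ.hom.open_source)) ?_) (φ.isOpen_img h2) ?_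
  · intro y hy
    exact ψ.apply_mem_img hy.2.1.2.2 hy.2.1.2.1
  · intro y hy
    simp only [chartRep, ψ.hom.left_inv hy.2.1.2.2]

theorem Smooth.comp [IsLCManifold M] [IsLCManifold N] [IsLCManifold P] {f : M → N} {g : N → P}
    (hg : Smooth g) (hf : Smooth f) : Smooth (fun x => g (f x)) :=
  SmoothOn.comp hg hf isOpen_univ isOpen_univ (mapsTo_univ _ _)

theorem Smooth.comp_smoothOn [IsLCManifold M] [IsLCManifold N] [IsLCManifold P] {f : M → N}
    {g : N → P} {W : Set M} (hg : Smooth g) (hf : SmoothOn f W) (hW : IsOpen W) :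
    SmoothOn (fun x => g (f x)) W :=
  SmoothOn.comp hg hf hW isOpen_univ (mapsTo_univ _ _)

theorem smooth_id [IsLCManifold M] : Smooth (fun x : M => x) := by
  refine ⟨continuousOn_id, fun φ hφ ψ hψ => ?_⟩
  rw [univ_inter]
  exact IsLCManifold.compatible φ hφ ψ hψ

theorem smooth_const (c : N) : Smooth (fun _ : M => c) :=
  ⟨continuousOn_const, fun _ _ _ _ => bSmoothOn_const _ _⟩

/-! ### Derivatives in charts -/

/-- The derivative of `f` at `x`, expressed in the charts `φ` and `ψ`. -/
def chartDeriv (φ : LCChart M) (ψ : LCChart N) (f : M → N) (x : M) (w : φ.model) : ψ.model :=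
  dirDeriv (chartRep φ ψ f) (φ.hom x) w

theorem LCChart.eventually_symm (φ : LCChart M) {x : M} (hx : x ∈ φ.hom.source) {O : Set M}
    (hO : IsOpen O) (hxO : x ∈ O) : ∀ᶠ y in 𝓝 (φ.hom x), y ∈ φ.img O :=
  (φ.isOpen_img hO).mem_nhds (φ.apply_mem_img hx hxO)

theorem chartDeriv_congr {φ : LCChart M} {ψ : LCChart N} {f g : M → N} {x : M}
    (hx : x ∈ φ.hom.source) (hfg : f =ᶠ[𝓝 x] g) (w : φ.model) :
    chartDeriv φ ψ f x w = chartDeriv φ ψ g x w := by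
  obtain ⟨O, hOs, hO, hxO⟩ := mem_nhds_iff.1 hfg
  refine dirDeriv_congr ?_
  filter_upwards [φ.eventually_symm hx hO hxO] with y hy
  have : f (φ.hom.symm y) = g (φ.hom.symm y) := hOs hy.2
  simp only [chartRep, this]

theorem SmoothOn.rep_one [IsLCManifold M] [IsLCManifold N] {f : M → N} {W : Set M}
    (hf : SmoothOn f W) (hW : IsOpen W) {φ : LCChart M} {ψ : LCChart N} (hφ : IsSmoothChart φ)
    (hψ : IsSmoothChart ψ) :
    BContDiffOn 1 (φ.img (W ∩ f ⁻¹' ψ.hom.source)) (chartRep φ ψ f) :=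
  hf.rep hW hφ hψ 1

/-- The chain rule in charts. -/
theorem chartDeriv_comp [IsLCManifold M] [IsLCManifold N] [IsLCManifold P] {f : M → N}
    {g : N → P} {W : Set M} {V : Set N} (hg : SmoothOn g V) (hf : SmoothOn f W) (hW : IsOpen W)
    (hV : IsOpen V) {x : M} (hx : x ∈ W) (hfx : f x ∈ V) {φ : LCChart M} {ψ : LCChart N}
    {χ : LCChart P} (hφ : IsSmoothChart φ) (hψ : IsSmoothChart ψ) (hχ : IsSmoothChart χ)
    (hxφ : x ∈ φ.hom.source) (hxψ : f x ∈ ψ.hom.source) (hxχ : g (f x) ∈ χ.hom.source)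
    (w : φ.model) :
    chartDeriv φ χ (fun y => g (f y)) x w =
      chartDeriv ψ χ g (f x) (chartDeriv φ ψ f x w) := by
  have h1 := hg.rep_one hV hψ hχ
  have h2 := hf.rep_one hW hφ hψ
  have e1 : chartRep φ ψ f (φ.hom x) = ψ.hom (f x) := by
    simp only [chartRep, φ.hom.left_inv hxφ]
  have key := h1.hasDirDeriv_comp
    (ψ.isOpen_img (hg.isOpen_inter_preimage hV χ.hom.open_source)) (f := chartRep φ ψ f)
    (x := φ.hom x) (w := w) (by
      rw [e1]; exact ψ.apply_mem_img hxψ ⟨hfx, hxχ⟩)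
    (hasDirDeriv_dirDeriv (h2.2.1 _ (φ.apply_mem_img hxφ ⟨hx, hxψ⟩) w))
  rw [e1] at key
  refine (key.congr ?_).dirDeriv_eq
  filter_upwards [φ.eventually_symm hxφ (hf.isOpen_inter_preimage hW ψ.hom.open_source)
    ⟨hx, hxψ⟩] with y hy
  simp only [chartRep, ψ.hom.left_inv hy.2.2]

theorem chartDeriv_id {φ : LCChart M} {x : M} (hx : x ∈ φ.hom.source) (w : φ.model) :
    chartDeriv φ φ (fun y => y) x w = w := by
  refine (HasDirDeriv.congr (hasDirDeriv_clm (ContinuousLinearMap.id ℝ φ.model) _ w)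
    ?_).dirDeriv_eq
  filter_upwards [φ.hom.open_target.mem_nhds (φ.hom.map_source hx)] with y hy
  simp only [chartRep, φ.hom.right_inv hy, ContinuousLinearMap.id_apply]

/-- The derivative of a smooth map in charts, as a continuous linear map. -/
def SmoothOn.chartDerivL [IsLCManifold M] [IsLCManifold N] {f : M → N}
    {W : Set M} (hf : SmoothOn f W) (hW : IsOpen W) {x : M} (hx : x ∈ W) {φ : LCChart M}
    {ψ : LCChart N} (hφ : IsSmoothChart φ) (hψ : IsSmoothChart ψ)
    (hxφ : x ∈ φ.hom.source) (hxψ : f x ∈ ψ.hom.source) : φ.model →L[ℝ] ψ.model :=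
  (hf.rep_one hW hφ hψ).derivAt
    (φ.isOpen_img (hf.isOpen_inter_preimage hW ψ.hom.open_source))
    (φ.apply_mem_img hxφ ⟨hx, hxψ⟩)

/-- Two smooth charts around a point have isomorphic tangent spaces. -/
theorem chartDeriv_id_comp [IsLCManifold M] {φ ψ χ : LCChart M} (hφ : IsSmoothChart φ)
    (hψ : IsSmoothChart ψ) (hχ : IsSmoothChart χ) {x : M} (hxφ : x ∈ φ.hom.source)
    (hxψ : x ∈ ψ.hom.source) (hxχ : x ∈ χ.hom.source) (w : φ.model) :
    chartDeriv ψ χ (fun y => y) x (chartDeriv φ ψ (fun y => y) x w) =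
      chartDeriv φ χ (fun y => y) x w :=
  (chartDeriv_comp (f := fun y : M => y) (g := fun y : M => y) smooth_id smooth_id isOpen_univ
    isOpen_univ trivial trivial hφ hψ hχ hxφ hxψ hxχ w).symm

theorem tmap_comp [IsLCManifold M] [IsLCManifold N] [IsLCManifold P] {f : M → N}
    {g : N → P} {W : Set M} {V : Set N} (hg : SmoothOn g V) (hf : SmoothOn f W) (hW : IsOpen W)
    (hV : IsOpen V) {x : M} (hx : x ∈ W) (hfx : f x ∈ V) (w : tangent x) :
    tmap (fun y => g (f y)) x (g (f x)) w = tmap g (f x) (g (f x)) (tmap f x (f x) w) :=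
  chartDeriv_comp hg hf hW hV hx hfx (isSmoothChart_chartAt _) (isSmoothChart_chartAt _)
    (isSmoothChart_chartAt _) (mem_chartAt_source _) (mem_chartAt_source _)
    (mem_chartAt_source _) w

end Charts

/-! ### Locally convex spaces and products as manifolds -/

section Products

theorem LCS.eq_of_mem_charts {E : LCS.{u}} {φ : LCChart E} (h : φ ∈ LCAtlas.charts (M := E)) :
    φ = ⟨E, OpenPartialHomeomorph.refl E⟩ := h

/-- The identity chart of a locally convex space. -/
def LCS.chart (E : LCS.{u}) : LCChart E := ⟨E, OpenPartialHomeomorph.refl E⟩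

theorem LCS.chart_mem (E : LCS.{u}) : E.chart ∈ LCAtlas.charts (M := E) := rfl

instance LCS.isLCManifold (E : LCS.{u}) : IsLCManifold E where
  t2 := inferInstance
  cover _ := ⟨_, E.chart_mem, trivial⟩
  compatible φ hφ ψ hψ := by
    obtain rfl := LCS.eq_of_mem_charts hφ
    obtain rfl := LCS.eq_of_mem_charts hψ
    exact bSmoothOn_id _

theorem LCS.isSmoothChart_chart (E : LCS.{u}) : IsSmoothChart E.chart :=
  isSmoothChart_of_mem E.chart_mem

theorem LCS.img_chart (E : LCS.{u}) (O : Set E) : E.chart.img O = O := by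
  ext x
  exact ⟨fun h => h.2, fun h => ⟨trivial, h⟩⟩

theorem BSmoothOn.smoothOn {E F : LCS.{u}} {f : E → F} {U : Set E} (hf : BSmoothOn U f)
    (hU : IsOpen U) : SmoothOn f U :=
  SmoothOn.of_charts fun x hx => ⟨E.chart, F.chart, U, E.isSmoothChart_chart,
    F.isSmoothChart_chart, hU, hx, fun _ _ => trivial, fun _ _ => trivial, by
      rw [E.img_chart]; exact hf⟩

variable {M N P : Type u} [TopologicalSpace M] [LCAtlas M] [TopologicalSpace N] [LCAtlas N]
  [TopologicalSpace P] [LCAtlas P]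

theorem LCChart.prod_img (φ : LCChart M) (ψ : LCChart N) (O : Set M) (O' : Set N) :
    (φ.prod ψ).img (O ×ˢ O') = (φ.img O ×ˢ ψ.img O' : Set (φ.model × ψ.model)) := by
  ext p
  exact ⟨fun h => ⟨⟨h.1.1, h.2.1⟩, h.1.2, h.2.2⟩, fun h => ⟨⟨h.1.1, h.2.1⟩, h.1.2, h.2.2⟩⟩

theorem smoothTransition_prod {φ φ' : LCChart M} {ψ ψ' : LCChart N} (h : SmoothTransition φ φ')
    (h' : SmoothTransition ψ ψ') : SmoothTransition (φ.prod ψ) (φ'.prod ψ') := by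
  have h1 := BSmoothOn.prodMap h h' (φ.isOpen_img φ'.hom.open_source)
    (ψ.isOpen_img ψ'.hom.open_source)
  have h2 := LCChart.prod_img φ ψ φ'.hom.source ψ'.hom.source
  exact (congrArg (fun s => BSmoothOn s (fun x : (φ.prod ψ).model =>
    (φ'.prod ψ').hom ((φ.prod ψ).hom.symm x))) h2).mpr h1

instance prod_isLCManifold [IsLCManifold M] [IsLCManifold N] : IsLCManifold (M × N) where
  t2 := by
    have := IsLCManifold.t2 (M := M)
    have := IsLCManifold.t2 (M := N)
    infer_instance
  cover p := by
    obtain ⟨φ, hφ, h1⟩ := IsLCManifold.cover p.1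
    obtain ⟨ψ, hψ, h2⟩ := IsLCManifold.cover p.2
    exact ⟨φ.prod ψ, ⟨φ, hφ, ψ, hψ, rfl⟩, ⟨h1, h2⟩⟩
  compatible := by
    rintro _ ⟨φ, hφ, ψ, hψ, rfl⟩ _ ⟨φ', hφ', ψ', hψ', rfl⟩
    exact smoothTransition_prod (IsLCManifold.compatible φ hφ φ' hφ')
      (IsLCManifold.compatible ψ hψ ψ' hψ')

theorem IsSmoothChart.prod [IsLCManifold M] [IsLCManifold N] {φ : LCChart M} {ψ : LCChart N}
    (hφ : IsSmoothChart φ) (hψ : IsSmoothChart ψ) : IsSmoothChart (φ.prod ψ) := by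
  rintro _ ⟨φ', hφ', ψ', hψ', rfl⟩
  exact ⟨smoothTransition_prod (hφ φ' hφ').1 (hψ ψ' hψ').1,
    smoothTransition_prod (hφ φ' hφ').2 (hψ ψ' hψ').2⟩

theorem SmoothOn.prodMk [IsLCManifold M] [IsLCManifold N] [IsLCManifold P] {f : M → N}
    {g : M → P} {W : Set M} (hf : SmoothOn f W) (hg : SmoothOn g W) (hW : IsOpen W) :
    SmoothOn (fun x => (f x, g x)) W :=
  SmoothOn.of_charts fun x hx => by
    obtain ⟨φ, hφ, h0⟩ := IsLCManifold.cover x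
    obtain ⟨ψ, hψ, h1⟩ := IsLCManifold.cover (f x)
    obtain ⟨χ, hχ, h2⟩ := IsLCManifold.cover (g x)
    have hO := ((hf.isOpen_inter_preimage hW ψ.hom.open_source).inter
      (hg.isOpen_inter_preimage hW χ.hom.open_source)).inter φ.hom.open_source
    refine ⟨φ, ψ.prod χ, _, isSmoothChart_of_mem hφ,
      (isSmoothChart_of_mem hψ).prod (isSmoothChart_of_mem hχ), hO,
      ⟨⟨⟨hx, h1⟩, hx, h2⟩, h0⟩, inter_subset_right, fun y hy => ⟨hy.1.1.2, hy.1.2.2⟩, ?_⟩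
    exact BSmoothOn.prodMk (BSmoothOn.mono (hf.2 φ hφ ψ hψ) (φ.img_mono fun y hy => hy.1.1))
      (BSmoothOn.mono (hg.2 φ hφ χ hχ) (φ.img_mono fun y hy => hy.1.2)) (φ.isOpen_img hO)

theorem Smooth.prodMk [IsLCManifold M] [IsLCManifold N] [IsLCManifold P] {f : M → N}
    {g : M → P} (hf : Smooth f) (hg : Smooth g) : Smooth (fun x => (f x, g x)) :=
  SmoothOn.prodMk hf hg isOpen_univ

end Products

/-! ### Construction of smooth charts -/

section SmoothCharts

variable {M N : Type u} [TopologicalSpace M] [LCAtlas M] [TopologicalSpace N] [LCAtlas N]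

/-- The restriction of a chart to an open set. -/
def LCChart.restrOpen (φ : LCChart M) (O : Set M) (hO : IsOpen O) : LCChart M :=
  ⟨φ.model, φ.hom.restrOpen O hO⟩

theorem LCChart.restrOpen_source (φ : LCChart M) {O : Set M} (hO : IsOpen O) :
    (φ.restrOpen O hO).hom.source = φ.hom.source ∩ O := φ.hom.restrOpen_source O hO

theorem IsSmoothChart.restrOpen {φ : LCChart M} (hφ : IsSmoothChart φ) {O : Set M}
    (hO : IsOpen O) : IsSmoothChart (φ.restrOpen O hO) := fun ψ hψ =>
  ⟨BSmoothOn.mono (hφ ψ hψ).1 fun _ hx => ⟨hx.1.1, hx.2⟩,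
    BSmoothOn.mono (hφ ψ hψ).2 fun x hx => ⟨hx.1, by
      have h : ψ.hom.symm x ∈ (φ.restrOpen O hO).hom.source := hx.2
      rw [φ.restrOpen_source] at h
      exact h.1⟩⟩

/-- A diffeomorphism between open subsets, as a partial homeomorphism. -/
def IsOpenDiffeoOn.toPartialHomeo {f : M → N} {W : Set M} (h : IsOpenDiffeoOn f W) :
    OpenPartialHomeomorph M N where
  toFun := f
  invFun := h.2.2.2.choose
  source := W
  target := f '' W
  map_source' := fun x hx => ⟨x, hx, rfl⟩
  map_target' := by
    rintro _ ⟨x, hx, rfl⟩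
    rwa [h.2.2.2.choose_spec.2 x hx]
  left_inv' := fun x hx => h.2.2.2.choose_spec.2 x hx
  right_inv' := by
    rintro _ ⟨x, hx, rfl⟩
    rw [h.2.2.2.choose_spec.2 x hx]
  open_source := h.1
  open_target := h.2.1
  continuousOn_toFun := h.2.2.1.1
  continuousOn_invFun := h.2.2.2.choose_spec.1.1

theorem IsOpenDiffeoOn.smoothOn_symm {f : M → N} {W : Set M} (h : IsOpenDiffeoOn f W) :
    SmoothOn h.toPartialHomeo.symm (f '' W) := h.2.2.2.choose_spec.1

/-- The image of a chart under a diffeomorphism between open subsets. -/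
def IsOpenDiffeoOn.chart {f : M → N} {W : Set M} (h : IsOpenDiffeoOn f W) (θ : LCChart M) :
    LCChart N :=
  ⟨θ.model, h.toPartialHomeo.symm.trans θ.hom⟩

theorem IsOpenDiffeoOn.isSmoothChart [IsLCManifold M] [IsLCManifold N] {f : M → N} {W : Set M}
    (h : IsOpenDiffeoOn f W) {θ : LCChart M} (hθ : IsSmoothChart θ) :
    IsSmoothChart (h.chart θ) := fun ψ hψ => by
  have hψ' := isSmoothChart_of_mem hψ
  constructor
  · refine BSmoothOn.mono (h.2.2.1.rep h.1 hθ hψ') ?_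
    rintro x ⟨hx, hx'⟩
    exact ⟨hx.1, hx.2, hx'⟩
  · exact h.smoothOn_symm.rep h.2.1 hψ' hθ

/-- The composition of a chart with an isomorphism of the model space. -/
def LCChart.transEquiv (φ : LCChart M) {E : LCS.{u}} (L : φ.model ≃L[ℝ] E) : LCChart M :=
  ⟨E, φ.hom.transHomeomorph L.toHomeomorph⟩

theorem IsSmoothChart.transEquiv {φ : LCChart M} (hφ : IsSmoothChart φ)
    {E : LCS.{u}} (L : φ.model ≃L[ℝ] E) : IsSmoothChart (φ.transEquiv L) := fun ψ hψ => by
  constructor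
  · exact BSmoothOn.comp_clm (hφ ψ hψ).1 (L.symm : E →L[ℝ] φ.model)
  · exact BSmoothOn.clm_comp (hφ ψ hψ).2 (ψ.isOpen_img φ.hom.open_source) (L : φ.model →L[ℝ] E)

end SmoothCharts

/-! ### Submanifolds -/

section Submanifold

variable {M N : Type u} [TopologicalSpace M] [LCAtlas M] [TopologicalSpace N] [LCAtlas N]

open Classical in
theorem LCChart.restrict_apply {S : Set M} (s₀ : S) {φ : LCChart M} {Y : Submodule ℝ φ.model}
    (h : IsAdapted S φ Y) {s : S} (hs : (s : M) ∈ φ.hom.source) :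
    ((show Y from (φ.restrict s₀ Y h).hom s) : φ.model) = φ.hom s := by
  change (((if hs : (s : M) ∈ φ.hom.source then ⟨φ.hom s, h.mem s.2 hs⟩ else 0 : Y)) : φ.model) = _
  rw [dif_pos hs]

open Classical in
theorem LCChart.restrict_symm {S : Set M} (s₀ : S) {φ : LCChart M} {Y : Submodule ℝ φ.model}
    (h : IsAdapted S φ Y) {y : Y} (hy : (y : φ.model) ∈ φ.hom.target) :
    (((φ.restrict s₀ Y h).hom.symm y : S) : M) = φ.hom.symm (y : φ.model) := by
  change (((if hy : (y : φ.model) ∈ φ.hom.target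
    then ⟨φ.hom.symm y, h.symm_mem y.2 hy⟩ else s₀ : S)) : M) = _
  rw [dif_pos hy]

theorem LCChart.mem_restrict_source {S : Set M} (s₀ : S) {φ : LCChart M}
    {Y : Submodule ℝ φ.model} (h : IsAdapted S φ Y) {s : S} :
    s ∈ (φ.restrict s₀ Y h).hom.source ↔ (s : M) ∈ φ.hom.source := Iff.rfl

theorem IsSubmanifold.isLCManifold [IsLCManifold M] {S : Set M} (hS : IsSubmanifold S) :
    IsLCManifold S where
  t2 := by
    have := IsLCManifold.t2 (M := M)
    infer_instance
  cover s := by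
    obtain ⟨φ, Y, hφ, hs, hY, h⟩ := hS s s.2
    exact ⟨φ.restrict s Y h, ⟨s, φ, Y, h, hφ, hY, rfl⟩, hs⟩
  compatible := by
    rintro _ ⟨s, φ, Y, h, hφ, hY, rfl⟩ _ ⟨s', φ', Y', h', hφ', hY', rfl⟩
    have h1 : BSmoothOn (Y.subtypeL ⁻¹' (φ.img φ'.hom.source))
        (fun y : Y => φ'.hom (φ.hom.symm (y : φ.model))) :=
      BSmoothOn.comp_clm (hφ.smoothTransition hφ') Y.subtypeL
    have ho : IsOpen (Y.subtypeL ⁻¹' (φ.img φ'.hom.source)) :=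
      (φ.isOpen_img φ'.hom.open_source).preimage Y.subtypeL.continuous
    have hset : (φ.restrict s Y h).img (φ'.restrict s' Y' h').hom.source =
        Y.subtypeL ⁻¹' (φ.img φ'.hom.source) := by
      ext y
      refine and_congr_right fun hy => ?_
      rw [mem_preimage, φ'.mem_restrict_source]
      have := φ.restrict_symm s h (y := y) hy
      rw [this]
      rfl
    have h2 : BSmoothOn (Y.subtypeL ⁻¹' (φ.img φ'.hom.source)) (fun y : Y =>
        (show Y' from (φ'.restrict s' Y' h').hom ((φ.restrict s Y h).hom.symm y))) := by
      refine BSmoothOn.of_coe hY' ho (h1.congr ho fun y hy => ?_)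
      have e1 := φ.restrict_symm s h (y := y) hy.1
      have e2 := φ'.restrict_apply s' h' (s := (φ.restrict s Y h).hom.symm y)
        (by rw [e1]; exact hy.2)
      simp only
      rw [e2, e1]
    exact (congrArg (fun t => BSmoothOn t (fun y : (φ.restrict s Y h).model =>
      (φ'.restrict s' Y' h').hom ((φ.restrict s Y h).hom.symm y))) hset).mpr h2

theorem isSmoothChart_restrict [IsLCManifold M] {S : Set M} (hS : IsSubmanifold S) (s₀ : S)
    {φ : LCChart M} {Y : Submodule ℝ φ.model} (h : IsAdapted S φ Y) (hφ : IsSmoothChart φ)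
    (hY : IsClosed (Y : Set φ.model)) : IsSmoothChart (φ.restrict s₀ Y h) :=
  have := hS.isLCManifold
  isSmoothChart_of_mem ⟨s₀, φ, Y, h, hφ, hY, rfl⟩

theorem IsSubmanifold.smooth_val [IsLCManifold M] {S : Set M} (hS : IsSubmanifold S) :
    Smooth (Subtype.val : S → M) := by
  have := hS.isLCManifold
  refine SmoothOn.of_charts fun s _ => ?_
  obtain ⟨φ, Y, hφ, hs, hY, h⟩ := hS s s.2
  refine ⟨φ.restrict s Y h, φ, _, isSmoothChart_restrict hS s h hφ hY, hφ,
    (φ.restrict s Y h).hom.open_source, hs, Subset.rfl, fun _ ht => ht, ?_⟩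
  refine BSmoothOn.congr (bSmoothOn_clm Y.subtypeL _)
    ((φ.restrict s Y h).isOpen_img (φ.restrict s Y h).hom.open_source) fun y hy => ?_
  have e1 := φ.restrict_symm s h (y := y) hy.1
  simp only [chartRep]
  rw [e1, φ.hom.right_inv hy.1]
  rfl

theorem IsSubmanifold.smoothOn_of_val [IsLCManifold M] [IsLCManifold N] {S : Set M}
    (hS : IsSubmanifold S) {f : N → S} {W : Set N} (hW : IsOpen W)
    (hf : SmoothOn (fun x => (f x : M)) W) : SmoothOn f W := by
  have := hS.isLCManifold
  refine SmoothOn.of_charts fun x hx => ?_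
  obtain ⟨φ, Y, hφ, hs, hY, h⟩ := hS (f x) (f x).2
  obtain ⟨χ, hχ, hxχ⟩ := IsLCManifold.cover x
  have hO := (hf.isOpen_inter_preimage hW φ.hom.open_source).inter χ.hom.open_source
  have hχ' := isSmoothChart_of_mem hχ
  refine ⟨χ, φ.restrict (f x) Y h, _, hχ', isSmoothChart_restrict hS _ h hφ hY, hO,
    ⟨⟨hx, hs⟩, hxχ⟩, inter_subset_right, fun y hy => hy.1.2, ?_⟩
  have h1 := BSmoothOn.mono (hf.rep hW hχ' hφ) (χ.img_mono inter_subset_left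
    (O := (W ∩ (fun x => (f x : M)) ⁻¹' φ.hom.source) ∩ χ.hom.source))
  refine BSmoothOn.of_coe (Y := Y) hY (χ.isOpen_img hO) (h1.congr (χ.isOpen_img hO) fun y hy => ?_)
  exact (φ.restrict_apply (f x) h hy.2.1.2).symm

theorem IsSubmanifold.smooth_of_val [IsLCManifold M] [IsLCManifold N] {S : Set M}
    (hS : IsSubmanifold S) {f : N → S} (hf : Smooth (fun x => (f x : M))) : Smooth f :=
  hS.smoothOn_of_val isOpen_univ hf

theorem chartDeriv_restrict_val {S : Set M} (s₀ : S) {φ : LCChart M} {Y : Submodule ℝ φ.model}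
    (h : IsAdapted S φ Y) {s : S} (hs : (s : M) ∈ φ.hom.source) (w : Y) :
    chartDeriv (φ.restrict s₀ Y h) φ (Subtype.val : S → M) s w = (w : φ.model) := by
  refine (HasDirDeriv.congr (hasDirDeriv_clm Y.subtypeL _ w) ?_).dirDeriv_eq
  filter_upwards [(φ.restrict s₀ Y h).hom.open_target.mem_nhds
    ((φ.restrict s₀ Y h).hom.map_source hs)] with y hy
  have e1 := φ.restrict_symm s₀ h (y := y) hy
  simp only [chartRep]
  exact ((congrArg φ.hom e1).trans (φ.hom.right_inv hy)).symm

theorem IsSubmanifold.chartDeriv_val_injective [IsLCManifold M] {S : Set M}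
    (hS : IsSubmanifold S) {s : S} {α : LCChart S} {β : LCChart M} (hα : IsSmoothChart α)
    (hβ : IsSmoothChart β) (hs1 : s ∈ α.hom.source) (hs2 : (s : M) ∈ β.hom.source) :
    Function.Injective (chartDeriv α β (Subtype.val : S → M) s) := by
  have := hS.isLCManifold
  obtain ⟨φ, Y, hφ, hs, hY, h⟩ := hS s s.2
  have hθ : IsSmoothChart (φ.restrict s Y h) := isSmoothChart_restrict hS s h hφ hY
  have hsθ : s ∈ (φ.restrict s Y h).hom.source := hs
  intro w w' hw
  have e : ∀ w : α.model, chartDeriv β φ (fun y => y) (s : M)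
      (chartDeriv α β (Subtype.val : S → M) s w) =
        chartDeriv (φ.restrict s Y h) φ (Subtype.val : S → M) s
          (chartDeriv α (φ.restrict s Y h) (fun y => y) s w) := fun w =>
    (chartDeriv_comp (f := (Subtype.val : S → M)) (g := fun y : M => y) smooth_id
      hS.smooth_val isOpen_univ isOpen_univ trivial trivial hα hβ hφ hs1 hs2 hs w).symm.trans
    (chartDeriv_comp (f := fun y : S => y) (g := (Subtype.val : S → M)) hS.smooth_val
        smooth_id isOpen_univ isOpen_univ trivial trivial hα hθ hφ hs1 hsθ hs w)
  have h1 : chartDeriv α (φ.restrict s Y h) (fun y => y) s w =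
      chartDeriv α (φ.restrict s Y h) (fun y => y) s w' :=
    Subtype.ext (((chartDeriv_restrict_val s h hs _).symm.trans
      ((e w).symm.trans ((congrArg _ hw).trans (e w')))).trans (chartDeriv_restrict_val s h hs _))
  have h2 := congrArg (chartDeriv (φ.restrict s Y h) α (fun y => y) s) h1
  rwa [chartDeriv_id_comp hα hθ hα hs1 hsθ hs1, chartDeriv_id_comp hα hθ hα hs1 hsθ hs1,
    chartDeriv_id hs1, chartDeriv_id hs1] at h2

/-- The inclusion of a submanifold is an immersion. -/
theorem IsSubmanifold.tmap_val_injective [IsLCManifold M] {S : Set M} (hS : IsSubmanifold S)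
    (s : S) : Function.Injective (tmap (Subtype.val : S → M) s s) :=
  have := hS.isLCManifold
  hS.chartDeriv_val_injective (isSmoothChart_chartAt s) (isSmoothChart_chartAt (s : M))
    (mem_chartAt_source s) (mem_chartAt_source (s : M))

end Submanifold

/-! ### Subgroups that are submanifolds -/

section Subgroups

variable {G : Type u} [Group G] [TopologicalSpace G] [LCAtlas G] [IsLCManifold G]
variable {N : Type u} [TopologicalSpace N] [LCAtlas N] [IsLCManifold N]
variable {H : Subgroup G}

theorem IsSubmanifold.isLCManifold_subgroup (hH : IsSubmanifold (H : Set G)) :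
    IsLCManifold H := hH.isLCManifold

theorem IsSubmanifold.smooth_coe (hH : IsSubmanifold (H : Set G)) :
    Smooth (fun h : H => (h : G)) := hH.smooth_val

theorem IsSubmanifold.smooth_of_coe (hH : IsSubmanifold (H : Set G)) {f : N → H}
    (hf : Smooth (fun x => (f x : G))) : Smooth f := hH.smooth_of_val hf

theorem IsSubmanifold.tmap_coe_injective (hH : IsSubmanifold (H : Set G)) (h : H) :
    Function.Injective (tmap (fun h : H => (h : G)) h (h : G)) := hH.tmap_val_injective h

end Subgroups

/-! ### Submersions and quotient manifolds -/

section Quotients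

variable {P N N' : Type u} [TopologicalSpace P] [LCAtlas P] [IsLCManifold P]
  [TopologicalSpace N] [LCAtlas N] [IsLCManifold N]
  [TopologicalSpace N'] [LCAtlas N'] [IsLCManifold N']

/-- A submersion has smooth local sections, through every point of its domain. -/
theorem IsSmoothSubmersion.exists_section {f : P → N} (hf : IsSmoothSubmersion f) (p : P) :
    ∃ (V : Set N) (σ : N → P), IsOpen V ∧ f p ∈ V ∧ SmoothOn σ V ∧ σ (f p) = p ∧
      ∀ n ∈ V, f (σ n) = n := by
  obtain ⟨A, B, φ, ψ, hφ, hψ, hp, h⟩ := hf.2 p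
  have hval : φ p = ((φ p).1, ψ (f p)) := Prod.ext rfl (h p hp).2.symm
  have hi : Continuous (fun b : B => (show A.prod B from ((φ p).1, b))) :=
    Continuous.prodMk_right (X := A) (Y := B) _
  have hi' : ContinuousOn (fun n => (show A.prod B from ((φ p).1, ψ n))) ψ.source :=
    hi.comp_continuousOn ψ.continuousOn
  have hV : IsOpen (ψ.source ∩ (fun n => (show A.prod B from ((φ p).1, ψ n))) ⁻¹' φ.target) :=
    hi'.isOpen_inter_preimage ψ.open_source φ.open_target
  refine ⟨_, fun n => φ.symm ((φ p).1, ψ n), hV, ⟨(h p hp).1, ?_⟩, ?_, ?_, fun n hn => ?_⟩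
  · rw [mem_preimage, ← hval]
    exact φ.map_source hp
  · refine SmoothOn.of_charts fun n hn => ⟨⟨B, ψ⟩, ⟨A.prod B, φ⟩, _, hψ, hφ, hV, hn,
      inter_subset_left, fun m hm => φ.map_target hm.2, ?_⟩
    have h1 : BSmoothOn (univ : Set B) (fun b : B => ((φ p).1, b)) :=
      (bSmoothOn_const (φ p).1 _).prodMk (bSmoothOn_id _) isOpen_univ
    refine BSmoothOn.congr (BSmoothOn.mono h1 (subset_univ _))
      (LCChart.isOpen_img ⟨B, ψ⟩ hV) fun b hb => ?_
    have e1 : ψ (ψ.symm b) = b := ψ.right_inv hb.1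
    have e2 : (show A.prod B from ((φ p).1, ψ (ψ.symm b))) ∈ φ.target := hb.2.2
    have e3 := φ.right_inv e2
    simp only [chartRep]
    refine Eq.trans ?_ e3.symm
    rw [e1]
  · exact (congrArg φ.symm hval.symm).trans (φ.left_inv hp)
  · have h1 := h _ (φ.map_target hn.2)
    have h2 : ψ (f (φ.symm ((φ p).1, ψ n))) = ψ n := by
      rw [h1.2, φ.right_inv hn.2]
    exact ψ.injOn h1.1 hn.1 h2

/-- A map out of the target of a surjective submersion is smooth if it is smooth upstairs. -/
theorem IsSmoothSubmersion.smooth_of_comp {f : P → N} (hf : IsSmoothSubmersion f)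
    (hs : Function.Surjective f) {g : N → N'} (hg : Smooth (fun p => g (f p))) : Smooth g := by
  refine SmoothOn.of_locally fun n _ => ?_
  obtain ⟨p, rfl⟩ := hs n
  obtain ⟨V, σ, hV, hpV, hσ, -, hfσ⟩ := hf.exists_section p
  refine ⟨V, hV, hpV, ?_⟩
  rw [univ_inter]
  exact (Smooth.comp_smoothOn hg hσ hV).congr hV fun n hn => by simp only [hfσ n hn]

theorem IsSmoothSubmersion.tmap_surjective {f : P → N} (hf : IsSmoothSubmersion f) (p : P) :
    Function.Surjective (tmap f p (f p)) := by
  obtain ⟨V, σ, hV, hpV, hσ, hσp, hfσ⟩ := hf.exists_section p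
  intro w
  refine ⟨tmap σ (f p) p w, ?_⟩
  have hc := chartDeriv_comp (f := σ) (g := f) hf.1 hσ hV isOpen_univ hpV trivial
    (φ := chartAt (f p)) (ψ := chartAt p) (χ := chartAt (f p)) (isSmoothChart_chartAt _)
    (isSmoothChart_chartAt _) (isSmoothChart_chartAt _) (mem_chartAt_source _)
    (by rw [hσp]; exact mem_chartAt_source _) (by rw [hσp]; exact mem_chartAt_source _) w
  rw [hσp] at hc
  refine hc.symm.trans ?_
  refine (chartDeriv_congr (mem_chartAt_source _) ?_ w).trans
    (chartDeriv_id (mem_chartAt_source (f p)) w)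
  filter_upwards [hV.mem_nhds hpV] with n hn
  exact hfσ n hn

/-- A chart of `P` in which the equivalence relation `r` consists of the equality of the second
coordinate. -/
structure QuotChart (r : Setoid P) : Type (u + 1) where
  A : LCS.{u}
  B : LCS.{u}
  φ : OpenPartialHomeomorph P (A.prod B)
  smooth : IsSmoothChart ⟨A.prod B, φ⟩
  base : P
  base_mem : base ∈ φ.source
  rel : ∀ x ∈ φ.source, ∀ y ∈ φ.source, r x y ↔ (φ x).2 = (φ y).2

namespace QuotChart

variable {r : Setoid P} (c : QuotChart r)

open Classical in
/-- The second coordinate, as a function on the quotient. -/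
def coord (q : Quotient r) : c.B :=
  if h : ∃ x ∈ c.φ.source, Quotient.mk r x = q then (c.φ h.choose).2 else 0

open Classical in
/-- The class of the points with a given second coordinate. -/
def param (b : c.B) : Quotient r :=
  if h : ∃ a : c.A, (show c.A.prod c.B from (a, b)) ∈ c.φ.target
    then Quotient.mk r (c.φ.symm (h.choose, b)) else Quotient.mk r c.base

theorem coord_mk {x : P} (hx : x ∈ c.φ.source) : c.coord (Quotient.mk r x) = (c.φ x).2 := by
  have h : ∃ y ∈ c.φ.source, Quotient.mk r y = Quotient.mk r x := ⟨x, hx, rfl⟩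
  rw [coord, dif_pos h]
  exact (c.rel _ h.choose_spec.1 _ hx).1 (Quotient.exact h.choose_spec.2)

theorem param_eq {a : c.A} {b : c.B} (h : (show c.A.prod c.B from (a, b)) ∈ c.φ.target) :
    c.param b = Quotient.mk r (c.φ.symm (a, b)) := by
  have h' : ∃ a : c.A, (show c.A.prod c.B from (a, b)) ∈ c.φ.target := ⟨a, h⟩
  rw [param, dif_pos h']
  refine Quotient.sound ((c.rel _ (c.φ.map_target h'.choose_spec) _ (c.φ.map_target h)).2 ?_)
  rw [c.φ.right_inv h'.choose_spec, c.φ.right_inv h]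

theorem param_apply {x : P} (hx : x ∈ c.φ.source) :
    c.param (c.φ x).2 = Quotient.mk r x := by
  have h : (show c.A.prod c.B from ((c.φ x).1, (c.φ x).2)) ∈ c.φ.target := c.φ.map_source hx
  rw [c.param_eq h]
  exact congrArg _ (c.φ.left_inv hx)

/-- The chart of the quotient given by the second coordinate. -/
def chart (hr : IsOpenMap (Quotient.mk r)) : LCChart (Quotient r) where
  model := c.B
  hom :=
    { toFun := c.coord
      invFun := c.param
      source := Quotient.mk r '' c.φ.source
      target := {b | ∃ a : c.A, (show c.A.prod c.B from (a, b)) ∈ c.φ.target}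
      map_source' := by
        rintro _ ⟨x, hx, rfl⟩
        rw [c.coord_mk hx]
        exact ⟨(c.φ x).1, c.φ.map_source hx⟩
      map_target' := by
        rintro b ⟨a, h⟩
        rw [c.param_eq h]
        exact mem_image_of_mem _ (c.φ.map_target h)
      left_inv' := by
        rintro _ ⟨x, hx, rfl⟩
        rw [c.coord_mk hx, c.param_apply hx]
      right_inv' := by
        rintro b ⟨a, h⟩
        rw [c.param_eq h, c.coord_mk (c.φ.map_target h), c.φ.right_inv h]
      open_source := hr _ c.φ.open_source
      open_target := by
        have h := isOpenMap_snd (X := c.A) (Y := c.B) _ c.φ.open_target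
        convert h using 1
        ext b
        exact ⟨fun ⟨a, h⟩ => ⟨(a, b), h, rfl⟩, by rintro ⟨⟨a, b⟩, h, rfl⟩; exact ⟨a, h⟩⟩
      continuousOn_toFun := by
        rintro _ ⟨x, hx, rfl⟩
        refine ContinuousAt.continuousWithinAt ?_
        have h1 : 𝓝 (Quotient.mk r x) ≤ map (Quotient.mk r) (𝓝 x) := hr.nhds_le x
        refine Tendsto.mono_left ?_ h1
        rw [tendsto_map'_iff, c.coord_mk hx]
        have h2 : Tendsto (fun y => (c.φ y).2) (𝓝 x) (𝓝 (c.φ x).2) :=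
          (continuous_snd (X := c.A) (Y := c.B)).continuousAt.tendsto.comp
            (c.φ.continuousAt hx)
        refine h2.congr' ?_
        filter_upwards [c.φ.open_source.mem_nhds hx] with y hy
        exact (c.coord_mk hy).symm
      continuousOn_invFun := by
        rintro b ⟨a, h⟩
        refine ContinuousAt.continuousWithinAt ?_
        have hi : Continuous (fun b : c.B => (show c.A.prod c.B from (a, b))) :=
          Continuous.prodMk_right (X := c.A) (Y := c.B) a
        have h1 : ContinuousAt (fun b => Quotient.mk r (c.φ.symm (a, b))) b :=
          continuous_quotient_mk'.continuousAt.comp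
            ((c.φ.continuousAt_symm h).comp hi.continuousAt)
        refine h1.congr ?_
        filter_upwards [(c.φ.open_target.preimage hi).mem_nhds h] with b' hb'
        exact (c.param_eq hb').symm }

variable {c}

/-- Charts of the quotient are compatible if equivalent points can be moved to each other by smooth
maps preserving the equivalence classes. -/
theorem smoothTransition (hr : IsOpenMap (Quotient.mk r))
    (hmove : ∀ p p', r p p' → ∃ γ : P → P, Smooth γ ∧ γ p = p' ∧ ∀ x, r x (γ x))
    (c c' : QuotChart r) : SmoothTransition (c.chart hr) (c'.chart hr) := by
  refine BSmoothOn.of_locally (E := c.B) (F := c'.B) fun b hb => ?_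
  obtain ⟨⟨a, ha⟩, hb'⟩ := hb
  obtain ⟨x', hx', hxx'⟩ : c.param b ∈ Quotient.mk r '' c'.φ.source := hb'
  rw [c.param_eq ha] at hxx'
  obtain ⟨γ, hγ, hγx, hγr⟩ := hmove _ _ (Quotient.exact hxx'.symm)
  have hopen := (SmoothOn.isOpen_inter_preimage hγ isOpen_univ c'.φ.open_source)
  have hrep := SmoothOn.rep hγ isOpen_univ c.smooth c'.smooth
  have hi : BSmoothOn (univ : Set c.B) (fun b : c.B => (a, b)) :=
    (bSmoothOn_const a _).prodMk (bSmoothOn_id _) isOpen_univ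
  have hic : Continuous (fun b : c.B => (show c.A.prod c.B from (a, b))) :=
    Continuous.prodMk_right (X := c.A) (Y := c.B) a
  have hO := LCChart.isOpen_img ⟨c.A.prod c.B, c.φ⟩ hopen
  have hV := hO.preimage hic
  refine ⟨_, hV, ⟨ha, trivial, ?_⟩, ?_⟩
  · rw [mem_preimage]
    change γ (c.φ.symm _) ∈ _
    rw [hγx]
    exact hx'
  · have h1 := (BSmoothOn.comp hrep (hi.mono (subset_univ _)) hV hO
      (fun b hb => hb)).clm_comp hV (ContinuousLinearMap.snd ℝ c'.A c'.B)
    refine BSmoothOn.mono (V := _ ∩ _) (BSmoothOn.congr h1 hV ?_) inter_subset_right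
    intro b₁ hb₁
    have e1 : (c.chart hr).hom.symm b₁ = Quotient.mk r (c.φ.symm (a, b₁)) := c.param_eq hb₁.1
    have e2 : Quotient.mk r (c.φ.symm (a, b₁)) = Quotient.mk r (γ (c.φ.symm (a, b₁))) :=
      Quotient.sound (hγr _)
    have e3 := c'.coord_mk (show γ (c.φ.symm (a, b₁)) ∈ c'.φ.source from hb₁.2.2)
    refine Eq.trans ?_ ((congrArg c'.coord (e1.trans e2)).trans e3).symm
    rfl

/-- The manifold structure on the quotient. -/
def smoothStructure (hr : IsOpenMap (Quotient.mk r))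
    (hcl : IsClosed {p : P × P | r p.1 p.2})
    (hmove : ∀ p p', r p p' → ∃ γ : P → P, Smooth γ ∧ γ p = p' ∧ ∀ x, r x (γ x))
    (c : P → QuotChart r) (hc : ∀ p, p ∈ (c p).φ.source) : SmoothStructure (Quotient r) where
  top := inferInstance
  atlas := ⟨range fun p => (c p).chart hr⟩
  manifold :=
    letI : LCAtlas (Quotient r) := ⟨range fun p => (c p).chart hr⟩
    { t2 := by
        refine (t2Space_iff_of_isOpenQuotientMap
          (⟨Quotient.mk_surjective, continuous_quotient_mk', hr⟩ :
            IsOpenQuotientMap (Quotient.mk r))).2 ?_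
        convert hcl using 3
        exact Quotient.eq
      cover := by
        intro q
        induction q using Quotient.inductionOn with
        | h p => exact ⟨_, ⟨p, rfl⟩, mem_image_of_mem _ (hc p)⟩
      compatible := by
        rintro _ ⟨p, rfl⟩ _ ⟨p', rfl⟩
        exact smoothTransition hr hmove _ _ }

theorem isSmoothSubmersion (hr : IsOpenMap (Quotient.mk r))
    (hcl : IsClosed {p : P × P | r p.1 p.2})
    (hmove : ∀ p p', r p p' → ∃ γ : P → P, Smooth γ ∧ γ p = p' ∧ ∀ x, r x (γ x))
    (c : P → QuotChart r) (hc : ∀ p, p ∈ (c p).φ.source) :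
    IsSmoothSubmersion (fun p : P => (smoothStructure hr hcl hmove c hc).into (Quotient.mk r p)) := by
  set 𝒮 := smoothStructure hr hcl hmove c hc with h𝒮
  have : IsLCManifold 𝒮.Carrier := 𝒮.manifold
  have hmem : ∀ p, (show LCChart 𝒮.Carrier from (c p).chart hr) ∈
    LCAtlas.charts (M := 𝒮.Carrier) := fun p => ⟨p, rfl⟩
  have key : ∀ p, ∀ x ∈ (c p).φ.source,
      𝒮.into (Quotient.mk r x) ∈ (show LCChart 𝒮.Carrier from (c p).chart hr).hom.source ∧
        (show LCChart 𝒮.Carrier from (c p).chart hr).hom (𝒮.into (Quotient.mk r x)) =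
          ((c p).φ x).2 := fun p x hx => ⟨mem_image_of_mem _ hx, (c p).coord_mk hx⟩
  refine ⟨SmoothOn.of_charts fun p _ => ?_, fun p => ?_⟩
  · refine ⟨⟨(c p).A.prod (c p).B, (c p).φ⟩, (show LCChart 𝒮.Carrier from (c p).chart hr),
      (c p).φ.source, (c p).smooth, isSmoothChart_of_mem (hmem p), (c p).φ.open_source, hc p,
      Subset.rfl, fun x hx => (key p x hx).1, ?_⟩
    refine BSmoothOn.congr (bSmoothOn_clm (ContinuousLinearMap.snd ℝ (c p).A (c p).B) _)
      (LCChart.isOpen_img ⟨(c p).A.prod (c p).B, (c p).φ⟩ (c p).φ.open_source) fun y hy => ?_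
    exact (((key p _ hy.2).2).trans (congrArg Prod.snd ((c p).φ.right_inv hy.1))).symm
  · exact ⟨(c p).A, (c p).B, (c p).φ, (show LCChart 𝒮.Carrier from (c p).chart hr).hom,
      (c p).smooth, isSmoothChart_of_mem (hmem p), hc p, key p⟩

end QuotChart

/-- The manifold structure on a quotient is determined by the requirement that the projection be a
submersion. -/
theorem SmoothStructure.same_of_isSmoothSubmersion {r : Setoid P} {𝒮 𝒮' : SmoothStructure (Quotient r)}
    (h : IsSmoothSubmersion (fun p : P => 𝒮.into (Quotient.mk r p)))
    (h' : IsSmoothSubmersion (fun p : P => 𝒮'.into (Quotient.mk r p))) : 𝒮.Same 𝒮' := by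
  have : IsLCManifold 𝒮.Carrier := 𝒮.manifold
  have : IsLCManifold 𝒮'.Carrier := 𝒮'.manifold
  exact ⟨h.smooth_of_comp Quotient.mk_surjective h'.1,
    h'.smooth_of_comp Quotient.mk_surjective h.1⟩

end Quotients

/-! ### Smooth curves and Mackey completeness -/

section Mackey

section Smul

variable {E : Type u} [AddCommGroup E] [Module ℝ E] [TopologicalSpace E]
variable {F : Type v} [AddCommGroup F] [Module ℝ F] [TopologicalSpace F]
  [IsTopologicalAddGroup F] [ContinuousSMul ℝ F] [T2Space F]

theorem HasDirDeriv.smul {c : E → ℝ} {f : E → F} {x w : E} {c' : ℝ} {y : F}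
    (hc : HasDirDeriv c x w c') (hf : HasDirDeriv f x w y) :
    HasDirDeriv (fun e => c e • f e) x w (c' • f x + c x • y) := by
  have hid : Tendsto (fun t : ℝ => t) (𝓝[≠] 0) (𝓝 0) := nhdsWithin_le_nhds
  have h1 : Tendsto (fun t : ℝ => f (x + t • w)) (𝓝[≠] 0) (𝓝 (f x)) := by
    have := (hid.smul hf).add_const (f x)
    rw [zero_smul, zero_add] at this
    refine this.congr' ?_
    filter_upwards [self_mem_nhdsWithin] with t (ht : t ≠ 0)
    simp [smul_smul, mul_inv_cancel₀ ht]
  refine ((Tendsto.smul hc h1).add (Tendsto.const_smul hf (c x))).congr fun t => ?_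
  rw [smul_eq_mul, mul_smul, smul_comm (c x), ← smul_add, sub_smul, smul_sub]
  congr 1
  abel

theorem BContDiffOn.smul : ∀ (n : ℕ) {E : Type u} [AddCommGroup E] [Module ℝ E]
    [TopologicalSpace E] [IsTopologicalAddGroup E] [ContinuousSMul ℝ E]
    [LocallyConvexSpace ℝ E] [LocallyConvexSpace ℝ F] {U : Set E} {c : E → ℝ}
    {f : E → F}, BContDiffOn n U c → BContDiffOn n U f → IsOpen U →
      BContDiffOn n U (fun e => c e • f e)
  | 0, _, _, _, _, _, _, _, _, _, _, _, hc, hf, _ => ContinuousOn.smul hc hf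
  | n + 1, E, _, _, _, _, _, _, _, U, c, f, hc, hf, hU => by
    have hd : ∀ x ∈ U, ∀ w, HasDirDeriv (fun e => c e • f e) x w
        (dirDeriv c x w • f x + c x • dirDeriv f x w) := fun x hx w =>
      (hasDirDeriv_dirDeriv (hc.2.1 x hx w)).smul (hasDirDeriv_dirDeriv (hf.2.1 x hx w))
    have hU' := hU.prod (isOpen_univ (X := E))
    have h1 : BContDiffOn n (U ×ˢ (univ : Set E)) (fun p : E × E => c p.1) :=
      ((BContDiffOn.of_succ n hc).comp_clm n (ContinuousLinearMap.fst ℝ E E)).mono n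
        (fun p hp => hp.1)
    have h2 : BContDiffOn n (U ×ˢ (univ : Set E)) (fun p : E × E => f p.1) :=
      ((BContDiffOn.of_succ n hf).comp_clm n (ContinuousLinearMap.fst ℝ E E)).mono n
        (fun p hp => hp.1)
    refine ⟨ContinuousOn.smul hc.1 hf.1, fun x hx w => ⟨_, hd x hx w⟩, ?_⟩
    exact BContDiffOn.congr n ((BContDiffOn.smul n hc.2.2 h2 hU').add
      (BContDiffOn.smul n h1 hf.2.2 hU') hU') hU' fun p hp => (hd p.1 hp.1 p.2).dirDeriv_eq.symm

theorem HasDirDeriv.sum {ι : Type*} {f : ι → E → F} {x w : E} {y : ι → F} (s : Finset ι)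
    (h : ∀ i ∈ s, HasDirDeriv (f i) x w (y i)) :
    HasDirDeriv (fun e => ∑ i ∈ s, f i e) x w (∑ i ∈ s, y i) := by
  refine (tendsto_finsetSum s h).congr fun t => ?_
  rw [← Finset.smul_sum, Finset.sum_sub_distrib]

/-- A curve with successive derivatives of all orders is smooth. -/
theorem bSmoothOn_curve [LocallyConvexSpace ℝ F] {g : ℕ → ℝ → F}
    (h : ∀ k t, HasDirDeriv (g k) t 1 (g (k + 1) t)) : BSmoothOn univ (g 0) := by
  have hc : ∀ k, Continuous (g k) := fun k =>
    continuous_iff_continuousAt.2 fun t => (h k t).continuousAt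
  have hd : ∀ k t s, HasDirDeriv (g k) t s (s • g (k + 1) t) := fun k t s => by
    have := (h k t).smul_dir s
    rwa [smul_eq_mul, mul_one] at this
  have key : ∀ n k, BContDiffOn n univ (g k) := by
    intro n
    induction n with
    | zero => exact fun k => (hc k).continuousOn
    | succ n ih =>
      refine fun k => ⟨(hc k).continuousOn, fun t _ s => ⟨_, hd k t s⟩, ?_⟩
      simp only [(hd k _ _).dirDeriv_eq]
      rw [univ_prod_univ]
      exact BContDiffOn.smul n (BContDiffOn.clm n (ContinuousLinearMap.snd ℝ ℝ ℝ) _)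
        ((ih (k + 1)).comp_clm n (ContinuousLinearMap.fst ℝ ℝ ℝ)) isOpen_univ
  exact fun n => key n 0

end Smul

/-- The derivative of order `k + 1` of the smooth transition function. -/
def stepDeriv (k : ℕ) : ℝ → ℝ := iteratedDeriv (k + 1) Real.smoothTransition

theorem contDiff_smoothTransition : ContDiff ℝ (⊤ : ℕ∞) Real.smoothTransition :=
  Real.smoothTransition.contDiff

theorem hasDerivAt_stepDeriv (k : ℕ) (x : ℝ) :
    HasDerivAt (stepDeriv k) (stepDeriv (k + 1) x) x := by
  have h : Differentiable ℝ (iteratedDeriv (k + 1) Real.smoothTransition) :=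
    contDiff_smoothTransition.differentiable_iteratedDeriv (k + 1)
      (by exact_mod_cast WithTop.coe_lt_top _)
  have := (h x).hasDerivAt
  rwa [← iteratedDeriv_succ] at this

theorem hasDerivAt_smoothTransition (x : ℝ) :
    HasDerivAt Real.smoothTransition (stepDeriv 0 x) x := by
  have h : Differentiable ℝ Real.smoothTransition :=
    contDiff_smoothTransition.differentiable (by simp)
  have := (h x).hasDerivAt
  rwa [← iteratedDeriv_one] at this

theorem continuous_stepDeriv (k : ℕ) : Continuous (stepDeriv k) :=
  continuous_iff_continuousAt.2 fun x => (hasDerivAt_stepDeriv k x).continuousAt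

theorem stepDeriv_eq_zero (k : ℕ) {x : ℝ} (hx : x ∉ Ioo (0 : ℝ) 1) : stepDeriv k x = 0 := by
  have h1 : ∀ k, ∀ x ∈ Iio (0 : ℝ), stepDeriv k x = 0 := by
    intro k
    induction k with
    | zero =>
      intro x hx
      refine (hasDerivAt_smoothTransition x).unique ((hasDerivAt_const x (0 : ℝ)).congr_of_eventuallyEq ?_)
      filter_upwards [isOpen_Iio.mem_nhds hx] with y hy
      exact Real.smoothTransition.zero_of_nonpos (le_of_lt hy)
    | succ k ih =>
      intro x hx
      refine (hasDerivAt_stepDeriv k x).unique ((hasDerivAt_const x (0 : ℝ)).congr_of_eventuallyEq ?_)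
      filter_upwards [isOpen_Iio.mem_nhds hx] with y hy
      exact ih y hy
  have h2 : ∀ k, ∀ x ∈ Ioi (1 : ℝ), stepDeriv k x = 0 := by
    intro k
    induction k with
    | zero =>
      intro x hx
      refine (hasDerivAt_smoothTransition x).unique ((hasDerivAt_const x (1 : ℝ)).congr_of_eventuallyEq ?_)
      filter_upwards [isOpen_Ioi.mem_nhds hx] with y hy
      exact Real.smoothTransition.one_of_one_le (le_of_lt hy)
    | succ k ih =>
      intro x hx
      refine (hasDerivAt_stepDeriv k x).unique ((hasDerivAt_const x (0 : ℝ)).congr_of_eventuallyEq ?_)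
      filter_upwards [isOpen_Ioi.mem_nhds hx] with y hy
      exact ih y hy
  have hcl : IsClosed {x | stepDeriv k x = 0} :=
    isClosed_singleton.preimage (continuous_stepDeriv k)
  rcases le_or_gt x 0 with h | h
  · have : closure (Iio (0 : ℝ)) ⊆ {x | stepDeriv k x = 0} := closure_minimal (h1 k) hcl
    rw [closure_Iio] at this
    exact this h
  · have : closure (Ioi (1 : ℝ)) ⊆ {x | stepDeriv k x = 0} := closure_minimal (h2 k) hcl
    rw [closure_Ioi] at this
    refine this ?_
    by_contra h'
    exact hx ⟨h, not_le.1 h'⟩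

theorem exists_stepDeriv_bound (k : ℕ) : ∃ C, 0 ≤ C ∧ ∀ x, |stepDeriv k x| ≤ C := by
  obtain ⟨C, hC⟩ := isCompact_Icc.exists_bound_of_continuousOn
    (continuous_stepDeriv k).continuousOn (s := Icc (0 : ℝ) 1)
  refine ⟨C, (norm_nonneg _).trans (hC 0 (by simp)), fun x => ?_⟩
  by_cases hx : x ∈ Icc (0 : ℝ) 1
  · exact hC x hx
  · rw [stepDeriv_eq_zero k fun h => hx (Ioo_subset_Icc_self h), abs_zero]
    exact (norm_nonneg _).trans (hC 0 (by simp))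

/-- The derivatives of a bump function on the interval `(2⁻ⁿ⁻¹, 2⁻ⁿ)` with integral `1`. -/
def bump (n k : ℕ) (t : ℝ) : ℝ := (2 ^ (n + 1)) ^ (k + 1) * stepDeriv k (2 ^ (n + 1) * t - 1)

theorem hasDerivAt_bump (n k : ℕ) (t : ℝ) : HasDerivAt (bump n k) (bump n (k + 1) t) t := by
  have h1 : HasDerivAt (fun t : ℝ => (2 : ℝ) ^ (n + 1) * t - 1) (2 ^ (n + 1)) t := by
    simpa using ((hasDerivAt_id t).const_mul ((2 : ℝ) ^ (n + 1))).sub_const 1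
  have h2 := ((hasDerivAt_stepDeriv k (2 ^ (n + 1) * t - 1)).comp t h1).const_mul
    (((2 : ℝ) ^ (n + 1)) ^ (k + 1))
  refine h2.congr_deriv ?_
  rw [bump, pow_succ _ (k + 1)]
  ring

theorem bump_eq_zero {n k : ℕ} {t : ℝ} (h : ¬ (1 < 2 ^ (n + 1) * t ∧ 2 ^ (n + 1) * t < 2)) :
    bump n k t = 0 := by
  rw [bump, stepDeriv_eq_zero, mul_zero]
  rintro ⟨h1, h2⟩
  exact h ⟨by linarith, by linarith⟩

theorem hasDirDeriv_of_hasDerivAt {g : ℝ → ℝ} {t y : ℝ} (h : HasDerivAt g y t) :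
    HasDirDeriv g t 1 y := by
  rw [hasDerivAt_iff_tendsto_slope_zero] at h
  simpa [HasDirDeriv] using h

variable {E : LCS.{u}}

/-- The curve `∑ₙ bump n k t • d n`; for every `t`, at most one summand does not vanish. -/
def bumpCurve (d : ℕ → E) (k : ℕ) (t : ℝ) : E := ∑ᶠ n, bump n k t • d n

theorem bumpCurve_eq_sum (d : ℕ → E) (k : ℕ) {t : ℝ} {N : ℕ} (ht : 1 < 2 ^ N * t) :
    bumpCurve d k t = ∑ n ∈ Finset.range N, bump n k t • d n := by
  refine finsum_eq_sum_of_support_subset _ fun n hn => ?_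
  by_contra hnN
  have hN : N ≤ n := by simpa using hnN
  refine hn ?_
  simp only
  have ht0 : 0 < t := by
    by_contra h
    have : (2 : ℝ) ^ N * t ≤ 0 := mul_nonpos_of_nonneg_of_nonpos (by positivity) (not_lt.1 h)
    linarith
  have h2 : (2 : ℝ) ^ (N + 1) ≤ 2 ^ (n + 1) := pow_le_pow_right₀ (by norm_num) (by omega)
  have h3 : (2 : ℝ) ^ (N + 1) * t ≤ 2 ^ (n + 1) * t := mul_le_mul_of_nonneg_right h2 ht0.le
  rw [bump_eq_zero, zero_smul]
  rintro ⟨-, h⟩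
  rw [pow_succ] at h3
  linarith

theorem bumpCurve_eq_single (d : ℕ → E) (k : ℕ) {t : ℝ} {n : ℕ} (h1 : 1 ≤ 2 ^ (n + 1) * t)
    (h2 : 2 ^ (n + 1) * t ≤ 2) : bumpCurve d k t = bump n k t • d n := by
  have ht0 : 0 < t := by
    by_contra h
    have : (2 : ℝ) ^ (n + 1) * t ≤ 0 := mul_nonpos_of_nonneg_of_nonpos (by positivity) (not_lt.1 h)
    linarith
  refine finsum_eq_single _ n fun m hm => ?_
  rw [bump_eq_zero, zero_smul]
  rintro ⟨h3, h4⟩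
  rcases lt_or_gt_of_ne hm with h | h
  · have : (2 : ℝ) ^ (m + 2) * t ≤ 2 ^ (n + 1) * t :=
      mul_le_mul_of_nonneg_right (pow_le_pow_right₀ (by norm_num) (by omega)) ht0.le
    rw [show m + 2 = (m + 1) + 1 from rfl, pow_succ _ (m + 1)] at this
    linarith
  · have : (2 : ℝ) ^ (n + 2) * t ≤ 2 ^ (m + 1) * t :=
      mul_le_mul_of_nonneg_right (pow_le_pow_right₀ (by norm_num) (by omega)) ht0.le
    rw [show n + 2 = (n + 1) + 1 from rfl, pow_succ _ (n + 1)] at this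
    linarith

theorem bumpCurve_of_nonpos (d : ℕ → E) (k : ℕ) {t : ℝ} (ht : t ≤ 0) : bumpCurve d k t = 0 := by
  refine (finsum_congr fun n => ?_).trans finsum_zero
  rw [bump_eq_zero, zero_smul]
  rintro ⟨h, -⟩
  have : (2 : ℝ) ^ (n + 1) * t ≤ 0 := mul_nonpos_of_nonneg_of_nonpos (by positivity) ht
  linarith

theorem bumpCurve_cases (d : ℕ → E) (k : ℕ) (t : ℝ) : bumpCurve d k t = 0 ∨
    ∃ n : ℕ, 1 < 2 ^ (n + 1) * t ∧ bumpCurve d k t = bump n k t • d n := by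
  by_cases h : ∃ n : ℕ, 1 < 2 ^ (n + 1) * t ∧ 2 ^ (n + 1) * t < 2
  · obtain ⟨n, h1, h2⟩ := h
    exact Or.inr ⟨n, h1, bumpCurve_eq_single d k h1.le h2.le⟩
  · left
    refine (finsum_congr fun n => ?_).trans finsum_zero
    rw [bump_eq_zero fun h' => h ⟨n, h'⟩, zero_smul]

theorem hasDirDeriv_bumpCurve {d : ℕ → E}
    (hd : ∀ q : Seminorm ℝ E, Continuous q → ∃ C, ∀ n, q (d n) ≤ C / n.factorial) (k : ℕ) (t : ℝ) :
    HasDirDeriv (bumpCurve d k) t 1 (bumpCurve d (k + 1) t) := by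
  rcases lt_trichotomy t 0 with ht | rfl | ht
  · rw [bumpCurve_of_nonpos d _ ht.le]
    refine HasDirDeriv.congr (hasDirDeriv_const (0 : E) t (1 : ℝ)) ?_
    filter_upwards [isOpen_Iio.mem_nhds ht] with s hs
    exact (bumpCurve_of_nonpos d k (le_of_lt hs)).symm
  · rw [bumpCurve_of_nonpos d _ le_rfl]
    refine tendsto_of_seminorm fun q hq ε hε => ?_
    obtain ⟨C, hC⟩ := hd q hq
    obtain ⟨D, hD0, hD⟩ := exists_stepDeriv_bound k
    have hlim : Tendsto (fun n : ℕ => D * C * 2 ^ (k + 2) *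
        (((2 : ℝ) ^ (k + 2)) ^ n / n.factorial)) atTop (𝓝 0) := by
      simpa using (FloorSemiring.tendsto_pow_div_factorial_atTop ((2 : ℝ) ^ (k + 2))).const_mul
        (D * C * 2 ^ (k + 2))
    obtain ⟨N, hN⟩ := eventually_atTop.1 (hlim.eventually (gt_mem_nhds hε))
    have hsmall : ∀ᶠ s : ℝ in 𝓝[≠] 0, s < (2 ^ N)⁻¹ :=
      nhdsWithin_le_nhds (gt_mem_nhds (by positivity))
    filter_upwards [hsmall] with s hs
    rw [sub_zero, zero_add, smul_eq_mul, mul_one, bumpCurve_of_nonpos d k le_rfl, sub_zero]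
    rcases bumpCurve_cases d k s with h | ⟨n, h1, h2⟩
    · rw [h, smul_zero, map_zero]
      exact hε
    · have hs0 : 0 < s := by
        by_contra h
        have : (2 : ℝ) ^ (n + 1) * s ≤ 0 :=
          mul_nonpos_of_nonneg_of_nonpos (by positivity) (not_lt.1 h)
        linarith
      have hNn : N ≤ n := by
        by_contra h
        have h3 : (2 : ℝ) ^ (n + 1) ≤ 2 ^ N := pow_le_pow_right₀ (by norm_num) (by omega)
        have h4 : (2 : ℝ) ^ (n + 1) * s ≤ 2 ^ N * s := mul_le_mul_of_nonneg_right h3 hs0.le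
        have h5 : (2 : ℝ) ^ N * s < 1 := by
          have := mul_lt_mul_of_pos_left hs (show (0 : ℝ) < 2 ^ N by positivity)
          rwa [mul_inv_cancel₀ (by positivity)] at this
        linarith
      refine lt_of_le_of_lt ?_ (hN n hNn)
      have hs1 : s⁻¹ ≤ 2 ^ (n + 1) := by
        rw [inv_le_iff_one_le_mul₀ hs0]
        exact h1.le
      rw [h2, map_smul_eq_mul, map_smul_eq_mul, Real.norm_eq_abs, Real.norm_eq_abs,
        abs_of_pos (inv_pos.2 hs0), bump, abs_mul, abs_of_pos (by positivity)]
      have hq0 : 0 ≤ q (d n) := apply_nonneg q _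
      have hC' := hC n
      calc s⁻¹ * ((2 ^ (n + 1)) ^ (k + 1) * |stepDeriv k (2 ^ (n + 1) * s - 1)| * q (d n))
          ≤ 2 ^ (n + 1) * ((2 ^ (n + 1)) ^ (k + 1) * D * (C / n.factorial)) := by
            gcongr
            exact hD _
        _ = D * C * 2 ^ (k + 2) * ((2 ^ (k + 2)) ^ n / n.factorial) := by
            rw [← pow_mul, ← pow_mul]
            have : (2 : ℝ) ^ (n + 1) * 2 ^ ((n + 1) * (k + 1)) = 2 ^ (k + 2) * 2 ^ ((k + 2) * n) := by
              rw [← pow_add, ← pow_add]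
              congr 1
              ring
            linear_combination (D * (C / n.factorial)) * this
  · obtain ⟨N, hN⟩ : ∃ N : ℕ, 1 < 2 ^ N * t := by
      obtain ⟨N, hN⟩ := pow_unbounded_of_one_lt t⁻¹ (show (1 : ℝ) < 2 by norm_num)
      exact ⟨N, by rwa [inv_lt_iff_one_lt_mul₀ ht] at hN⟩
    rw [bumpCurve_eq_sum d _ hN]
    refine HasDirDeriv.congr (f := fun s => ∑ n ∈ Finset.range N, bump n k s • d n)
      (HasDirDeriv.sum _ fun n _ => ?_) ?_
    · have := (hasDirDeriv_of_hasDerivAt (hasDerivAt_bump n k t)).smul (hasDirDeriv_const (d n) t (1 : ℝ))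
      rwa [smul_zero, add_zero] at this
    · have ho : IsOpen {s : ℝ | 1 < 2 ^ N * s} := isOpen_lt (by fun_prop) (by fun_prop)
      filter_upwards [ho.mem_nhds hN] with s hs
      exact (bumpCurve_eq_sum d k hs).symm

/-- In a Mackey complete space, rapidly decreasing series converge: such a series is the integral of
a smooth curve made of disjoint bumps. -/
theorem IsMackeyComplete.exists_tendsto_sum (hE : IsMackeyComplete E) {d : ℕ → E}
    (hd : ∀ q : Seminorm ℝ E, Continuous q → ∃ C, ∀ n, q (d n) ≤ C / n.factorial) :
    ∃ s, Tendsto (fun N => ∑ n ∈ Finset.range N, d n) atTop (𝓝 s) := by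
  obtain ⟨η, hη⟩ := hE (bumpCurve d 0) (bSmoothOn_curve fun k t => hasDirDeriv_bumpCurve hd k t)
  have hstep : ∀ n : ℕ, η ((2 ^ n)⁻¹) - η ((2 ^ (n + 1))⁻¹) = d n := fun n => by
    set L : ℝ := 2 ^ (n + 1) with hL
    have hL0 : 0 < L := by positivity
    have hL2 : ((2 : ℝ) ^ n)⁻¹ = L⁻¹ + L⁻¹ := by
      rw [hL, pow_succ]
      field_simp
      norm_num
    have hder : ∀ t, HasDerivAt (fun t => - Real.smoothTransition (L * t - 1)) (- bump n 0 t) t :=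
      fun t => by
        have h1 : HasDerivAt (fun t : ℝ => L * t - 1) L t := by
          simpa using ((hasDerivAt_id t).const_mul L).sub_const 1
        refine (((hasDerivAt_smoothTransition (L * t - 1)).comp t h1).neg).congr_deriv ?_
        simp only [bump, ← hL, zero_add, pow_one]
        ring
    have key := eq_of_dirDeriv_eq_zero
      (f := fun t => η t + (- Real.smoothTransition (L * t - 1)) • d n)
      (x := L⁻¹) (w := L⁻¹) (fun t ht => by
        set s := L⁻¹ + t • L⁻¹ with hs
        have hs1 : L * s = 1 + t := by
          rw [hs, smul_eq_mul]
          field_simp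
        have h1 := ((hη s).add ((hasDirDeriv_of_hasDerivAt (hder s)).smul
          (hasDirDeriv_const (d n) s (1 : ℝ)))).smul_dir L⁻¹
        rw [smul_zero, add_zero, bumpCurve_eq_single d 0 (n := n) (by rw [← hL, hs1]; linarith [ht.1])
          (by rw [← hL, hs1]; linarith [ht.2]), ← add_smul, add_neg_cancel, zero_smul, smul_zero,
          smul_eq_mul, mul_one] at h1
        exact h1)
    rw [← hL2, mul_inv_cancel₀ hL0.ne', show L * (2 ^ n)⁻¹ - 1 = 1 by
      rw [hL2, mul_add, mul_inv_cancel₀ hL0.ne']; norm_num, sub_self,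
      Real.smoothTransition.zero, Real.smoothTransition.one, neg_zero, zero_smul, add_zero,
      neg_smul, one_smul, ← sub_eq_add_neg, sub_eq_iff_eq_add] at key
    rw [key]
    abel
  have hsum : ∀ N, ∑ n ∈ Finset.range N, d n = η 1 - η ((2 ^ N)⁻¹) := fun N => by
    rw [← Finset.sum_congr rfl fun n _ => hstep n,
      Finset.sum_range_sub' (fun n => η ((2 ^ n)⁻¹))]
    simp
  refine ⟨η 1 - η 0, ?_⟩
  simp only [hsum]
  refine tendsto_const_nhds.sub ((hη 0).continuousAt.tendsto.comp ?_)
  exact tendsto_inv_atTop_zero.comp (tendsto_pow_atTop_atTop_of_one_lt (by norm_num))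

end Mackey

/-! ### Averaging over a compact Lie group -/

section Average

open MeasureTheory

open scoped NNReal

variable {E : LCS.{u}}

/-- The continuous seminorms that are at most `1` on `K`. -/
def polarSeminorms (K : Set E) : Set (Seminorm ℝ E) := {q | Continuous q ∧ ∀ x ∈ K, q x ≤ 1}

/-- The vectors on which the seminorms in `polarSeminorms K` are uniformly bounded. It is the linear
span of the closed absolutely convex hull of `K`. -/
def polarSpan (K : Set E) : Submodule ℝ E where
  carrier := {x | ∃ C, ∀ q ∈ polarSeminorms K, q x ≤ C}
  add_mem' := by
    rintro x y ⟨C, hC⟩ ⟨D, hD⟩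
    exact ⟨C + D, fun q hq => (map_add_le_add q x y).trans (add_le_add (hC q hq) (hD q hq))⟩
  zero_mem' := ⟨0, fun q _ => by simp⟩
  smul_mem' := by
    rintro c x ⟨C, hC⟩
    refine ⟨‖c‖ * C, fun q hq => ?_⟩
    rw [map_smul_eq_mul]
    exact mul_le_mul_of_nonneg_left (hC q hq) (norm_nonneg c)

/-- The space `polarSpan K`, to be endowed with the norm `sup q` over `polarSeminorms K` instead of
the topology of `E`. -/
def PolarSpace (K : Set E) : Type u := polarSpan K

instance (K : Set E) : AddCommGroup (PolarSpace K) := inferInstanceAs (AddCommGroup (polarSpan K))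

instance (K : Set E) : Module ℝ (PolarSpace K) := inferInstanceAs (Module ℝ (polarSpan K))

/-- The inclusion of `PolarSpace K` into `E`. -/
def PolarSpace.val (K : Set E) : PolarSpace K →ₗ[ℝ] E := (polarSpan K).subtype

instance (K : Set E) : Norm (PolarSpace K) :=
  ⟨fun x => ⨆ q : polarSeminorms K, (q : Seminorm ℝ E) (PolarSpace.val K x)⟩

theorem PolarSpace.le_norm {K : Set E} (x : PolarSpace K) {q : Seminorm ℝ E}
    (hq : q ∈ polarSeminorms K) : q (PolarSpace.val K x) ≤ ‖x‖ := by
  obtain ⟨C, hC⟩ := x.2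
  exact le_ciSup (f := fun q : polarSeminorms K => (q : Seminorm ℝ E) (PolarSpace.val K x))
    ⟨C, by rintro _ ⟨q, rfl⟩; exact hC q q.2⟩ ⟨q, hq⟩

theorem zero_mem_polarSeminorms (K : Set E) : (0 : Seminorm ℝ E) ∈ polarSeminorms K :=
  ⟨continuous_const, fun _ _ => by simp⟩

theorem PolarSpace.norm_le {K : Set E} (x : PolarSpace K) {C : ℝ}
    (h : ∀ q ∈ polarSeminorms K, q (PolarSpace.val K x) ≤ C) : ‖x‖ ≤ C :=
  have : Nonempty (polarSeminorms K) := ⟨⟨0, zero_mem_polarSeminorms K⟩⟩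
  ciSup_le fun q => h q q.2

theorem exists_mul_mem_polarSeminorms {K : Set E} (hK : IsCompact K) {q : Seminorm ℝ E}
    (hq : Continuous q) : ∃ C : ℝ≥0, 0 < C ∧ C⁻¹ • q ∈ polarSeminorms K := by
  obtain ⟨C, hC⟩ := hK.exists_bound_of_continuousOn hq.continuousOn
  refine ⟨⟨max C 1, by positivity⟩, lt_of_lt_of_le one_pos (le_max_right C 1), ?_, fun x hx => ?_⟩
  · have : Continuous fun x => (⟨max C 1, by positivity⟩ : ℝ≥0)⁻¹ • q x := hq.const_smul _
    exact this
  · have h1 : q x ≤ max C 1 := ((le_abs_self _).trans (hC x hx)).trans (le_max_left _ _)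
    have h2 : (0 : ℝ) < max C 1 := by positivity
    change (max C 1)⁻¹ * q x ≤ 1
    rw [inv_mul_le_iff₀ h2, mul_one]
    exact h1

theorem PolarSpace.exists_le_norm {K : Set E} (hK : IsCompact K) {q : Seminorm ℝ E}
    (hq : Continuous q) : ∃ C : ℝ, 0 < C ∧ ∀ x : PolarSpace K, q (PolarSpace.val K x) ≤ C * ‖x‖ := by
  obtain ⟨C, hC, h⟩ := exists_mul_mem_polarSeminorms hK hq
  refine ⟨C, hC, fun x => ?_⟩
  have h1 : (C : ℝ)⁻¹ * q (PolarSpace.val K x) ≤ ‖x‖ := x.le_norm h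
  rwa [inv_mul_le_iff₀ (by exact_mod_cast hC)] at h1

theorem PolarSpace.core {K : Set E} (hK : IsCompact K) : NormedSpace.Core ℝ (PolarSpace K) where
  norm_nonneg x := by
    simpa using x.le_norm (zero_mem_polarSeminorms K)
  norm_smul c x := by
    have key : ∀ (c : ℝ) (x : PolarSpace K), ‖c • x‖ ≤ ‖c‖ * ‖x‖ := fun c x =>
      PolarSpace.norm_le _ fun q hq => by
        rw [map_smul, map_smul_eq_mul]
        exact mul_le_mul_of_nonneg_left (x.le_norm hq) (norm_nonneg c)
    refine le_antisymm (key c x) ?_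
    rcases eq_or_ne c 0 with rfl | hc
    · rw [norm_zero, zero_mul]
      simpa using ((0 : ℝ) • x).le_norm (zero_mem_polarSeminorms K)
    · have h1 := key c⁻¹ (c • x)
      rw [smul_smul, inv_mul_cancel₀ hc, one_smul, norm_inv] at h1
      rwa [le_inv_mul_iff₀ (norm_pos_iff.2 hc)] at h1
  norm_triangle x y := PolarSpace.norm_le _ fun q hq => by
    rw [map_add]
    exact (map_add_le_add q _ _).trans (add_le_add (x.le_norm hq) (y.le_norm hq))
  norm_eq_zero_iff x := by
    constructor
    · intro h
      refine Subtype.ext (eq_zero_of_seminorm fun q hq => ?_)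
      obtain ⟨C, -, hC⟩ := PolarSpace.exists_le_norm hK hq
      refine le_antisymm ((hC x).trans ?_) (apply_nonneg q _)
      rw [h, mul_zero]
    · rintro rfl
      refine le_antisymm (PolarSpace.norm_le _ fun q _ => by simp) ?_
      simpa using (0 : PolarSpace K).le_norm (zero_mem_polarSeminorms K)

/-- In a Mackey complete space, a map with values in a compact set that is continuous for the norm
of `PolarSpace K` has a weak integral. -/
theorem IsMackeyComplete.exists_weak_integral (hE : IsMackeyComplete E) {K : Set E}
    (hK : IsCompact K) {X : Type*} [TopologicalSpace X] [CompactSpace X] [MeasurableSpace X]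
    [BorelSpace X] (μ : Measure X) [IsFiniteMeasure μ] {f : X → E} (hfK : ∀ x, f x ∈ K)
    (hf : ∀ x₀, ∀ ε > 0, ∀ᶠ x in 𝓝 x₀, ∀ q ∈ polarSeminorms K, q (f x - f x₀) ≤ ε) :
    ∃ y : E, ∀ l : E →L[ℝ] ℝ, l y = ∫ x, l (f x) ∂μ := by
  let : NormedAddCommGroup (PolarSpace K) := NormedAddCommGroup.ofCore (PolarSpace.core hK)
  let : NormedSpace ℝ (PolarSpace K) := NormedSpace.ofCore (PolarSpace.core hK)
  have hcomplete : CompleteSpace (PolarSpace K) := by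
    refine Metric.complete_of_convergent_controlled_sequences (fun n => 1 / (n.factorial : ℝ))
      (fun n => by positivity) fun a ha => ?_
    obtain ⟨s, hs⟩ := hE.exists_tendsto_sum
      (d := fun n => PolarSpace.val K (a (n + 1)) - PolarSpace.val K (a n)) (fun q hq => by
        obtain ⟨C, hC0, hC⟩ := PolarSpace.exists_le_norm hK hq
        refine ⟨C, fun n => ?_⟩
        have h1 := ha n (n + 1) n (Nat.le_succ n) le_rfl
        rw [dist_eq_norm] at h1
        have h2 := hC (a (n + 1) - a n)
        rw [map_sub] at h2
        calc _ ≤ C * ‖a (n + 1) - a n‖ := h2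
          _ ≤ C * (1 / n.factorial) := by gcongr
          _ = C / n.factorial := by ring)
    simp only [Finset.sum_range_sub (fun n => PolarSpace.val K (a n))] at hs
    have hlim : Tendsto (fun N => PolarSpace.val K (a N)) atTop (𝓝 (s + PolarSpace.val K (a 0))) := by
      simpa using hs.add_const (PolarSpace.val K (a 0))
    set y := s + PolarSpace.val K (a 0)
    have hle : ∀ q ∈ polarSeminorms K, ∀ N : ℕ,
        q (y - PolarSpace.val K (a N)) ≤ 1 / N.factorial := fun q hq N => by
      have h1 : Tendsto (fun M => q (PolarSpace.val K (a M) - PolarSpace.val K (a N))) atTop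
          (𝓝 (q (y - PolarSpace.val K (a N)))) :=
        (hq.1.tendsto _).comp (hlim.sub_const _)
      refine le_of_tendsto h1 ?_
      filter_upwards [eventually_ge_atTop N] with M hM
      have h2 := (a M - a N).le_norm hq
      rw [map_sub] at h2
      have h3 := ha N M N hM le_rfl
      rw [dist_eq_norm] at h3
      exact h2.trans h3.le
    have hy : y ∈ polarSpan K := by
      have h1 : y - PolarSpace.val K (a 0) ∈ polarSpan K := ⟨_, fun q hq => hle q hq 0⟩
      have h2 := (polarSpan K).add_mem h1 (a 0).2
      have h3 : y - PolarSpace.val K (a 0) + PolarSpace.val K (a 0) = y := by abel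
      exact h3 ▸ h2
    let y' : PolarSpace K := (⟨y, hy⟩ : polarSpan K)
    refine ⟨y', ?_⟩
    rw [tendsto_iff_norm_sub_tendsto_zero]
    have h0 : Tendsto (fun N : ℕ => 1 / (N.factorial : ℝ)) atTop (𝓝 0) := by
      simpa using FloorSemiring.tendsto_pow_div_factorial_atTop (1 : ℝ)
    refine squeeze_zero (fun _ => norm_nonneg _) (fun N => ?_) h0
    rw [norm_sub_rev]
    exact PolarSpace.norm_le _ fun q hq => hle q hq N
  have hmem : ∀ x, f x ∈ polarSpan K := fun x => ⟨1, fun q hq => hq.2 _ (hfK x)⟩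
  let g : X → PolarSpace K := fun x => (⟨f x, hmem x⟩ : polarSpan K)
  have hg : Continuous g := continuous_iff_continuousAt.2 fun x₀ => by
    rw [ContinuousAt, tendsto_iff_norm_sub_tendsto_zero]
    refine Metric.tendsto_nhds.2 fun ε hε => ?_
    filter_upwards [hf x₀ (ε / 2) (half_pos hε)] with x hx
    rw [Real.dist_eq, sub_zero, abs_of_nonneg (norm_nonneg _)]
    exact lt_of_le_of_lt (PolarSpace.norm_le _ fun q hq => hx q hq) (half_lt_self hε)
  have hgi : Integrable g μ := hg.integrable_of_hasCompactSupport (HasCompactSupport.of_compactSpace _)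
  refine ⟨PolarSpace.val K (∫ x, g x ∂μ), fun l => ?_⟩
  let q : Seminorm ℝ E := (normSeminorm ℝ ℝ).comp (l : E →ₗ[ℝ] ℝ)
  have hq : Continuous q := l.continuous.norm
  obtain ⟨C, -, hC⟩ := PolarSpace.exists_le_norm hK hq
  let L : PolarSpace K →L[ℝ] ℝ :=
    LinearMap.mkContinuous ((l : E →ₗ[ℝ] ℝ).comp (PolarSpace.val K)) C hC
  exact (L.integral_comp_comm hgi).symm

variable {H : Type u} [Group H] [TopologicalSpace H] [LCAtlas H]

/-- For a vector `w` with smooth orbit map, `h ↦ ρ h w` is continuous with respect to the seminorms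
that are at most one on a suitable compact set. This is a Lipschitz estimate: near `h₀`, the orbit
map is a translate of the orbit map near `1`. -/
theorem exists_compact_orbit_estimate [IsLCLieGroup H] [CompactSpace H] (ρ : Representation ℝ H E)
    (hρ : Continuous fun p : H × E => ρ p.1 p.2) {w : E} (hs : Smooth fun h : H => ρ h w) :
    ∃ K : Set E, IsCompact K ∧ (∀ h, ρ h w ∈ K) ∧
      ∀ h₀, ∀ ε > 0, ∀ᶠ h in 𝓝 h₀, ∀ q ∈ polarSeminorms K, q (ρ h w - ρ h₀ w) ≤ ε := by
  have : T2Space H := IsLCManifold.t2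
  set φ := chartAt (1 : H) with hφ
  have h1 : (1 : H) ∈ φ.hom.source := mem_chartAt_source 1
  have hφs : IsSmoothChart φ := isSmoothChart_chartAt 1
  obtain ⟨C, hCn, hCs, hCc⟩ := local_compact_nhds (φ.hom.open_source.mem_nhds h1)
  set F : φ.model → E := fun x => ρ (φ.hom.symm x) w with hF
  have hrep : BContDiffOn 1 φ.hom.target F := by
    have := hs.rep_one isOpen_univ hφs E.isSmoothChart_chart
    exact this.mono 1 fun x hx => ⟨hx, trivial, trivial⟩
  set v₀ := φ.hom 1 with hv₀
  set N₀ : Set φ.model := (fun x => x - v₀) '' (φ.hom '' C) with hN₀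
  have hCφ : IsCompact (φ.hom '' C) := hCc.image_of_continuousOn (φ.hom.continuousOn.mono hCs)
  have hN₀c : IsCompact N₀ := hCφ.image (continuous_id.sub continuous_const)
  have hN₀t : ∀ v ∈ N₀, v₀ + v ∈ φ.hom '' C := by
    rintro _ ⟨x, hx, rfl⟩
    simpa using hx
  have hCt : φ.hom '' C ⊆ φ.hom.target := by
    rintro _ ⟨x, hx, rfl⟩
    exact φ.hom.map_source (hCs hx)
  have hN₀n : N₀ ∈ 𝓝 (0 : φ.model) := by
    have h2 : φ.hom '' C ∈ 𝓝 v₀ := φ.hom.image_mem_nhds h1 hCn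
    have h3 : Tendsto (fun v => v₀ + v) (𝓝 (0 : φ.model)) (𝓝 v₀) := by
      have : Continuous fun v : φ.model => v₀ + v := by fun_prop
      simpa using this.tendsto 0
    filter_upwards [h3 h2] with v hv
    exact ⟨v₀ + v, hv, by simp⟩
  obtain ⟨N, ⟨hNn, hNb⟩, hNN₀⟩ := (nhds_basis_balanced ℝ φ.model).mem_iff.1 hN₀n
  set K₀ : Set E := (fun p : φ.model × φ.model => dirDeriv F p.1 p.2) '' ((φ.hom '' C) ×ˢ N₀)
  have hK₀ : IsCompact K₀ := (hCφ.prod hN₀c).image_of_continuousOn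
    ((show ContinuousOn _ _ from hrep.2.2).mono (prod_mono hCt (subset_univ _)))
  set K : Set E := (fun p : H × E => ρ p.1 p.2) '' (univ ×ˢ K₀) ∪ range fun h : H => ρ h w
  have hK : IsCompact K := ((isCompact_univ.prod hK₀).image hρ).union
    (isCompact_range (hρ.comp (Continuous.prodMk_left w)))
  refine ⟨K, hK, fun h => Or.inr ⟨h, rfl⟩, fun h₀ ε hε => ?_⟩
  -- the estimate on the neighbourhood `h₀ φ⁻¹(v₀ + ε N)` of `h₀`
  have hcont : ∀ h, Continuous fun e => ρ h e := fun h => hρ.comp (Continuous.prodMk_right h)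
  have hN' : ∀ᶠ v in 𝓝 (0 : φ.model), ∃ t ∈ Icc (0 : ℝ) ε, ∃ b ∈ N, v = t • b ∧ t ≤ 1 := by
    set t := min ε 1 with ht
    have ht0 : 0 < t := lt_min hε one_pos
    have h4 : Tendsto (fun v : φ.model => t⁻¹ • v) (𝓝 0) (𝓝 0) := by
      have : Continuous fun v : φ.model => t⁻¹ • v := by fun_prop
      simpa using this.tendsto 0
    filter_upwards [h4 hNn] with v hv
    exact ⟨t, ⟨ht0.le, min_le_left _ _⟩, _, hv, by rw [smul_smul, mul_inv_cancel₀ ht0.ne', one_smul],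
      min_le_right _ _⟩
  have h5 : Tendsto (fun h => φ.hom (h₀⁻¹ * h) - v₀) (𝓝 h₀) (𝓝 0) := by
    have hmul : Continuous fun h => h₀⁻¹ * h :=
      (IsLCLieGroup.smooth_mul (G := H)).continuous.comp (Continuous.prodMk_right h₀⁻¹)
    have h6 : Tendsto (fun h => h₀⁻¹ * h) (𝓝 h₀) (𝓝 1) := by simpa using hmul.tendsto h₀
    have h7 := ((φ.hom.continuousAt h1).tendsto.comp h6).sub_const v₀
    rwa [sub_self] at h7
  have h8 : ∀ᶠ h in 𝓝 h₀, h₀⁻¹ * h ∈ φ.hom.source := by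
    have hmul : Continuous fun h => h₀⁻¹ * h :=
      (IsLCLieGroup.smooth_mul (G := H)).continuous.comp (Continuous.prodMk_right h₀⁻¹)
    exact hmul.continuousAt.eventually (φ.hom.open_source.mem_nhds (by
      simpa using h1))
  filter_upwards [h5.eventually hN', h8] with h ⟨t, ht, b, hb, hv, ht1⟩ hsrc q hq
  have hseg : ∀ s ∈ Icc (0 : ℝ) 1, v₀ + s • (t • b) ∈ φ.hom '' C := fun s hs => by
    refine hN₀t _ (hNN₀ ?_)
    rw [smul_smul]
    refine hNb.smul_mem ?_ hb
    rw [Real.norm_eq_abs, abs_of_nonneg (mul_nonneg hs.1 ht.1)]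
    exact mul_le_one₀ hs.2 ht.1 ht1
  let R : E →L[ℝ] E := ⟨ρ h₀, hcont h₀⟩
  have key := seminorm_sub_le q hq.1 (g := fun s : ℝ => R (F (v₀ + s • (t • b))))
    (g' := fun s => R (t • dirDeriv F (v₀ + s • (t • b)) b)) (C := ε)
    (fun s hs => by
      have h9 := (hasDirDeriv_dirDeriv (hrep.2.1 _ (hCt (hseg s hs)) b)).smul_dir t
      exact h9.line.clm_comp R)
    (fun s hs => by
      rw [map_smul, map_smul_eq_mul, Real.norm_eq_abs, abs_of_nonneg ht.1]
      have h10 : q (R (dirDeriv F (v₀ + s • (t • b)) b)) ≤ 1 := hq.2 _ (Or.inl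
        ⟨(h₀, dirDeriv F (v₀ + s • (t • b)) b), ⟨trivial, (_, b), ⟨hseg s hs, hNN₀ hb⟩, rfl⟩, rfl⟩)
      calc t * q (R (dirDeriv F (v₀ + s • (t • b)) b)) ≤ t * 1 := by
            gcongr
            exact ht.1
        _ ≤ ε := by rw [mul_one]; exact ht.2)
  have e0 : R (F (v₀ + (0 : ℝ) • (t • b))) = ρ h₀ w := by
    rw [zero_smul, add_zero, hF]
    simp only [hv₀, φ.hom.left_inv h1, map_one, Module.End.one_apply]
    rfl
  have e1 : R (F (v₀ + (1 : ℝ) • (t • b))) = ρ h w := by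
    rw [one_smul, ← hv, hF]
    have : v₀ + (φ.hom (h₀⁻¹ * h) - v₀) = φ.hom (h₀⁻¹ * h) := by abel
    simp only [this, φ.hom.left_inv hsrc]
    change (ρ h₀ * ρ (h₀⁻¹ * h)) w = ρ h w
    rw [← map_mul, mul_inv_cancel_left]
  rw [e0, e1] at key
  exact key

/-- Averaging over a compact Lie group acting on a Mackey complete space. -/
theorem IsMackeyComplete.exists_average [IsLCLieGroup H] [CompactSpace H] (hE : IsMackeyComplete E)
    (ρ : Representation ℝ H E) (hρ : Continuous fun p : H × E => ρ p.1 p.2) {w : E}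
    (hs : Smooth fun h : H => ρ h w) :
    ∃ y : E, (∀ k, ρ k y = y) ∧ ∀ l : E →L[ℝ] ℝ, (∀ h, l (ρ h w) = l w) → l y = l w := by
  have : T2Space H := IsLCManifold.t2
  have : IsTopologicalGroup H :=
    { continuous_mul := (IsLCLieGroup.smooth_mul (G := H)).continuous
      continuous_inv := (IsLCLieGroup.smooth_inv (G := H)).continuous }
  let : MeasurableSpace H := borel H
  have : BorelSpace H := ⟨rfl⟩
  obtain ⟨K, hK, hwK, hest⟩ := exists_compact_orbit_estimate ρ hρ hs
  let μ : Measure H := Measure.haarMeasure ⊤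
  have hμ : μ univ = 1 := Measure.haarMeasure_self (K₀ := (⊤ : TopologicalSpace.PositiveCompacts H))
  have : IsProbabilityMeasure μ := ⟨hμ⟩
  obtain ⟨y, hy⟩ := hE.exists_weak_integral hK μ hwK hest
  have hcont : ∀ h, Continuous fun e => ρ h e := fun h => hρ.comp (Continuous.prodMk_right h)
  refine ⟨y, fun k => ?_, fun l hl => ?_⟩
  · refine sub_eq_zero.1 (eq_zero_of_seminorm fun q hq => ?_)
    obtain ⟨l, hl, -⟩ := exists_dual_seminorm q hq (ρ k y - y)
    rw [← hl, map_sub, sub_eq_zero]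
    let R : E →L[ℝ] E := ⟨ρ k, hcont k⟩
    have h1 : l (ρ k y) = ∫ h, l (ρ k (ρ h w)) ∂μ := hy (l.comp R)
    rw [h1, hy l, ← integral_mul_left_eq_self (fun h => l (ρ h w)) k]
    simp [map_mul]
  · rw [hy l]
    simp [hl]

end Average

/-! ### Compact Lie groups are co-Hopfian -/

section CoHopf

/-- A compact space that is covered by preconnected neighbourhoods has only finitely many clopen
subsets, so that an open, continuous and injective self-map is surjective. -/
theorem surjective_of_isOpenMap_injective {X : Type*} [TopologicalSpace X] [CompactSpace X]
    [T2Space X] (hX : ∀ x : X, ∃ V ∈ 𝓝 x, IsPreconnected V) {σ : X → X} (hσ : Continuous σ)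
    (ho : IsOpenMap σ) (hi : Function.Injective σ) : Function.Surjective σ := by
  choose V hV hVc using hX
  obtain ⟨F, hF⟩ := isCompact_univ.elim_nhds_subcover V fun x _ => hV x
  have hdet : ∀ K : Set X, IsClopen K → ∀ x, ∀ y ∈ V x, y ∈ K ↔ x ∈ K := fun K hK x y hy =>
    ⟨fun h => (hVc x).subset_isClopen hK ⟨y, hy, h⟩ (mem_of_mem_nhds (hV x)),
      fun h => (hVc x).subset_isClopen hK ⟨x, mem_of_mem_nhds (hV x), h⟩ hy⟩
  let K : ℕ → Set X := fun n => range σ^[n]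
  have hK : ∀ n, IsClopen (K n) := fun n => by
    refine ⟨(isCompact_range (hσ.iterate n)).isClosed, ?_⟩
    have h1 : IsOpenMap σ^[n] := by
      induction n with
      | zero => exact IsOpenMap.id
      | succ n ih => exact ih.comp ho
    exact h1.isOpen_range
  let T : ℕ → Set F := fun n => {x | (x : X) ∈ K n}
  have hanti : ∀ n, K (n + 1) ⊆ K n := fun n => by
    rintro _ ⟨x, rfl⟩
    exact ⟨σ x, (Function.iterate_succ_apply σ n x).symm⟩
  have hanti' : Antitone K := antitone_nat_of_succ_le hanti
  obtain ⟨n, m, hnm, hT⟩ := Finite.exists_ne_map_eq_of_infinite T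
  have key : ∀ n m, n < m → T n = T m → Function.Surjective σ := fun n m hlt hT x => by
    have h1 : σ^[n] x ∈ K m := by
      obtain ⟨y, hy, hxy⟩ := mem_iUnion₂.1 (hF.2 (mem_univ (σ^[n] x)))
      rw [hdet _ (hK m) y _ hxy]
      have h2 : y ∈ K n := (hdet _ (hK n) y _ hxy).1 ⟨x, rfl⟩
      have h3 : (⟨y, hy⟩ : F) ∈ T n := h2
      rw [hT] at h3
      exact h3
    obtain ⟨z, hz⟩ := hanti' (Nat.succ_le_of_lt hlt) h1
    rw [Nat.succ_eq_add_one, Function.iterate_succ_apply] at hz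
    refine ⟨z, (hi.iterate n) ?_⟩
    rw [← hz]
  rcases lt_or_gt_of_ne hnm with h | h
  · exact key n m h hT
  · exact key m n h hT.symm

theorem exists_isPreconnected_nhds {M : Type u} [TopologicalSpace M] [LCAtlas M] [IsLCManifold M]
    (m : M) : ∃ V ∈ 𝓝 m, IsPreconnected V := by
  obtain ⟨φ, -, hm⟩ := IsLCManifold.cover m
  obtain ⟨C, ⟨hC, hCc⟩, hCt⟩ := (LocallyConvexSpace.convex_basis (𝕜 := ℝ) (φ.hom m)).mem_iff.1
    (φ.hom.open_target.mem_nhds (φ.hom.map_source hm))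
  have h1 : φ.hom.symm '' C ∈ 𝓝 (φ.hom.symm (φ.hom m)) :=
    φ.hom.symm.image_mem_nhds (φ.hom.map_source hm) hC
  rw [φ.hom.left_inv hm] at h1
  exact ⟨φ.hom.symm '' C, h1, hCc.isPreconnected.image _ (φ.hom.continuousOn_symm.mono hCt)⟩

theorem hasDirDeriv_zero_dir {E : Type u} [AddCommGroup E] [Module ℝ E] {F : Type v}
    [AddCommGroup F] [Module ℝ F] [TopologicalSpace F] (f : E → F) (x : E) :
    HasDirDeriv f x 0 0 := by
  simp only [HasDirDeriv, smul_zero, add_zero, sub_self]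
  exact tendsto_const_nhds

variable {M N : Type u} [TopologicalSpace M] [LCAtlas M] [TopologicalSpace N] [LCAtlas N]

theorem chartDeriv_zero {φ : LCChart M} {ψ : LCChart N} (f : M → N) (x : M) :
    chartDeriv φ ψ f x 0 = 0 := (hasDirDeriv_zero_dir _ _).dirDeriv_eq

/-- A map with zero derivative is locally constant. -/
theorem SmoothOn.eventually_eq_of_chartDeriv_eq_zero [IsLCManifold M] [IsLCManifold N] {f : M → N}
    {O : Set M} (hf : SmoothOn f O) (hO : IsOpen O) {φ : LCChart M} {ψ : LCChart N}
    (hφ : IsSmoothChart φ) (hψ : IsSmoothChart ψ) (hOφ : O ⊆ φ.hom.source)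
    (hfO : MapsTo f O ψ.hom.source) (h : ∀ x ∈ O, ∀ w, chartDeriv φ ψ f x w = 0) {x : M}
    (hx : x ∈ O) : ∀ᶠ y in 𝓝 x, f y = f x := by
  have hsub : O ⊆ O ∩ f ⁻¹' ψ.hom.source := fun y hy => ⟨hy, hfO hy⟩
  have hrep : BContDiffOn 1 (φ.img O) (chartRep φ ψ f) :=
    (hf.rep_one hO hφ hψ).mono 1 (φ.img_mono hsub)
  obtain ⟨C, ⟨hC, hCc⟩, hCO⟩ := (LocallyConvexSpace.convex_basis (𝕜 := ℝ) (φ.hom x)).mem_iff.1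
    ((φ.isOpen_img hO).mem_nhds (φ.apply_mem_img (hOφ hx) hx))
  have hCO : C ⊆ φ.img O := hCO
  have h1 : φ.hom ⁻¹' C ∈ 𝓝 x := (φ.hom.continuousAt (hOφ hx)).preimage_mem_nhds hC
  filter_upwards [h1, hO.mem_nhds hx] with y hy hyO
  have hseg : ∀ t ∈ Icc (0 : ℝ) 1, φ.hom x + t • (φ.hom y - φ.hom x) ∈ C := fun t ht =>
    hCc.add_smul_sub_mem (mem_of_mem_nhds hC) hy ht
  have key := eq_of_dirDeriv_eq_zero (f := chartRep φ ψ f) (x := φ.hom x)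
    (w := φ.hom y - φ.hom x) fun t ht => by
      have hm := hCO (hseg t ht)
      have h2 := hasDirDeriv_dirDeriv (hrep.2.1 _ hm (φ.hom y - φ.hom x))
      have h3 := h _ hm.2 (φ.hom y - φ.hom x)
      rw [chartDeriv, φ.hom.right_inv hm.1] at h3
      rwa [h3] at h2
  rw [add_sub_cancel] at key
  simp only [chartRep, φ.hom.left_inv (hOφ hx), φ.hom.left_inv (hOφ hyO)] at key
  exact ψ.hom.injOn (hfO hyO) (hfO hx) key

variable {H : Type u} [Group H] [TopologicalSpace H] [LCAtlas H]

theorem finiteDimensional_lieAlg [IsLCManifold H] [CompactSpace H] :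
    FiniteDimensional ℝ (lieAlg H) := by
  have : T2Space H := IsLCManifold.t2
  have h1 : (1 : H) ∈ (chartAt (1 : H)).hom.source := mem_chartAt_source 1
  obtain ⟨C, hCn, hCs, hCc⟩ := local_compact_nhds
    ((chartAt (1 : H)).hom.open_source.mem_nhds h1)
  have hcp : IsCompact ((chartAt (1 : H)).hom '' C) :=
    hCc.image_of_continuousOn ((chartAt (1 : H)).hom.continuousOn.mono hCs)
  have hn : (chartAt (1 : H)).hom '' C ∈ 𝓝 ((chartAt (1 : H)).hom 1) :=
    (chartAt (1 : H)).hom.image_mem_nhds h1 hCn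
  have : LocallyCompactSpace (chartAt (1 : H)).model :=
    hcp.locallyCompactSpace_of_mem_nhds_of_addGroup hn
  exact FiniteDimensional.of_locallyCompactSpace ℝ (E := (chartAt (1 : H)).model)

/-- If the image of an immersive endomorphism `σ` of a compact Lie group fixes the point `p`, then a
neighbourhood of `1` fixes `p`: the derivative of the orbit map vanishes at `1`, because the
derivative of `σ` is onto, and hence it vanishes everywhere. -/
theorem eventually_smul_eq_of_immersion [IsLCLieGroup H] [CompactSpace H] [IsLCManifold M]
    [MulAction H M] {σ : H →* H} (hσ : Smooth σ) (hinj : Function.Injective (tmap σ 1 1)) {p : M}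
    (hp : ∀ h, σ h • p = p) (hM : ∀ h : H, Smooth fun x : M => h • x)
    (ho : Smooth fun h : H => h • p) : ∀ᶠ h : H in 𝓝 1, h • p = p := by
  set φ := chartAt (1 : H)
  set ψ := chartAt p
  have h1 : (1 : H) ∈ φ.hom.source := mem_chartAt_source 1
  have hφ : IsSmoothChart φ := isSmoothChart_chartAt _
  have hψ : IsSmoothChart ψ := isSmoothChart_chartAt _
  have hpψ : p ∈ ψ.hom.source := mem_chartAt_source p
  have hone : σ 1 = 1 := map_one σ
  have hone' : (1 : H) • p = p := one_smul H p
  have hd : ∀ w, chartDeriv φ ψ (fun h : H => h • p) 1 w = 0 := by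
    have : FiniteDimensional ℝ φ.model := finiteDimensional_lieAlg (H := H)
    have h2 : σ 1 ∈ φ.hom.source := by rw [hone]; exact h1
    let L : φ.model →L[ℝ] φ.model :=
      SmoothOn.chartDerivL hσ isOpen_univ (mem_univ (1 : H)) hφ hφ h1 h2
    have hL : Function.Injective (L : φ.model →ₗ[ℝ] φ.model) := hinj
    intro w
    obtain ⟨v, rfl⟩ := (LinearMap.injective_iff_surjective (V := φ.model)).1 hL w
    have h3 := chartDeriv_comp (f := σ) (g := fun h : H => h • p) ho hσ isOpen_univ isOpen_univ
      (mem_univ 1) (mem_univ _) hφ hφ hψ h1 h2 (by rw [hp]; exact hpψ) v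
    rw [hone] at h3
    refine h3.symm.trans ?_
    simp only [hp]
    exact dirDeriv_const (ψ.hom p) _ _
  have hO : IsOpen (φ.hom.source ∩ (fun h : H => h • p) ⁻¹' ψ.hom.source) :=
    φ.hom.open_source.inter (ψ.hom.open_source.preimage ho.continuous)
  have h1O : (1 : H) ∈ φ.hom.source ∩ (fun h : H => h • p) ⁻¹' ψ.hom.source :=
    ⟨h1, by rw [mem_preimage, hone']; exact hpψ⟩
  have key := SmoothOn.eventually_eq_of_chartDeriv_eq_zero (ho.smoothOn _) hO hφ hψ
    inter_subset_left (fun h hh => hh.2) (fun h hh w => by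
      have e : (fun x : H => x • p) = fun x => h • ((h⁻¹ * x) • p) := by
        funext x
        rw [smul_smul, mul_inv_cancel_left]
      have hl : Smooth fun x : H => h⁻¹ * x :=
        (IsLCLieGroup.smooth_mul (G := H)).comp ((smooth_const h⁻¹).prodMk smooth_id)
      have e1 : h⁻¹ * h = 1 := inv_mul_cancel h
      have h4 := chartDeriv_comp (f := fun x : H => h⁻¹ * x) (g := fun x : H => x • p) ho hl
        isOpen_univ isOpen_univ (mem_univ h) (mem_univ _) hφ hφ hψ hh.1 (by rw [e1]; exact h1)
        (by rw [e1, hone']; exact hpψ) w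
      have h5 := chartDeriv_comp (f := fun x : H => (h⁻¹ * x) • p) (g := fun y : M => h • y) (hM h)
        (ho.comp hl) isOpen_univ isOpen_univ (mem_univ h) (mem_univ _) hφ hψ hψ hh.1
        (by rw [e1, hone']; exact hpψ) (by rw [e1, hone']; exact hh.2) w
      rw [e, h5, h4]
      simp only [e1]
      rw [hd, chartDeriv_zero]) h1O
  simpa using key

/-- An immersive injective endomorphism `σ` of a compact Lie group is surjective if its image is the
stabilizer of a point. -/
theorem surjective_of_stabilizer_eq_range [IsLCLieGroup H] [CompactSpace H] [IsLCManifold M]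
    [MulAction H M] {σ : H →* H} (hσ : Smooth σ) (hi : Function.Injective σ)
    (hinj : Function.Injective (tmap σ 1 1)) {p : M}
    (hp : ∀ h, h • p = p ↔ h ∈ σ.range) (hM : ∀ h : H, Smooth fun x : M => h • x)
    (ho : Smooth fun h : H => h • p) : Function.Surjective σ := by
  have : T2Space H := IsLCManifold.t2
  have : IsTopologicalGroup H :=
    { continuous_mul := (IsLCLieGroup.smooth_mul (G := H)).continuous
      continuous_inv := (IsLCLieGroup.smooth_inv (G := H)).continuous }
  have hev := eventually_smul_eq_of_immersion hσ hinj (p := p)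
    (fun h => (hp _).2 ⟨h, rfl⟩) hM ho
  have hrange : IsOpen (σ.range : Set H) := by
    refine Subgroup.isOpen_of_mem_nhds _ (g := 1) ?_
    filter_upwards [hev] with h hh
    exact (hp h).1 hh
  have hemb : IsOpenEmbedding σ :=
    ⟨(hσ.continuous.isClosedEmbedding hi).isEmbedding, by simpa using hrange⟩
  exact surjective_of_isOpenMap_injective exists_isPreconnected_nhds hσ.continuous hemb.isOpenMap hi

variable {G : Type u} [Group G] [TopologicalSpace G] [LCAtlas G] [IsLCLieGroup G] [IsLCManifold M]
  [MulAction G M]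

theorem smooth_conj (a : G) : Smooth fun g : G => a * g * a⁻¹ :=
  (IsLCLieGroup.smooth_mul (G := G)).comp
    (((IsLCLieGroup.smooth_mul (G := G)).comp ((smooth_const a).prodMk smooth_id)).prodMk
      (smooth_const a⁻¹))

/-- A compact stabilizer is not conjugate to a proper subgroup of itself. -/
theorem conj_mem_of_conj_le (hact : Smooth fun p : G × M => p.1 • p.2) {Γ : Subgroup G}
    (hΓ : IsSubmanifold (Γ : Set G)) {m : M}
    (hH : IsSubmanifold (MulAction.stabilizer Γ m : Set Γ))
    [IsLCLieGroup (MulAction.stabilizer Γ m)] [CompactSpace (MulAction.stabilizer Γ m)] {a : Γ}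
    (ha : ∀ h ∈ MulAction.stabilizer Γ m, a * h * a⁻¹ ∈ MulAction.stabilizer Γ m)
    {h : Γ} (hh : h ∈ MulAction.stabilizer Γ m) : a⁻¹ * h * a ∈ MulAction.stabilizer Γ m := by
  have hΓm : IsLCManifold Γ := hΓ.isLCManifold_subgroup
  let H := MulAction.stabilizer Γ m
  let σ : H →* H :=
    { toFun := fun h => ⟨a * h * a⁻¹, ha h h.2⟩
      map_one' := Subtype.ext (by simp)
      map_mul' := fun h k => Subtype.ext (by simp [mul_assoc]) }
  have hΓc : Smooth fun g : Γ => (g : G) := hΓ.smooth_coe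
  have hHc : Smooth fun h : H => (h : Γ) := hH.smooth_coe
  have hc : Smooth fun h : H => ((h : Γ) : G) := hΓc.comp hHc
  have hσ1 : Smooth fun h : H => ((σ h : Γ) : G) := (smooth_conj (a : G)).comp hc
  have hσ : Smooth σ := hH.smooth_of_coe (hΓ.smooth_of_coe hσ1)
  have hσi : Function.Injective σ := fun h k hhk => Subtype.ext (by
    simpa [σ] using congrArg Subtype.val hhk)
  have hti : Function.Injective (tmap (fun h : H => ((h : Γ) : G)) 1 1) := by
    have h1 : Function.Injective (tmap (fun h : H => (h : Γ)) 1 1) := hH.tmap_coe_injective 1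
    have h2 : Function.Injective (tmap (fun h : Γ => (h : G)) 1 1) := hΓ.tmap_coe_injective 1
    intro v w hvw
    have h3 : ∀ w, tmap (fun h : H => ((h : Γ) : G)) 1 1 w =
        tmap (fun h : Γ => (h : G)) 1 1 (tmap (fun h : H => (h : Γ)) 1 1 w) := fun w =>
      tmap_comp (f := fun h : H => (h : Γ)) (g := fun h : Γ => (h : G)) hΓc hHc isOpen_univ
        isOpen_univ (mem_univ 1) (mem_univ _) w
    rw [h3, h3] at hvw
    exact h1 (h2 hvw)
  have htσ : Function.Injective (tmap σ 1 1) := by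
    intro v w hvw
    have e1 : (a : G) * 1 * (a : G)⁻¹ = 1 := by simp
    have eσ : σ 1 = 1 := map_one σ
    have h3 : ∀ w, tmap (fun h : H => (a : G) * ((h : Γ) : G) * (a : G)⁻¹) 1 1 w =
        tmap (fun h : H => ((h : Γ) : G)) 1 1 (tmap σ 1 1 w) := fun w => by
      have := tmap_comp (f := σ) (g := fun h : H => ((h : Γ) : G)) hc hσ isOpen_univ
        isOpen_univ (mem_univ 1) (mem_univ _) w
      rw [eσ] at this
      exact this
    have h4 : ∀ w, tmap (fun h : H => (a : G) * ((h : Γ) : G) * (a : G)⁻¹) 1 1 w =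
        tmap (fun g : G => (a : G) * g * (a : G)⁻¹) 1 1
          (tmap (fun h : H => ((h : Γ) : G)) 1 1 w) := fun w => by
      have := tmap_comp (f := fun h : H => ((h : Γ) : G))
        (g := fun g : G => (a : G) * g * (a : G)⁻¹) (smooth_conj (a : G)) hc isOpen_univ
        isOpen_univ (mem_univ 1) (mem_univ _) w
      have e2 : (a : G) * (((1 : H) : Γ) : G) * (a : G)⁻¹ = 1 := e1
      rw [e2] at this
      exact this
    have hinj : Function.Injective (tmap (fun g : G => (a : G) * g * (a : G)⁻¹) 1 1) := by
      refine Function.LeftInverse.injective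
        (g := tmap (fun g : G => (a : G)⁻¹ * g * (a : G)⁻¹⁻¹) 1 1) fun w => ?_
      have := tmap_comp (f := fun g : G => (a : G) * g * (a : G)⁻¹)
        (g := fun g : G => (a : G)⁻¹ * g * (a : G)⁻¹⁻¹) (smooth_conj (a : G)⁻¹)
        (smooth_conj (a : G)) isOpen_univ isOpen_univ (mem_univ 1) (mem_univ _) w
      have e3 : (a : G)⁻¹ * 1 * (a : G)⁻¹⁻¹ = 1 := by simp
      rw [e1, e3] at this
      refine this.symm.trans ?_
      have e4 : (fun g : G => (a : G)⁻¹ * ((a : G) * g * (a : G)⁻¹) * (a : G)⁻¹⁻¹) = fun g => g := by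
        funext g
        group
      rw [e4]
      exact chartDeriv_id (mem_chartAt_source (1 : G)) w
    refine hti (hinj ?_)
    rw [← h4, ← h4, h3, h3, hvw]
  have hM : ∀ g : G, Smooth fun x : M => g • x := fun g =>
    hact.comp ((smooth_const g).prodMk smooth_id)
  have hsurj := surjective_of_stabilizer_eq_range (M := M) (p := a • m) hσ hσi htσ (fun k => by
      constructor
      · intro hk
        have hk' : (k : Γ) • (a • m) = a • m := hk
        refine ⟨⟨a⁻¹ * k * a, ?_⟩, Subtype.ext ?_⟩
        · rw [MulAction.mem_stabilizer_iff, mul_smul, mul_smul, hk', inv_smul_smul]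
        · change a * (a⁻¹ * k * a) * a⁻¹ = k
          group
      · rintro ⟨k', rfl⟩
        change (a * (k' : Γ) * a⁻¹) • (a • m) = a • m
        rw [smul_smul, inv_mul_cancel_right, mul_smul, (MulAction.mem_stabilizer_iff.1 k'.2)])
    (fun k => hM ((k : Γ) : G))
    (hact.comp (hc.prodMk (smooth_const (a • m))))
  obtain ⟨k, hk⟩ := hsurj ⟨h, hh⟩
  have hk' : a * (k : Γ) * a⁻¹ = h := congrArg Subtype.val hk
  rw [← hk']
  have : a⁻¹ * (a * (k : Γ) * a⁻¹) * a = k := by group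
  rw [this]
  exact k.2

end CoHopf

/-! ### Tubes around orbits -/

section Tubes

theorem IsSmoothChart.smoothOn_symm {M : Type u} [TopologicalSpace M] [LCAtlas M] [IsLCManifold M]
    {φ : LCChart M} (hφ : IsSmoothChart φ) : SmoothOn φ.hom.symm φ.hom.target := by
  refine SmoothOn.of_charts fun x hx => ⟨φ.model.chart, φ, φ.hom.target,
    φ.model.isSmoothChart_chart, hφ, φ.hom.open_target, hx, fun _ _ => trivial,
    fun y hy => φ.hom.map_target hy, ?_⟩
  rw [LCS.img_chart]
  exact BSmoothOn.congr (bSmoothOn_id _) φ.hom.open_target fun y hy => (φ.hom.right_inv hy).symm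

theorem IsSmoothChart.smoothOn_hom {M : Type u} [TopologicalSpace M] [LCAtlas M] [IsLCManifold M]
    {φ : LCChart M} (hφ : IsSmoothChart φ) : SmoothOn φ.hom φ.hom.source := by
  refine SmoothOn.of_charts fun x hx => ⟨φ, φ.model.chart, φ.hom.source, hφ,
    φ.model.isSmoothChart_chart, φ.hom.open_source, hx, Subset.rfl, fun _ _ => trivial, ?_⟩
  exact BSmoothOn.congr (bSmoothOn_id _) (φ.isOpen_img φ.hom.open_source)
    fun y hy => (φ.hom.right_inv hy.1).symm

variable {Γ M : Type u} [Group Γ] [TopologicalSpace Γ] [LCAtlas Γ] [IsLCManifold Γ]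
  [TopologicalSpace M] [LCAtlas M] [IsLCManifold M] [MulAction Γ M]

/-- A slice at `m`, parametrised by `ι`, gives a chart of `M` around `m` whose inverse has the form
`(a, x) ↦ χ a • ι x`. -/
theorem IsSlice.exists_chart {m : M} {S : Set M} (hS : IsSlice Γ m S) {K C : LCS.{u}}
    {act : MulAction.stabilizer Γ m → K × C → K × C} {U : Set (K × C)} {ι : K × C → S}
    (hι : IsSliceDiffeo m S act U ι) :
    ∃ (A : LCS.{u}) (D : Set A) (χ : A → Γ) (φ : OpenPartialHomeomorph M (A.prod (K.prod C)))
      (a₀ : A), IsOpen D ∧ SmoothOn χ D ∧ IsSmoothChart ⟨A.prod (K.prod C), φ⟩ ∧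
      (∀ p : A × (K × C), (show A.prod (K.prod C) from p) ∈ φ.target ↔ p.1 ∈ D ∧ p.2 ∈ U) ∧
      (∀ p : A × (K × C), φ.symm (show A.prod (K.prod C) from p) = χ p.1 • (ι p.2 : M)) ∧
      a₀ ∈ D ∧ χ a₀ • m = m := by
  obtain ⟨_, hP, W, χ, hW, hW1, hχ, hχW, hF, hmF⟩ := hS.section_tube
  have : IsLCManifold (Γ ⧸ MulAction.stabilizer Γ m) := hP.1
  have : IsLCManifold S := hS.submanifold.isLCManifold
  let α : LCChart (Γ ⧸ MulAction.stabilizer Γ m) := chartAt ((1 : Γ) : Γ ⧸ MulAction.stabilizer Γ m)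
  have hα : IsSmoothChart α := isSmoothChart_chartAt _
  have h1α : ((1 : Γ) : Γ ⧸ MulAction.stabilizer Γ m) ∈ α.hom.source := mem_chartAt_source _
  let β : LCChart S := hι.diffeo.chart (K.chart.prod C.chart)
  have hβ : IsSmoothChart β :=
    hι.diffeo.isSmoothChart (K.isSmoothChart_chart.prod C.isSmoothChart_chart)
  let φ : LCChart M := hF.chart (α.prod β)
  refine ⟨α.model, α.img W, fun a => χ (α.hom.symm a), φ.hom, α.hom _, α.isOpen_img hW, ?_,
    hF.isSmoothChart (hα.prod hβ), fun p => ?_, fun p => rfl, α.apply_mem_img h1α hW1, ?_⟩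
  · exact hχ.comp (SmoothOn.mono hα.smoothOn_symm fun x hx => hx.1) (α.isOpen_img hW) hW
      fun x hx => hx.2
  · constructor
    · rintro ⟨⟨h1, -, h2⟩, h3, -⟩
      exact ⟨⟨h1, h3⟩, h2⟩
    · rintro ⟨⟨h1, h3⟩, h2⟩
      exact ⟨⟨h1, ⟨trivial, trivial⟩, h2⟩, h3, trivial⟩
  · simp only [α.hom.left_inv h1α]
    have : χ ((1 : Γ) : Γ ⧸ MulAction.stabilizer Γ m) ∈ MulAction.stabilizer Γ m := by
      have := hχW _ hW1
      rwa [QuotientGroup.eq, mul_one, inv_mem_iff] at this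
    exact this

end Tubes

/-! ### Normal forms in a tube -/

section NormalForms

theorem conjClass_map_conj {Γ : Type u} [Group Γ] (L : Subgroup Γ) (a : Γ) :
    conjClass (L.map (MulAut.conj a).toMonoidHom) = conjClass L := by
  ext L'
  constructor
  · rintro ⟨b, rfl⟩
    refine ⟨b * a, ?_⟩
    rw [Subgroup.map_map]
    congr 1
    ext x
    simp
  · rintro ⟨b, rfl⟩
    refine ⟨b * a⁻¹, ?_⟩
    rw [Subgroup.map_map]
    congr 1
    ext x
    simp [mul_assoc]

theorem orbitType_smul {Γ : Type u} {M : Type u} [Group Γ] [MulAction Γ M] (g : Γ) (p : M) :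
    orbitType Γ (g • p) = orbitType Γ p := by
  have h1 : MulAction.stabilizer Γ (g • p) =
      (MulAction.stabilizer Γ p).map (MulAut.conj g).toMonoidHom :=
    MulAction.stabilizer_smul_eq_stabilizer_map_conj g p
  rw [orbitType, h1, conjClass_map_conj, orbitType]

section FixedVectors

variable {H : Type u} [Group H] [TopologicalSpace H] [LCAtlas H] {Y 𝔤 : LCS.{u}}

/-- The vectors of the kernel part that are fixed by `H`. -/
def EquivariantNormalForm.fixed (𝒩 : EquivariantNormalForm H Y) : Submodule ℝ 𝒩.Ker where
  carrier := {x | ∀ h, 𝒩.repKer h x = x}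
  add_mem' := fun hx hy h => by rw [map_add, hx h, hy h]
  zero_mem' := fun h => map_zero _
  smul_mem' := fun c x hx h => by rw [map_smul, hx h]

theorem EquivariantNormalForm.mem_fixed (𝒩 : EquivariantNormalForm H Y) {x : 𝒩.Ker} :
    x ∈ 𝒩.fixed ↔ ∀ h, 𝒩.repKer h x = x := Iff.rfl

theorem EquivariantNormalForm.isClosed_fixed (𝒩 : EquivariantNormalForm H Y) :
    IsClosed (𝒩.fixed : Set 𝒩.Ker) := by
  have : (𝒩.fixed : Set 𝒩.Ker) = ⋂ h, {x | 𝒩.repKer h x = x} := by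
    ext x
    simp only [mem_iInter]
    exact Iff.rfl
  rw [this]
  exact isClosed_iInter fun h => isClosed_eq
    (𝒩.continuous_repKer.comp (Continuous.prodMk_right h)) continuous_id

theorem EquivariantNormalForm.isClosed_Coker (𝒩 : EquivariantNormalForm H Y) :
    IsClosed (𝒩.Coker : Set Y) := by
  obtain ⟨e, he⟩ : ∃ e : 𝒩.Coker × 𝒩.Im ≃ₜ Y, ∀ p, e p = (p.1 : Y) + (p.2 : Y) :=
    ⟨𝒩.decomposition.homeomorph, fun p => rfl⟩
  have : (𝒩.Coker : Set Y) = (fun y => (e.symm y).2) ⁻¹' {0} := by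
    ext y
    constructor
    · intro hy
      have h1 : e (⟨y, hy⟩, 0) = y := by rw [he]; simp
      have h2 : e.symm y = (⟨y, hy⟩, 0) := e.symm_apply_eq.2 h1.symm
      exact congrArg Prod.snd h2
    · intro hy
      have h1 : (e.symm y).2 = 0 := hy
      have h2 := he (e.symm y)
      rw [e.apply_symm_apply, h1, ZeroMemClass.coe_zero, add_zero] at h2
      exact h2 ▸ (e.symm y).1.2
  rw [this]
  exact isClosed_singleton.preimage (continuous_snd.comp e.symm.continuous)

variable {κ : Y →ₗ[ℝ] 𝔤 →ₗ[ℝ] ℝ} {j : lieAlg H → 𝔤}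

/-- Near `0`, the singular part vanishes on the fixed vectors: there the momentum map relation says
that its derivative is zero. -/
theorem MGSNormalForm.exists_sing_eq_zero (𝒩 : MGSNormalForm H κ j) :
    ∃ V : Set 𝒩.Ker, IsOpen V ∧ 0 ∈ V ∧ ∀ x ∈ V, (x, (0 : 𝒩.Coim)) ∈ 𝒩.U ∧
      (x ∈ 𝒩.fixed → 𝒩.sing (x, 0) = 0) := by
  have hi : Continuous fun x : 𝒩.Ker => (x, (0 : 𝒩.Coim)) := Continuous.prodMk_left _
  obtain ⟨C, ⟨hC, hCc⟩, hCU⟩ := (LocallyConvexSpace.convex_basis (𝕜 := ℝ) (0 : 𝒩.Ker)).mem_iff.1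
    ((𝒩.isOpen_U.preimage hi).mem_nhds 𝒩.zero_mem)
  have hCU' : ∀ x ∈ C, (x, (0 : 𝒩.Coim)) ∈ 𝒩.U := fun x hx => hCU hx
  refine ⟨interior C, isOpen_interior, mem_interior_iff_mem_nhds.2 hC, fun x hx =>
    ⟨hCU' x (interior_subset hx), fun hxf => ?_⟩⟩
  have h0 : 𝒩.sing ((0 : 𝒩.Ker), (0 : 𝒩.Coim)) = 0 := 𝒩.sing_zero 0 𝒩.zero_mem
  have key := eq_of_dirDeriv_eq_zero (f := fun y : 𝒩.Ker => 𝒩.sing (y, 0)) (x := 0) (w := x)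
    fun t ht => by
      have hC0 : 0 + t • (x - 0) ∈ C := hCc.add_smul_sub_mem (mem_of_mem_nhds hC)
        (interior_subset hx) ht
      rw [sub_zero] at hC0
      rw [zero_add] at hC0 ⊢
      obtain ⟨y, hy⟩ := (𝒩.smooth_sing 1).2.1 _ (hCU' _ hC0) (x, 0)
      have hf : t • x ∈ 𝒩.fixed := 𝒩.fixed.smul_mem t hxf
      have h1 : HasDirDeriv (fun y : 𝒩.Ker => 𝒩.sing (y, 0)) (t • x) x y :=
        hy.congr' (Eventually.of_forall fun s => by simp)
      have hyC : y ∈ 𝒩.Coker := by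
        have hev : ∀ᶠ s : ℝ in 𝓝[≠] 0, (t • x + s • x, (0 : 𝒩.Coim)) ∈ 𝒩.U := by
          have h2 : Tendsto (fun s : ℝ => (t • x + s • x, (0 : 𝒩.Coim))) (𝓝 0)
              (𝓝 (t • x, (0 : 𝒩.Coim))) := by
            have : Continuous fun s : ℝ => (t • x + s • x, (0 : 𝒩.Coim)) := by fun_prop
            simpa using this.tendsto 0
          exact (h2.mono_left nhdsWithin_le_nhds).eventually
            (𝒩.isOpen_U.mem_nhds (hCU' _ hC0))
        refine 𝒩.isClosed_Coker.mem_of_tendsto h1 ?_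
        filter_upwards [hev] with s hs
        exact 𝒩.Coker.smul_mem _ (𝒩.Coker.sub_mem (𝒩.sing_mem _ hs) (𝒩.sing_mem _ (hCU' _ hC0)))
      have hy0 : y = 0 := 𝒩.coker_left y hyC fun ξ => by
        have h2 := 𝒩.momentum (t • x) (hCU' _ hC0) x ξ
        have h3 : infRep 𝒩.repKer ξ (t • x) = 0 := by
          rw [infRep]
          simp only [fun h => (𝒩.mem_fixed.1 hf h)]
          exact dirDeriv_const _ _ _
        rw [h3, map_zero, LinearMap.zero_apply, zero_add, hy.dirDeriv_eq] at h2
        exact h2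
      rwa [hy0] at h1
  simpa [h0] using key

end FixedVectors

variable {M G Gs : Type u} [TopologicalSpace M] [LCAtlas M] [IsLCManifold M]
  [Group G] [TopologicalSpace G] [LCAtlas G] [IsLCLieGroup G]
  [AddCommGroup Gs] [TopologicalSpace Gs] [LCAtlas Gs]
  [MulAction G M] [MulAction G Gs]

/-- The data through which `J` is brought into the normal form `𝒩` at `m`: a parametrisation `ι` of
a slice, and a chart of `M` around `m` whose inverse is `(a, x) ↦ χ a • ι x`, where `χ` takes values
in `G_μ`. -/
structure NormalTube (ω : BilinField M) {κ : lieAlgAdd Gs →ₗ[ℝ] lieAlg G →ₗ[ℝ] ℝ} (J : M → Gs)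
    {μ : Gs} {m : M} (𝒩 : MGSNormalForm (StabPt G μ m) κ (stabLie G μ m)) : Type (u + 1) where
  ι : 𝒩.Ker × 𝒩.Coim → M
  A : LCS.{u}
  D : Set A
  χ : A → StabMu G μ
  φ : OpenPartialHomeomorph M (A.prod (𝒩.Ker.prod 𝒩.Coim))
  a₀ : A
  isOpen_D : IsOpen D
  smooth_χ : SmoothOn (fun a => (χ a : G)) D
  smooth_φ : IsSmoothChart ⟨A.prod (𝒩.Ker.prod 𝒩.Coim), φ⟩
  target : ∀ (a : A) (x : 𝒩.Ker × 𝒩.Coim),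
    (show A.prod (𝒩.Ker.prod 𝒩.Coim) from (a, x)) ∈ φ.target ↔ a ∈ D ∧ x ∈ 𝒩.U
  symm : ∀ (a : A) (x : 𝒩.Ker × 𝒩.Coim),
    φ.symm (show A.prod (𝒩.Ker.prod 𝒩.Coim) from (a, x)) = χ a • ι x
  a₀_mem : a₀ ∈ D
  χ_a₀ : χ a₀ • m = m
  ι_zero : ι 0 = m
  smooth_ι : SmoothOn ι 𝒩.U
  equivariant : ∀ h, ∀ x ∈ 𝒩.U, ι (𝒩.act h x) = (h : StabMu G μ) • ι x
  slice : ∀ g : StabMu G μ, ∀ x ∈ 𝒩.U, ∀ y ∈ 𝒩.U, g • ι x = ι y →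
    g ∈ MulAction.stabilizer (StabMu G μ) m
  stab_submanifold : IsSubmanifold (MulAction.stabilizer (StabMu G μ) m : Set (StabMu G μ))
  level : ∀ x ∈ 𝒩.U, J (ι x) = μ ↔ x.2 = 0 ∧ 𝒩.sing x = 0
  form_eq : ∀ x : 𝒩.Ker, (x, (0 : 𝒩.Coim)) ∈ 𝒩.U → ∀ w₁ w₂ : 𝒩.Ker,
      ω (ι (x, 0))
        (dirDeriv (fun y : 𝒩.Ker => (chartAt (ι (x, 0) : M)).hom (ι (y, 0))) x w₁)
        (dirDeriv (fun y : 𝒩.Ker => (chartAt (ι (x, 0) : M)).hom (ι (y, 0))) x w₂) =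
      𝒩.form x w₁ w₂

theorem IsBroughtInto.nonempty_normalTube {ω : BilinField M}
    {κ : lieAlgAdd Gs →ₗ[ℝ] lieAlg G →ₗ[ℝ] ℝ} {J : M → Gs} {μ : Gs} {m : M}
    {𝒩 : MGSNormalForm (StabPt G μ m) κ (stabLie G μ m)} (h : IsBroughtInto ω J 𝒩)
    (hμ : IsSubmanifold (MulAction.stabilizer G μ : Set G)) : Nonempty (NormalTube ω J 𝒩) := by
  have : IsLCManifold (StabMu G μ) := hμ.isLCManifold_subgroup
  obtain ⟨S, ι, ρ, hS, hι, -, hμρ, hρμ, -, hSρ, hNF, hform⟩ := h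
  obtain ⟨A, D, χ, φ, a₀, hD, hχ, hφ, ht, hs, ha₀, hχa₀⟩ := hS.exists_chart hι
  have hinj := 𝒩.decomposition.injective
  refine ⟨⟨fun x => ι x, A, D, χ, φ, a₀, hD, ?_, hφ, fun a x => ht (a, x), fun a x => hs (a, x), ha₀,
    hχa₀, hι.map_zero, ?_, hι.equivariant, fun g x hx y hy hg => hS.stabilizer g ⟨ι x, (ι x).2, ?_⟩,
    ?_, fun x hx => ?_, hform⟩⟩
  · exact Smooth.comp_smoothOn hμ.smooth_coe hχ hD
  · have : IsLCManifold S := hS.submanifold.isLCManifold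
    exact Smooth.comp_smoothOn hS.submanifold.smooth_val hι.diffeo.2.2.1 𝒩.isOpen_U
  · rw [hg]
    exact (ι y).2
  · obtain ⟨_, hP, -⟩ := hS.section_tube
    exact hP.2.1
  · obtain ⟨hx1, hx2⟩ := hNF x hx
    have h0 : ρ.symm 0 = μ := by rw [← hρμ, ρ.left_inv hμρ]
    have h0t : (0 : lieAlgAdd Gs) ∈ ρ.target := by rw [← hρμ]; exact ρ.map_source hμρ
    have h3 := hx2 1
    rw [one_smul, OneMemClass.coe_one, one_smul] at h3
    rw [h3]
    constructor
    · intro h4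
      have h5 : (𝒩.core x.2 : lieAlgAdd Gs) + 𝒩.sing x = 0 :=
        ρ.symm.injOn hx1 h0t (h4.trans h0.symm)
      have h6 := @hinj (⟨𝒩.sing x, 𝒩.sing_mem x hx⟩, 𝒩.core x.2) 0 (by
        simp only [Prod.fst_zero, Prod.snd_zero, ZeroMemClass.coe_zero, add_zero]
        rwa [add_comm])
      have h7 := congrArg Prod.fst h6
      have h8 := congrArg Prod.snd h6
      exact ⟨(map_eq_zero_iff 𝒩.core 𝒩.core.injective).1 h8, congrArg Subtype.val h7⟩
    · rintro ⟨h4, h5⟩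
      rw [h4, h5, map_zero, ZeroMemClass.coe_zero, add_zero, h0]

namespace NormalTube

variable {ω : BilinField M} {κ : lieAlgAdd Gs →ₗ[ℝ] lieAlg G →ₗ[ℝ] ℝ} {J : M → Gs} {μ : Gs} {m : M}
  {𝒩 : MGSNormalForm (StabPt G μ m) κ (stabLie G μ m)} (t : NormalTube ω J 𝒩)

theorem injOn_ι : InjOn t.ι 𝒩.U := fun x hx y hy hxy => by
  have h1 := t.symm t.a₀ x
  rw [hxy, ← t.symm t.a₀ y] at h1
  have h2 := t.φ.symm.injOn ((t.target _ _).2 ⟨t.a₀_mem, hx⟩) ((t.target _ _).2 ⟨t.a₀_mem, hy⟩) h1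
  exact congrArg Prod.snd h2

theorem mem_stabilizer {x : 𝒩.Ker × 𝒩.Coim} (hx : x ∈ 𝒩.U) {g : StabMu G μ} :
    g ∈ MulAction.stabilizer (StabMu G μ) (t.ι x) ↔
      ∃ h : StabPt G μ m, (h : StabMu G μ) = g ∧ 𝒩.act h x = x := by
  constructor
  · intro hg
    have hg' : g • t.ι x = t.ι x := hg
    have h1 := t.slice g x hx x hx hg'
    refine ⟨⟨g, h1⟩, rfl, t.injOn_ι (𝒩.invariant_U _ x hx) hx ?_⟩
    exact (t.equivariant ⟨g, h1⟩ x hx).trans hg'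
  · rintro ⟨h, rfl, hh⟩
    refine (t.equivariant h x hx).symm.trans ?_
    rw [hh]

theorem stabilizer_le {x : 𝒩.Ker × 𝒩.Coim} (hx : x ∈ 𝒩.U) :
    MulAction.stabilizer (StabMu G μ) (t.ι x) ≤ MulAction.stabilizer (StabMu G μ) m := fun g hg => by
  obtain ⟨h, rfl, -⟩ := (t.mem_stabilizer hx).1 hg
  exact h.2

theorem orbitType_ι_eq_iff (hact : Smooth fun p : G × M => p.1 • p.2)
    (hμ : IsSubmanifold (MulAction.stabilizer G μ : Set G)) {x : 𝒩.Ker × 𝒩.Coim} (hx : x ∈ 𝒩.U) :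
    orbitType (StabMu G μ) (t.ι x) = orbitType (StabMu G μ) m ↔ ∀ h, 𝒩.act h x = x := by
  have := 𝒩.lie
  have := 𝒩.compact
  constructor
  · intro h k
    have h1 : MulAction.stabilizer (StabMu G μ) (t.ι x) ∈ orbitType (StabMu G μ) m := by
      rw [← h]
      exact ⟨1, by ext; simp⟩
    obtain ⟨a, ha⟩ := h1
    have h2 : ∀ h ∈ MulAction.stabilizer (StabMu G μ) m,
        a * h * a⁻¹ ∈ MulAction.stabilizer (StabMu G μ) (t.ι x) := fun h hh => by
      rw [ha]
      exact ⟨h, hh, rfl⟩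
    have h3 := conj_mem_of_conj_le hact hμ t.stab_submanifold
      (fun h hh => t.stabilizer_le hx (h2 h hh)) k.2
    have h4 := h2 _ h3
    have h5 : a * (a⁻¹ * (k : StabMu G μ) * a) * a⁻¹ = k := by group
    rw [h5] at h4
    obtain ⟨k', hk', hk''⟩ := (t.mem_stabilizer hx).1 h4
    rwa [Subtype.ext hk'] at hk''
  · intro h
    have h1 : MulAction.stabilizer (StabMu G μ) (t.ι x) = MulAction.stabilizer (StabMu G μ) m :=
      le_antisymm (t.stabilizer_le hx) fun g hg => (t.mem_stabilizer hx).2 ⟨⟨g, hg⟩, rfl, h _⟩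
    rw [orbitType, h1, orbitType]

end NormalTube

end NormalForms

/-! ### The orbit type pieces of a level set -/

section Pieces

/-- A neighbourhood of `0` in the kernel part on whose fixed vectors the singular part vanishes. -/
def MGSNormalForm.regular {H : Type u} [Group H] [TopologicalSpace H] [LCAtlas H] {Y 𝔤 : LCS.{u}}
    {κ : Y →ₗ[ℝ] 𝔤 →ₗ[ℝ] ℝ} {j : lieAlg H → 𝔤} (𝒩 : MGSNormalForm H κ j) : Set 𝒩.Ker :=
  𝒩.exists_sing_eq_zero.choose

section Regular

variable {H : Type u} [Group H] [TopologicalSpace H] [LCAtlas H] {Y 𝔤 : LCS.{u}}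
  {κ : Y →ₗ[ℝ] 𝔤 →ₗ[ℝ] ℝ} {j : lieAlg H → 𝔤} (𝒩 : MGSNormalForm H κ j)

theorem MGSNormalForm.isOpen_regular : IsOpen 𝒩.regular := 𝒩.exists_sing_eq_zero.choose_spec.1

theorem MGSNormalForm.zero_mem_regular : 0 ∈ 𝒩.regular := 𝒩.exists_sing_eq_zero.choose_spec.2.1

theorem MGSNormalForm.mem_U_of_regular {x : 𝒩.Ker} (hx : x ∈ 𝒩.regular) :
    (x, (0 : 𝒩.Coim)) ∈ 𝒩.U := (𝒩.exists_sing_eq_zero.choose_spec.2.2 x hx).1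

theorem MGSNormalForm.sing_eq_zero {x : 𝒩.Ker} (hx : x ∈ 𝒩.regular) (hf : x ∈ 𝒩.fixed) :
    𝒩.sing (x, 0) = 0 := (𝒩.exists_sing_eq_zero.choose_spec.2.2 x hx).2 hf

end Regular

variable {M G Gs : Type u} [TopologicalSpace M] [LCAtlas M] [IsLCManifold M]
  [Group G] [TopologicalSpace G] [LCAtlas G] [IsLCLieGroup G]
  [AddCommGroup Gs] [TopologicalSpace Gs] [LCAtlas Gs]
  [MulAction G M] [MulAction G Gs]

namespace NormalTube

variable {ω : BilinField M} {κ : lieAlgAdd Gs →ₗ[ℝ] lieAlg G →ₗ[ℝ] ℝ} {J : M → Gs} {μ : Gs} {m : M}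
  {𝒩 : MGSNormalForm (StabPt G μ m) κ (stabLie G μ m)} (t : NormalTube ω J 𝒩)

/-- The chart of a tube, over the vectors with regular kernel component. -/
def chart : LCChart M :=
  LCChart.restrOpen ⟨t.A.prod (𝒩.Ker.prod 𝒩.Coim), t.φ⟩
    (t.φ.source ∩ (fun p => (show t.A × 𝒩.Ker × 𝒩.Coim from t.φ p).2.1) ⁻¹' 𝒩.regular)
    (by
      have h : Continuous fun p : t.A × 𝒩.Ker × 𝒩.Coim => p.2.1 := by fun_prop
      exact t.φ.isOpen_inter_preimage (𝒩.isOpen_regular.preimage h))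

theorem isSmoothChart_chart : IsSmoothChart t.chart := t.smooth_φ.restrOpen _

theorem mem_chart_target {a : t.A} {x : 𝒩.Ker × 𝒩.Coim} :
    (show t.A.prod (𝒩.Ker.prod 𝒩.Coim) from (a, x)) ∈ t.chart.hom.target ↔
      a ∈ t.D ∧ x ∈ 𝒩.U ∧ x.1 ∈ 𝒩.regular := by
  have h : (show t.A.prod (𝒩.Ker.prod 𝒩.Coim) from (a, x)) ∈ t.chart.hom.target ↔
      (show t.A.prod (𝒩.Ker.prod 𝒩.Coim) from (a, x)) ∈ t.φ.target ∧ x.1 ∈ 𝒩.regular := by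
    constructor
    · rintro ⟨h1, -, h2⟩
      refine ⟨h1, ?_⟩
      have h3 := t.φ.right_inv h1
      have h4 : (show t.A × 𝒩.Ker × 𝒩.Coim from
        t.φ (t.φ.symm (show t.A.prod (𝒩.Ker.prod 𝒩.Coim) from (a, x)))).2.1 ∈ 𝒩.regular := h2
      rwa [h3] at h4
    · rintro ⟨h1, h2⟩
      refine ⟨h1, t.φ.map_target h1, ?_⟩
      change (show t.A × 𝒩.Ker × 𝒩.Coim from
        t.φ (t.φ.symm (show t.A.prod (𝒩.Ker.prod 𝒩.Coim) from (a, x)))).2.1 ∈ 𝒩.regular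
      rwa [t.φ.right_inv h1]
  rw [h, t.target, and_assoc]

theorem chart_symm (a : t.A) (x : 𝒩.Ker × 𝒩.Coim) :
    t.chart.hom.symm (show t.A.prod (𝒩.Ker.prod 𝒩.Coim) from (a, x)) = t.χ a • t.ι x :=
  t.symm a x

theorem mem_chart_source : m ∈ t.chart.hom.source := by
  have h := t.chart.hom.map_target (t.mem_chart_target (a := t.a₀) (x := 0)|>.2
    ⟨t.a₀_mem, 𝒩.zero_mem, 𝒩.zero_mem_regular⟩)
  rwa [t.chart_symm, t.ι_zero, t.χ_a₀] at h

theorem fixed_of_act {x : 𝒩.Ker × 𝒩.Coim} (hx : x.2 = 0) :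
    (∀ h, 𝒩.act h x = x) ↔ x.1 ∈ 𝒩.fixed := by
  obtain ⟨x, y⟩ := x
  obtain rfl : y = 0 := hx
  simp [EquivariantNormalForm.act, EquivariantNormalForm.mem_fixed]

/-- In the slice, the piece consists of the fixed vectors at which the singular part vanishes. -/
theorem smul_ι_mem_piece_iff (hact : Smooth fun p : G × M => p.1 • p.2)
    (hμ : IsSubmanifold (MulAction.stabilizer G μ : Set G))
    (hequiv : ∀ (g : G) (m : M), J (g • m) = g • J m) {c : Set (Subgroup (StabMu G μ))}
    (hc : orbitType (StabMu G μ) m = c) (g : StabMu G μ) {x : 𝒩.Ker × 𝒩.Coim} (hx : x ∈ 𝒩.U) :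
    g • t.ι x ∈ piece J μ c ↔ x.2 = 0 ∧ 𝒩.sing x = 0 ∧ x.1 ∈ 𝒩.fixed := by
  have h1 : J (g • t.ι x) = μ ↔ J (t.ι x) = μ := by
    have h2 : J (g • t.ι x) = (g : G) • J (t.ι x) := hequiv g _
    have h3 : (g : G) • μ = μ := g.2
    rw [h2]
    constructor
    · intro h
      exact smul_left_cancel (g : G) (h.trans h3.symm)
    · intro h
      rw [h, h3]
  have h4 : g • t.ι x ∈ piece J μ c ↔ orbitType (StabMu G μ) (g • t.ι x) = c ∧
    J (g • t.ι x) = μ := Iff.rfl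
  rw [h4, h1, orbitType_smul, ← hc, t.orbitType_ι_eq_iff hact hμ hx, t.level x hx]
  constructor
  · rintro ⟨h5, h6, h7⟩
    exact ⟨h6, h7, (fixed_of_act h6).1 h5⟩
  · rintro ⟨h5, h6, h7⟩
    exact ⟨(fixed_of_act h5).2 h7, h5, h6⟩

/-- The subspace that describes the piece in the chart. -/
def subspace : Submodule ℝ t.chart.model :=
  (⊤ : Submodule ℝ t.A).prod (𝒩.fixed.prod (⊥ : Submodule ℝ 𝒩.Coim))

theorem mem_subspace {a : t.A} {x : 𝒩.Ker × 𝒩.Coim} :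
    (show t.A.prod (𝒩.Ker.prod 𝒩.Coim) from (a, x)) ∈ t.subspace ↔
      x.1 ∈ 𝒩.fixed ∧ x.2 = 0 :=
  ⟨fun h => h.2, fun h => ⟨trivial, h⟩⟩

theorem isClosed_subspace : IsClosed (t.subspace : Set t.chart.model) := by
  have h : IsClosed ((univ : Set t.A) ×ˢ ((𝒩.fixed : Set 𝒩.Ker) ×ˢ ({0} : Set 𝒩.Coim))) :=
    isClosed_univ.prod (𝒩.isClosed_fixed.prod isClosed_singleton)
  exact h

theorem isAdapted (hact : Smooth fun p : G × M => p.1 • p.2)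
    (hμ : IsSubmanifold (MulAction.stabilizer G μ : Set G))
    (hequiv : ∀ (g : G) (m : M), J (g • m) = g • J m) {c : Set (Subgroup (StabMu G μ))}
    (hc : orbitType (StabMu G μ) m = c) : IsAdapted (piece J μ c) t.chart t.subspace := by
  have key : ∀ y ∈ t.chart.hom.target, t.chart.hom.symm y ∈ piece J μ c ↔ y ∈ t.subspace := by
    rintro ⟨a, x⟩ hy
    obtain ⟨-, hxU, hxV⟩ := t.mem_chart_target.1 hy
    have h1 := t.smul_ι_mem_piece_iff hact hμ hequiv hc (t.χ a) hxU
    refine (iff_of_eq (congrArg (fun p => p ∈ piece J μ c) (t.chart_symm a x))).trans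
      (h1.trans (Iff.trans ?_ t.mem_subspace.symm))
    constructor
    · rintro ⟨h2, -, h3⟩
      exact ⟨h3, h2⟩
    · rintro ⟨h2, h3⟩
      obtain ⟨x, z⟩ := x
      obtain rfl : z = 0 := h3
      exact ⟨rfl, 𝒩.sing_eq_zero hxV h2, h2⟩
  ext y
  constructor
  · rintro ⟨p, ⟨hp, hpS⟩, rfl⟩
    refine ⟨t.chart.hom.map_source hp, (key _ (t.chart.hom.map_source hp)).1 ?_⟩
    rwa [t.chart.hom.left_inv hp]
  · rintro ⟨hy, hyY⟩
    exact ⟨t.chart.hom.symm y, ⟨t.chart.hom.map_target hy, (key y hy).2 hyY⟩,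
      t.chart.hom.right_inv hy⟩

/-- The subspace that describes the piece is the product of the orbit directions and the fixed
vectors. -/
def subspaceEquiv : (t.chart.model.sub t.subspace) ≃L[ℝ] (t.A.prod (𝒩.Ker.sub 𝒩.fixed)) :=
  ContinuousLinearEquiv.mk (M := t.subspace) (M₂ := t.A × 𝒩.fixed)
    { toFun := fun p => ((show t.A × 𝒩.Ker × 𝒩.Coim from p.1).1,
        ⟨(show t.A × 𝒩.Ker × 𝒩.Coim from p.1).2.1, p.2.2.1⟩)
      invFun := fun q => ⟨(show t.A × 𝒩.Ker × 𝒩.Coim from (q.1, q.2, 0)), trivial, q.2.2, rfl⟩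
      map_add' := fun p q => rfl
      map_smul' := fun c p => rfl
      left_inv := by
        rintro ⟨⟨a, x, z⟩, h⟩
        obtain rfl : z = 0 := h.2.2
        rfl
      right_inv := fun q => rfl }
    (by
      have h : Continuous fun p : t.subspace => (show t.A × 𝒩.Ker × 𝒩.Coim from p.1) :=
        continuous_subtype_val
      exact (continuous_fst.comp h).prodMk
        ((continuous_fst.comp (continuous_snd.comp h)).subtype_mk _))
    (by
      have h : Continuous fun q : t.A × 𝒩.fixed =>
          (show t.A × 𝒩.Ker × 𝒩.Coim from (q.1, (q.2 : 𝒩.Ker), 0)) := by fun_prop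
      exact h.subtype_mk _)

end NormalTube

/-- The pieces are submanifolds. -/
theorem isSubmanifold_piece {ω : BilinField M} {κ : lieAlgAdd Gs →ₗ[ℝ] lieAlg G →ₗ[ℝ] ℝ}
    {J : M → Gs} {μ : Gs} (hact : Smooth fun p : G × M => p.1 • p.2)
    (hμ : IsSubmanifold (MulAction.stabilizer G μ : Set G))
    (hequiv : ∀ (g : G) (m : M), J (g • m) = g • J m)
    (hN : ∀ m, J m = μ → ∃ 𝒩 : MGSNormalForm (StabPt G μ m) κ (stabLie G μ m),
      Nonempty (NormalTube ω J 𝒩)) (c : Set (Subgroup (StabMu G μ))) :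
    IsSubmanifold (piece J μ c) := fun m hm => by
  obtain ⟨𝒩, ⟨t⟩⟩ := hN m hm.2
  exact ⟨t.chart, t.subspace, t.isSmoothChart_chart, t.mem_chart_source, t.isClosed_subspace,
    t.isAdapted hact hμ hequiv hm.1⟩

namespace NormalTube

variable {ω : BilinField M} {κ : lieAlgAdd Gs →ₗ[ℝ] lieAlg G →ₗ[ℝ] ℝ} {J : M → Gs} {μ : Gs} {m : M}
  {𝒩 : MGSNormalForm (StabPt G μ m) κ (stabLie G μ m)} (t : NormalTube ω J 𝒩)
  {c : Set (Subgroup (StabMu G μ))} (ha : IsAdapted (piece J μ c) t.chart t.subspace)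

/-- The chart of the piece, with values in the product of the orbit directions and the fixed
vectors. -/
def pieceChart (s₀ : piece J μ c) : LCChart (piece J μ c) :=
  (t.chart.restrict s₀ t.subspace ha).transEquiv t.subspaceEquiv

theorem mem_pieceChart_target {s₀ : piece J μ c} {a : t.A} {b : 𝒩.fixed} :
    (show t.A.prod (𝒩.Ker.sub 𝒩.fixed) from (a, b)) ∈ (t.pieceChart ha s₀).hom.target ↔
      a ∈ t.D ∧ (b : 𝒩.Ker) ∈ 𝒩.regular := by
  have h : (show t.A.prod (𝒩.Ker.sub 𝒩.fixed) from (a, b)) ∈ (t.pieceChart ha s₀).hom.target ↔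
      (show t.A.prod (𝒩.Ker.prod 𝒩.Coim) from (a, ((b : 𝒩.Ker), 0))) ∈ t.chart.hom.target :=
    Iff.rfl
  rw [h, t.mem_chart_target]
  exact ⟨fun h => ⟨h.1, h.2.2⟩, fun h => ⟨h.1, 𝒩.mem_U_of_regular h.2, h.2⟩⟩

theorem pieceChart_symm {s₀ : piece J μ c} {a : t.A} {b : 𝒩.fixed} (h1 : a ∈ t.D)
    (h2 : (b : 𝒩.Ker) ∈ 𝒩.regular) :
    ((t.pieceChart ha s₀).hom.symm (show t.A.prod (𝒩.Ker.sub 𝒩.fixed) from (a, b)) : M) =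
      t.χ a • t.ι (b, 0) :=
  (t.chart.restrict_symm s₀ ha (y := t.subspaceEquiv.symm (a, b))
    ((t.mem_pieceChart_target ha (s₀ := s₀)).2 ⟨h1, h2⟩)).trans (t.chart_symm a _)

theorem isSmoothChart_pieceChart (hS : IsSubmanifold (piece J μ c)) (s₀ : piece J μ c) :
    IsSmoothChart (t.pieceChart ha s₀) :=
  (isSmoothChart_restrict hS s₀ ha t.isSmoothChart_chart t.isClosed_subspace).transEquiv _

theorem orbitSetoid_iff {a a' : t.A} {b b' : 𝒩.fixed} (hb : (b : 𝒩.Ker) ∈ 𝒩.regular)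
    (hb' : (b' : 𝒩.Ker) ∈ 𝒩.regular) :
    t.χ a • t.ι (b, 0) ∈ MulAction.orbit (StabMu G μ) (t.χ a' • t.ι (b', 0)) ↔ b = b' := by
  have hU := 𝒩.mem_U_of_regular hb
  have hU' := 𝒩.mem_U_of_regular hb'
  constructor
  · rintro ⟨g, hg⟩
    have hg' : g • t.χ a' • t.ι (b', 0) = t.χ a • t.ι (b, 0) := hg
    have h1 : ((t.χ a)⁻¹ * g * t.χ a') • t.ι (b', 0) = t.ι (b, 0) := by
      rw [mul_smul, mul_smul, hg', inv_smul_smul]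
    have h2 := t.slice _ _ hU' _ hU h1
    have h3 := t.equivariant ⟨_, h2⟩ _ hU'
    have h4 : 𝒩.act ⟨_, h2⟩ ((b' : 𝒩.Ker), (0 : 𝒩.Coim)) = ((b' : 𝒩.Ker), 0) :=
      (fixed_of_act (x := ((b' : 𝒩.Ker), (0 : 𝒩.Coim))) rfl).2 b'.2 _
    rw [h4] at h3
    have h5 := t.injOn_ι hU' hU (h3.trans h1)
    exact Subtype.ext (congrArg Prod.fst h5).symm
  · rintro rfl
    refine ⟨t.χ a * (t.χ a')⁻¹, ?_⟩
    change (t.χ a * (t.χ a')⁻¹) • t.χ a' • t.ι (b, 0) = t.χ a • t.ι (b, 0)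
    rw [mul_smul, inv_smul_smul]

/-- The tube as a chart adapted to the projection onto the orbit space. -/
def quotChart (hS : IsSubmanifold (piece J μ c)) (hm : m ∈ piece J μ c) :
    QuotChart (orbitSetoid (StabMu G μ) (piece J μ c)) where
  A := t.A
  B := 𝒩.Ker.sub 𝒩.fixed
  φ := (t.pieceChart ha ⟨m, hm⟩).hom
  smooth := t.isSmoothChart_pieceChart ha hS _
  base := ⟨m, hm⟩
  base_mem := t.mem_chart_source
  rel := fun x hx y hy => by
    have key : ∀ x ∈ (t.pieceChart ha ⟨m, hm⟩).hom.source, ∃ (a : t.A) (b : 𝒩.fixed),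
        (b : 𝒩.Ker) ∈ 𝒩.regular ∧ (t.pieceChart ha ⟨m, hm⟩).hom x = (a, b) ∧
        (x : M) = t.χ a • t.ι (b, 0) := fun x hx => by
      obtain ⟨⟨a, b⟩, hab⟩ : ∃ p : t.A × 𝒩.fixed, (t.pieceChart ha ⟨m, hm⟩).hom x = p := ⟨_, rfl⟩
      have h1 := (t.pieceChart ha ⟨m, hm⟩).hom.map_source hx
      rw [hab] at h1
      obtain ⟨h2, h3⟩ := (t.mem_pieceChart_target ha).1 h1
      refine ⟨a, b, h3, hab, ?_⟩
      rw [← t.pieceChart_symm ha (s₀ := ⟨m, hm⟩) h2 h3]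
      exact congrArg Subtype.val
        (((t.pieceChart ha ⟨m, hm⟩).hom.left_inv hx).symm.trans (congrArg _ hab))
    obtain ⟨a, b, hb, h1, h2⟩ := key x hx
    obtain ⟨a', b', hb', h1', h2'⟩ := key y hy
    have h3 : orbitSetoid (StabMu G μ) (piece J μ c) x y ↔
      (x : M) ∈ MulAction.orbit (StabMu G μ) (y : M) := Iff.rfl
    rw [h2, h2', t.orbitSetoid_iff hb hb'] at h3
    have e1 : (show t.A × 𝒩.fixed from (t.pieceChart ha ⟨m, hm⟩).hom x).2 = b :=
      congrArg (fun p : t.A × 𝒩.fixed => p.2) h1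
    have e2 : (show t.A × 𝒩.fixed from (t.pieceChart ha ⟨m, hm⟩).hom y).2 = b' :=
      congrArg (fun p : t.A × 𝒩.fixed => p.2) h1'
    exact h3.trans ⟨fun h => e1.trans (h.trans e2.symm), fun h => e1.symm.trans (h.trans e2)⟩

end NormalTube

end Pieces

/-! ### Manifold structures on the reduced pieces -/

section ReducedPieces

variable {M G Gs : Type u} [TopologicalSpace M] [LCAtlas M] [IsLCManifold M]
  [Group G] [TopologicalSpace G] [LCAtlas G] [IsLCLieGroup G]
  [AddCommGroup Gs] [TopologicalSpace Gs] [LCAtlas Gs]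
  [MulAction G M] [MulAction G Gs]

/-- A set that is invariant under the subgroup of a group that acts by homeomorphisms has an open
projection onto its orbit space. -/
theorem isOpenMap_orbitQuotient {Γ : Type u} [Group Γ] [MulAction Γ M] {S : Set M}
    (hS : ∀ (g : Γ), ∀ s ∈ S, g • s ∈ S) (hc : ∀ g : Γ, Continuous fun x : M => g • x) :
    IsOpenMap (Quotient.mk (orbitSetoid Γ S)) := fun O hO => by
  have h : Quotient.mk (orbitSetoid Γ S) ⁻¹' (Quotient.mk (orbitSetoid Γ S) '' O) =
      ⋃ g : Γ, (fun s : S => (⟨g • (s : M), hS g s s.2⟩ : S)) ⁻¹' O := by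
    ext s
    simp only [mem_preimage, mem_image, mem_iUnion]
    constructor
    · rintro ⟨x, hx, hxs⟩
      obtain ⟨g, hg⟩ : (x : M) ∈ MulAction.orbit Γ (s : M) := Quotient.exact hxs
      refine ⟨g, ?_⟩
      convert hx
    · rintro ⟨g, hg⟩
      exact ⟨_, hg, Quotient.sound (show g • (s : M) ∈ MulAction.orbit Γ (s : M) from ⟨g, rfl⟩)⟩
  refine isOpen_coinduced.2 ?_
  change IsOpen (Quotient.mk (orbitSetoid Γ S) ⁻¹' (Quotient.mk (orbitSetoid Γ S) '' O))
  rw [h]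
  exact isOpen_iUnion fun g => hO.preimage
    (((hc g).comp continuous_subtype_val).subtype_mk _)

/-- The orbit relation of a closed subgroup is closed if the action is proper. -/
theorem isClosed_orbit_of_isProperMap {Γ : Subgroup G} (hΓ : IsClosed (Γ : Set G))
    (hproper : IsProperMap (fun p : G × M => (p.1 • p.2, p.2))) :
    IsClosed {p : M × M | p.1 ∈ MulAction.orbit Γ p.2} := by
  have h : {p : M × M | p.1 ∈ MulAction.orbit Γ p.2} =
      (fun p : G × M => (p.1 • p.2, p.2)) '' ((Γ : Set G) ×ˢ univ) := by
    ext ⟨x, y⟩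
    constructor
    · rintro ⟨g, hg⟩
      exact ⟨(g, y), ⟨g.2, trivial⟩, Prod.ext hg rfl⟩
    · rintro ⟨⟨g, z⟩, ⟨hg, -⟩, h⟩
      obtain rfl : z = y := congrArg Prod.snd h
      exact ⟨⟨g, hg⟩, congrArg Prod.fst h⟩
  rw [h]
  exact hproper.isClosedMap _ (hΓ.prod isClosed_univ)

theorem isClosed_orbitSetoid {Γ : Subgroup G} (hΓ : IsClosed (Γ : Set G))
    (hproper : IsProperMap (fun p : G × M => (p.1 • p.2, p.2))) (S : Set M) :
    IsClosed {p : S × S | orbitSetoid Γ S p.1 p.2} :=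
  (isClosed_orbit_of_isProperMap hΓ hproper).preimage
    ((continuous_subtype_val.comp continuous_fst).prodMk
      (continuous_subtype_val.comp continuous_snd))

theorem isClosed_stabilizer [T2Space Gs] (h : Continuous fun p : G × Gs => p.1 • p.2) (μ : Gs) :
    IsClosed (MulAction.stabilizer G μ : Set G) :=
  isClosed_eq (h.comp (Continuous.prodMk_left μ)) continuous_const

theorem smul_mem_level {J : M → Gs} {μ : Gs} (hequiv : ∀ (g : G) (m : M), J (g • m) = g • J m)
    (g : StabMu G μ) {s : M} (hs : J s = μ) : J (g • s) = μ := by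
  have h1 : J (g • s) = (g : G) • J s := hequiv g s
  rw [h1, hs]
  exact g.2

theorem smul_mem_piece {J : M → Gs} {μ : Gs} {c : Set (Subgroup (StabMu G μ))}
    (hequiv : ∀ (g : G) (m : M), J (g • m) = g • J m) (g : StabMu G μ) {s : M}
    (hs : s ∈ piece J μ c) : g • s ∈ piece J μ c :=
  ⟨(orbitType_smul g s).trans hs.1, smul_mem_level hequiv g hs.2⟩

theorem exists_smooth_move {J : M → Gs} {μ : Gs} {c : Set (Subgroup (StabMu G μ))}
    (hact : Smooth fun p : G × M => p.1 • p.2)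
    (hequiv : ∀ (g : G) (m : M), J (g • m) = g • J m) (hS : IsSubmanifold (piece J μ c))
    (p p' : piece J μ c) (h : orbitSetoid (StabMu G μ) (piece J μ c) p p') :
    ∃ γ : piece J μ c → piece J μ c, Smooth γ ∧ γ p = p' ∧
      ∀ x, orbitSetoid (StabMu G μ) (piece J μ c) x (γ x) := by
  have := hS.isLCManifold
  obtain ⟨g, hg⟩ : (p : M) ∈ MulAction.orbit (StabMu G μ) (p' : M) := h
  have hg' : g • (p' : M) = p := hg
  refine ⟨fun s => ⟨g⁻¹ • (s : M), smul_mem_piece hequiv g⁻¹ s.2⟩, hS.smooth_of_val ?_,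
    Subtype.ext ?_, fun x => ⟨g, smul_inv_smul g (x : M)⟩⟩
  · exact hact.comp ((smooth_const ((g⁻¹ : StabMu G μ) : G)).prodMk hS.smooth_val)
  · change g⁻¹ • (p : M) = p'
    rw [← hg', inv_smul_smul]

variable {ω : BilinField M} {κ : lieAlgAdd Gs →ₗ[ℝ] lieAlg G →ₗ[ℝ] ℝ} {J : M → Gs} {μ : Gs}

/-- The hypotheses on the action and the momentum map under which the orbit spaces of the pieces
are manifolds, together with a choice of normal forms. -/
structure ReductionData (ω : BilinField M) (κ : lieAlgAdd Gs →ₗ[ℝ] lieAlg G →ₗ[ℝ] ℝ) (J : M → Gs)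
    (μ : Gs) : Type (u + 1) where
  act : Smooth fun p : G × M => p.1 • p.2
  proper : IsProperMap (fun p : G × M => (p.1 • p.2, p.2))
  equiv : ∀ (g : G) (m : M), J (g • m) = g • J m
  stab : IsSubmanifold (MulAction.stabilizer G μ : Set G)
  stab_closed : IsClosed (MulAction.stabilizer G μ : Set G)
  nf : ∀ m, J m = μ → MGSNormalForm (StabPt G μ m) κ (stabLie G μ m)
  tube : ∀ m hm, NormalTube ω J (nf m hm)

namespace ReductionData

theorem isSubmanifold_piece (R : ReductionData ω κ J μ) (c : Set (Subgroup (StabMu G μ))) :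
    IsSubmanifold (piece J μ c) :=
  LCRed.isSubmanifold_piece R.act R.stab R.equiv (fun m hm => ⟨R.nf m hm, ⟨R.tube m hm⟩⟩) c

theorem isAdapted (R : ReductionData ω κ J μ) {c : Set (Subgroup (StabMu G μ))} (p : piece J μ c) :
    IsAdapted (piece J μ c) (R.tube p p.2.2).chart (R.tube p p.2.2).subspace :=
  (R.tube p p.2.2).isAdapted R.act R.stab R.equiv p.2.1

/-- The charts of the pieces that are adapted to the projection onto the orbit space. -/
def quotChart (R : ReductionData ω κ J μ) (c : Set (Subgroup (StabMu G μ))) (p : piece J μ c) : QuotChart (orbitSetoid (StabMu G μ) (piece J μ c)) :=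
  (R.tube p p.2.2).quotChart (R.isAdapted p) (R.isSubmanifold_piece c) p.2

theorem isOpenMap_piece (R : ReductionData ω κ J μ) (c : Set (Subgroup (StabMu G μ))) : IsOpenMap (Quotient.mk (orbitSetoid (StabMu G μ) (piece J μ c))) :=
  isOpenMap_orbitQuotient (fun g _ hs => smul_mem_piece R.equiv g hs) fun g =>
    R.act.continuous.comp (Continuous.prodMk_right (g : G))

/-- The manifold structure on the orbit space of a piece. -/
def structureOn (R : ReductionData ω κ J μ) (c : Set (Subgroup (StabMu G μ))) : SmoothStructure (OrbitQuotient (StabMu G μ) (piece J μ c)) :=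
  have := (R.isSubmanifold_piece c).isLCManifold
  QuotChart.smoothStructure (R.isOpenMap_piece c)
    (isClosed_orbitSetoid R.stab_closed R.proper _)
    (exists_smooth_move R.act R.equiv (R.isSubmanifold_piece c)) (R.quotChart c)
    fun p => (R.quotChart c p).base_mem

theorem isSmoothSubmersion_pieceProj (R : ReductionData ω κ J μ) (c : Set (Subgroup (StabMu G μ))) : IsSmoothSubmersion (pieceProj J μ c (R.structureOn c)) :=
  have := (R.isSubmanifold_piece c).isLCManifold
  QuotChart.isSmoothSubmersion (R.isOpenMap_piece c)
    (isClosed_orbitSetoid R.stab_closed R.proper _)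
    (exists_smooth_move R.act R.equiv (R.isSubmanifold_piece c)) (R.quotChart c)
    fun p => (R.quotChart c p).base_mem

theorem same_of_isSmoothSubmersion (R : ReductionData ω κ J μ)
    {c : Set (Subgroup (StabMu G μ))}
    {𝒮 : SmoothStructure (OrbitQuotient (StabMu G μ) (piece J μ c))}
    (h : IsSmoothSubmersion (pieceProj J μ c 𝒮)) : (R.structureOn c).Same 𝒮 :=
  have := (R.isSubmanifold_piece c).isLCManifold
  SmoothStructure.same_of_isSmoothSubmersion (R.isSmoothSubmersion_pieceProj c) h

end ReductionData

end ReducedPieces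

/-! ### The order of orbit types -/

section OrbitTypes

variable {Γ : Type u} {M : Type u} [Group Γ] [MulAction Γ M]

theorem stabilizer_mem_orbitType (p : M) : MulAction.stabilizer Γ p ∈ orbitType Γ p :=
  ⟨1, by ext; simp⟩

theorem typeLE_orbitType_iff {p q : M} : TypeLE (orbitType Γ p) (orbitType Γ q) ↔
    ∃ a : Γ, ∀ h ∈ MulAction.stabilizer Γ p, a * h * a⁻¹ ∈ MulAction.stabilizer Γ q := by
  constructor
  · rintro ⟨_, ⟨a, rfl⟩, _, ⟨b, rfl⟩, h⟩
    refine ⟨b⁻¹ * a, fun g hg => ?_⟩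
    obtain ⟨k, hk, hk'⟩ := h ⟨g, hg, rfl⟩
    have h1 : b * k * b⁻¹ = a * g * a⁻¹ := hk'
    have h2 : b⁻¹ * a * g * (b⁻¹ * a)⁻¹ = k := by
      rw [mul_inv_rev, inv_inv, ← mul_assoc, mul_assoc b⁻¹ a g, mul_assoc b⁻¹ (a * g), ← h1]
      group
    rwa [h2]
  · rintro ⟨a, h⟩
    refine ⟨_, ⟨a, rfl⟩, _, stabilizer_mem_orbitType q, ?_⟩
    rintro _ ⟨g, hg, rfl⟩
    exact h g hg

end OrbitTypes

/-! ### Stratifications -/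

section Stratifications

/-- The frontier condition holds if the closure relation of the pieces is governed by an
antisymmetric relation on the index set. -/
theorem frontier_of_antisymm {X : Type u} [TopologicalSpace X] {I : Type v} {N : I → Type u}
    {j : ∀ i, N i → X} (le : I → I → Prop) (hanti : ∀ i i', le i i' → le i' i → i = i')
    (hdisj : ∀ i i', i ≠ i' → Disjoint (range (j i)) (range (j i')))
    (h1 : ∀ i i', ∀ x ∈ range (j i), x ∈ closure (range (j i')) → le i' i)
    (h2 : ∀ i i', le i' i → ∀ x ∈ range (j i), x ∈ closure (range (j i'))) (i i' : I)
    (hne : i ≠ i') (h : (range (j i) ∩ closure (range (j i'))).Nonempty) :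
    range (j i) ⊆ closure (range (j i')) \ range (j i') ∧
      Disjoint (range (j i')) (closure (range (j i))) := by
  obtain ⟨x, hx, hx'⟩ := h
  have hle := h1 i i' x hx hx'
  refine ⟨fun y hy => ⟨h2 i i' hle y hy, fun hy' => (hdisj i i' hne).ne_of_mem hy hy' rfl⟩, ?_⟩
  rw [disjoint_left]
  intro y hy hy'
  exact hne (hanti i i' (h1 i' i y hy hy') hle)

theorem IsSubmanifold.isLocallyClosed {M : Type u} [TopologicalSpace M] [LCAtlas M] {S : Set M}
    (hS : IsSubmanifold S) : IsLocallyClosed S := by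
  refine ((isLocallyClosed_tfae S).out 0 3).2 fun s hs => ?_
  obtain ⟨φ, Y, -, hsφ, hY, h⟩ := hS s hs
  refine ⟨φ.hom.source, hsφ, φ.hom.open_source, fun p ⟨hp, hpS⟩ => ?_⟩
  have h1 : φ.hom p ∈ closure (φ.hom '' (φ.hom.source ∩ S)) := by
    have h2 : p ∈ closure (φ.hom.source ∩ S) :=
      φ.hom.open_source.inter_closure ⟨hp, hpS⟩
    have h3 := (φ.hom.continuousAt hp).continuousWithinAt (s := φ.hom.source ∩ S)
    exact h3.mem_closure_image h2
  have h2 : φ.hom p ∈ Y := by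
    have h3 : closure (φ.hom '' (φ.hom.source ∩ S)) ⊆ Y :=
      closure_minimal (h.le.trans inter_subset_right) hY
    exact h3 h1
  have h3 := h.symm_mem h2 (φ.hom.map_source hp)
  rwa [φ.hom.left_inv hp] at h3

theorem isLocallyClosed_of_preimage {X Y : Type*} [TopologicalSpace X] [TopologicalSpace Y]
    {π : X → Y} (hπ : IsOpenQuotientMap π) {T : Set Y} (h : IsLocallyClosed (π ⁻¹' T)) :
    IsLocallyClosed T := by
  rw [isLocallyClosed_iff_isOpen_coborder] at h ⊢
  have h1 : π ⁻¹' (coborder T) = coborder (π ⁻¹' T) := by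
    rw [coborder, coborder, preimage_compl, preimage_sdiff,
      hπ.isOpenMap.preimage_closure_eq_closure_preimage hπ.continuous]
  rw [← h1] at h
  exact (hπ.isQuotientMap.isOpen_preimage).1 h

variable {M G Gs : Type u} [TopologicalSpace M] [LCAtlas M] [IsLCManifold M]
  [Group G] [TopologicalSpace G] [LCAtlas G] [IsLCLieGroup G]
  [AddCommGroup Gs] [TopologicalSpace Gs] [LCAtlas Gs]
  [MulAction G M] [MulAction G Gs]

theorem dirDeriv_of_not_exists {E F : Type*} [AddCommGroup E] [Module ℝ E] [AddCommGroup F]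
    [Module ℝ F] [TopologicalSpace F] {f : E → F} {x w : E} (h : ¬∃ y, HasDirDeriv f x w y) :
    dirDeriv f x w = 0 := dif_neg h

theorem infRep_smul {H : Type u} [Group H] [TopologicalSpace H] [LCAtlas H] {E : LCS.{u}}
    (ρ : Representation ℝ H E) (ξ : lieAlg H) (x : E) {s : ℝ} (hs : s ≠ 0) :
    infRep ρ ξ (s • x) = s • infRep ρ ξ x := by
  have h1 : (fun e => ρ ((chartAt (1 : H)).hom.symm e) (s • x)) =
      fun e => s • ρ ((chartAt (1 : H)).hom.symm e) x := by
    funext e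
    rw [map_smul]
  rw [infRep, infRep, h1]
  by_cases h : ∃ y, HasDirDeriv (fun e => ρ ((chartAt (1 : H)).hom.symm e) x)
      ((chartAt (1 : H)).hom 1) ξ y
  · obtain ⟨y, hy⟩ := h
    rw [hy.dirDeriv_eq, (hy.const_smul s).dirDeriv_eq]
  · have h2 : ¬∃ y, HasDirDeriv (fun e => s • ρ ((chartAt (1 : H)).hom.symm e) x)
        ((chartAt (1 : H)).hom 1) ξ y := by
      rintro ⟨y, hy⟩
      refine h ⟨s⁻¹ • y, ?_⟩
      have := hy.const_smul s⁻¹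
      simpa only [smul_smul, inv_mul_cancel₀ hs, one_smul] using this
    rw [dirDeriv_of_not_exists h, dirDeriv_of_not_exists h2, smul_zero]

/-- In a strong normal form, the singular part is homogeneous: its zero set in the kernel part is a
cone. -/
theorem MGSNormalForm.IsStrong.sing_smul_eq_zero {H : Type u} [Group H] [TopologicalSpace H]
    [LCAtlas H] {Y 𝔤 : LCS.{u}} {κ : Y →ₗ[ℝ] 𝔤 →ₗ[ℝ] ℝ} {j : lieAlg H → 𝔤}
    {𝒩 : MGSNormalForm H κ j} (hN : 𝒩.IsStrong) {x : 𝒩.Ker} (hx : (x, (0 : 𝒩.Coim)) ∈ 𝒩.U)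
    (hx0 : 𝒩.sing (x, 0) = 0) {s : ℝ} (hs : s ≠ 0) (hsx : (s • x, (0 : 𝒩.Coim)) ∈ 𝒩.U) :
    𝒩.sing (s • x, 0) = 0 := by
  refine 𝒩.coker_left _ (𝒩.sing_mem _ hsx) fun ξ => ?_
  have h1 := (hN x hx).2 ξ
  rw [hx0, map_zero, LinearMap.zero_apply] at h1
  rw [(hN _ hsx).2 ξ, infRep_smul _ _ _ hs, map_smul, map_smul, LinearMap.smul_apply, smul_eq_mul,
    smul_eq_mul]
  linear_combination (-s ^ 2) * h1

namespace NormalTube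

variable {ω : BilinField M} {κ : lieAlgAdd Gs →ₗ[ℝ] lieAlg G →ₗ[ℝ] ℝ} {J : M → Gs} {μ : Gs} {m : M}
  {𝒩 : MGSNormalForm (StabPt G μ m) κ (stabLie G μ m)}

/-- The orbit types near `m` are at most that of `m`. -/
theorem eventually_typeLE (t : NormalTube ω J 𝒩) :
    ∀ᶠ p in 𝓝 m, TypeLE (orbitType (StabMu G μ) p) (orbitType (StabMu G μ) m) := by
  filter_upwards [t.chart.hom.open_source.mem_nhds t.mem_chart_source] with p hp
  obtain ⟨⟨a, x⟩, hax⟩ : ∃ y : t.A × 𝒩.Ker × 𝒩.Coim, t.chart.hom p = y := ⟨_, rfl⟩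
  have h1 := t.chart.hom.map_source hp
  have h2 := t.chart.hom.left_inv hp
  rw [hax] at h1 h2
  have h3 := (t.mem_chart_target.1 h1).2.1
  have h4 : t.χ a • t.ι x = p := (t.chart_symm a x).symm.trans h2
  rw [← h4, orbitType_smul]
  exact ⟨_, stabilizer_mem_orbitType _, _, stabilizer_mem_orbitType _, t.stabilizer_le h3⟩

theorem continuousAt_ι (t : NormalTube ω J 𝒩) {x : 𝒩.Ker × 𝒩.Coim} (hx : x ∈ 𝒩.U) : ContinuousAt t.ι x :=
  t.smooth_ι.1.continuousAt (𝒩.isOpen_U.mem_nhds hx)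

/-- The points of the pieces provided by the approximation property can be moved into `m` along
rays in the slice. -/
theorem mem_closure_piece (t : NormalTube ω J 𝒩) (hN : 𝒩.IsStrong) (happ : HasApproximation J 𝒩)
    {c : Set (Subgroup (StabMu G μ))} (hc : IsLevelType G J μ c)
    (hle : TypeLE c (orbitType (StabMu G μ) m)) : m ∈ closure (piece J μ c) := by
  obtain ⟨x, hx, hx0, hxc⟩ := happ c hc hle
  have hcont : Continuous fun s : ℝ => (s • x, (0 : 𝒩.Coim)) := by fun_prop
  have ht : Tendsto (fun s : ℝ => (s • x, (0 : 𝒩.Coim))) (𝓝[≠] 0) (𝓝 0) := by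
    have := hcont.tendsto 0
    rw [zero_smul] at this
    exact this.mono_left nhdsWithin_le_nhds
  have h1 : Tendsto (fun s : ℝ => t.ι (s • x, (0 : 𝒩.Coim))) (𝓝[≠] 0) (𝓝 m) := by
    have := (t.continuousAt_ι 𝒩.zero_mem).tendsto.comp ht
    rwa [t.ι_zero] at this
  refine mem_closure_of_tendsto h1 ?_
  filter_upwards [ht.eventually (𝒩.isOpen_U.mem_nhds 𝒩.zero_mem), self_mem_nhdsWithin] with s hsU hs
  have hs' : s ≠ 0 := hs
  refine ⟨?_, (t.level _ hsU).2 ⟨rfl, hN.sing_smul_eq_zero hx hx0 hs' hsU⟩⟩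
  have h2 : MulAction.stabilizer (StabMu G μ) (t.ι (s • x, (0 : 𝒩.Coim))) =
      (linStabilizer 𝒩.repKer x).map (MulAction.stabilizer (StabMu G μ) m).subtype := by
    ext g
    rw [t.mem_stabilizer hsU]
    constructor
    · rintro ⟨h, rfl, hh⟩
      have h3 : 𝒩.repKer h (s • x) = s • x := congrArg Prod.fst hh
      rw [map_smul] at h3
      exact ⟨h, smul_right_injective _ hs' h3, rfl⟩
    · rintro ⟨h, hh, rfl⟩
      have h3 : 𝒩.repKer h x = x := hh
      refine ⟨h, rfl, ?_⟩
      simp only [EquivariantNormalForm.act, map_smul, h3, map_zero]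
  rw [mem_ofPred_eq, orbitType, h2, hxc]

/-- The order of orbit types is antisymmetric on the level set, because compact Lie groups are
co-Hopfian. -/
theorem typeLE_antisymm (t : NormalTube ω J 𝒩) (hact : Smooth fun p : G × M => p.1 • p.2)
    (hμ : IsSubmanifold (MulAction.stabilizer G μ : Set G)) {p : M}
    (h1 : TypeLE (orbitType (StabMu G μ) m) (orbitType (StabMu G μ) p))
    (h2 : TypeLE (orbitType (StabMu G μ) p) (orbitType (StabMu G μ) m)) :
    orbitType (StabMu G μ) m = orbitType (StabMu G μ) p := by
  have := 𝒩.lie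
  have := 𝒩.compact
  obtain ⟨a, ha⟩ := typeLE_orbitType_iff.1 h1
  obtain ⟨b, hb⟩ := typeLE_orbitType_iff.1 h2
  have h3 : MulAction.stabilizer (StabMu G μ) p =
      (MulAction.stabilizer (StabMu G μ) m).map (MulAut.conj a).toMonoidHom := by
    refine le_antisymm (fun k hk => ?_) ?_
    · have h4 := conj_mem_of_conj_le hact hμ t.stab_submanifold (a := b * a) (fun h hh => by
        have := hb _ (ha h hh)
        rwa [show b * (a * h * a⁻¹) * b⁻¹ = b * a * h * (b * a)⁻¹ by group] at this) (hb k hk)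
      rw [show (b * a)⁻¹ * (b * k * b⁻¹) * (b * a) = a⁻¹ * k * a by group] at h4
      refine ⟨_, h4, ?_⟩
      change a * (a⁻¹ * k * a) * a⁻¹ = k
      group
    · rintro _ ⟨h, hh, rfl⟩
      exact ha h hh
  rw [orbitType, orbitType, h3, conjClass_map_conj]

end NormalTube

variable {ω : BilinField M} {κ : lieAlgAdd Gs →ₗ[ℝ] lieAlg G →ₗ[ℝ] ℝ} {J : M → Gs} {μ : Gs}

theorem range_inclusion_piece (c : Set (Subgroup (StabMu G μ))) :
    range (Set.inclusion (piece_subset J μ c)) = Subtype.val ⁻¹' piece J μ c :=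
  Set.range_inclusion _

theorem disjoint_piece {c c' : Set (Subgroup (StabMu G μ))} (h : c ≠ c') :
    Disjoint (piece J μ c) (piece J μ c') :=
  disjoint_left.2 fun _ hp hp' => h (hp.1.symm.trans hp'.1)

theorem mem_closure_range_inclusion {c : Set (Subgroup (StabMu G μ))} {x : J ⁻¹' {μ}} :
    x ∈ closure (range (Set.inclusion (piece_subset J μ c))) ↔ (x : M) ∈ closure (piece J μ c) := by
  refine closure_subtype.trans ?_
  rw [range_inclusion_piece, Subtype.image_preimage_coe,
    inter_eq_self_of_subset_right (piece_subset J μ c)]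

/-- Normal forms at all points of the level set that are strong and have the approximation
property. -/
def HasStrongTubes (ω : BilinField M) (κ : lieAlgAdd Gs →ₗ[ℝ] lieAlg G →ₗ[ℝ] ℝ) (J : M → Gs)
    (μ : Gs) : Prop :=
  ∀ m, J m = μ → ∃ 𝒩 : MGSNormalForm (StabPt G μ m) κ (stabLie G μ m),
    Nonempty (NormalTube ω J 𝒩) ∧ 𝒩.IsStrong ∧ HasApproximation J 𝒩

namespace ReductionData

theorem typeLE_of_mem_closure (R : ReductionData ω κ J μ) {c c' : Set (Subgroup (StabMu G μ))}
    {m : M} (hm : m ∈ piece J μ c) (h : m ∈ closure (piece J μ c')) : TypeLE c' c := by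
  obtain ⟨p, hp, hp'⟩ := mem_closure_iff_nhds.1 h _ (R.tube m hm.2).eventually_typeLE
  have h1 : TypeLE (orbitType (StabMu G μ) p) (orbitType (StabMu G μ) m) := hp
  have h2 : orbitType (StabMu G μ) p = c' := hp'.1
  have h3 : orbitType (StabMu G μ) m = c := hm.1
  rwa [h2, h3] at h1

theorem mem_closure_of_typeLE (hT : HasStrongTubes ω κ J μ) {c c' : Set (Subgroup (StabMu G μ))}
    (hc' : IsLevelType G J μ c') (h : TypeLE c' c) {m : M} (hm : m ∈ piece J μ c) :
    m ∈ closure (piece J μ c') := by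
  obtain ⟨𝒩, ⟨t⟩, hN, happ⟩ := hT m hm.2
  have h3 : orbitType (StabMu G μ) m = c := hm.1
  exact t.mem_closure_piece hN happ hc' (by rwa [h3])

theorem typeLE_antisymm (R : ReductionData ω κ J μ) (c c' : {c // IsLevelType G J μ c})
    (h : TypeLE c.1 c'.1) (h' : TypeLE c'.1 c.1) : c = c' := by
  obtain ⟨c, m, hm, rfl⟩ := c
  obtain ⟨c', m', hm', rfl⟩ := c'
  exact Subtype.ext ((R.tube m hm).typeLE_antisymm R.act R.stab h h')

theorem isStratification_level (R : ReductionData ω κ J μ) (hT : HasStrongTubes ω κ J μ) :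
    IsStratification (J ⁻¹' {μ}) (fun c : {c // IsLevelType G J μ c} => piece J μ c.1)
      (fun c => Set.inclusion (piece_subset J μ c.1)) := by
  have hdisj : ∀ c c' : {c // IsLevelType G J μ c}, c ≠ c' →
      Disjoint (range (Set.inclusion (piece_subset J μ c.1)))
        (range (Set.inclusion (piece_subset J μ c'.1))) := fun c c' h => by
    rw [range_inclusion_piece, range_inclusion_piece]
    exact (disjoint_piece fun h' => h (Subtype.ext h')).preimage _
  have := IsLCManifold.t2 (M := M)
  refine ⟨inferInstance, ?_, hdisj, ?_, fun c => (R.isSubmanifold_piece c.1).isLCManifold,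
    fun c => IsEmbedding.inclusion _, fun c => ?_,
    frontier_of_antisymm (fun c c' => TypeLE c.1 c'.1) R.typeLE_antisymm hdisj
      (fun c c' x hx hx' => ?_) (fun c c' h x hx => ?_)⟩
  · rintro ⟨c, m, hm, hc⟩
    exact ⟨⟨m, hc, hm⟩⟩
  · refine eq_univ_of_forall fun x => mem_iUnion.2 ⟨⟨_, x, x.2, rfl⟩, ?_⟩
    rw [range_inclusion_piece]
    exact ⟨rfl, x.2⟩
  · rw [range_inclusion_piece]
    exact (R.isSubmanifold_piece c.1).isLocallyClosed.preimage continuous_subtype_val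
  · rw [range_inclusion_piece] at hx
    exact R.typeLE_of_mem_closure hx (mem_closure_range_inclusion.1 hx')
  · rw [range_inclusion_piece] at hx
    exact mem_closure_range_inclusion.2 (mem_closure_of_typeLE hT c'.2 h hx)

theorem isOpenMap_level (R : ReductionData ω κ J μ) :
    IsOpenMap (Quotient.mk (orbitSetoid (StabMu G μ) (J ⁻¹' {μ}))) :=
  isOpenMap_orbitQuotient (fun g _ hs => smul_mem_level R.equiv g hs) fun g =>
    R.act.continuous.comp (Continuous.prodMk_right (g : G))

theorem preimage_range_orbitInclusion (R : ReductionData ω κ J μ)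
    (c : Set (Subgroup (StabMu G μ))) :
    Quotient.mk (orbitSetoid (StabMu G μ) (J ⁻¹' {μ})) ⁻¹'
      range (orbitInclusion (StabMu G μ) (piece_subset J μ c)) =
      range (Set.inclusion (piece_subset J μ c)) := by
  rw [range_inclusion_piece]
  ext x
  constructor
  · rintro ⟨q, hq⟩
    obtain ⟨p, rfl⟩ := Quotient.exists_rep q
    obtain ⟨g, hg⟩ : (p : M) ∈ MulAction.orbit (StabMu G μ) (x : M) := Quotient.exact hq
    have hg' : g • (x : M) = p := hg
    have h1 := smul_mem_piece R.equiv g⁻¹ p.2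
    rwa [← hg', inv_smul_smul] at h1
  · intro hx
    exact ⟨Quotient.mk _ ⟨x, hx⟩, rfl⟩

/-- The orbit space of a piece, with the quotient topology, is a subspace of the orbit space of the
level set. -/
theorem isEmbedding_orbitInclusion (R : ReductionData ω κ J μ)
    (c : Set (Subgroup (StabMu G μ))) :
    IsEmbedding (orbitInclusion (StabMu G μ) (piece_subset J μ c)) := by
  have hcont : Continuous (orbitInclusion (StabMu G μ) (piece_subset J μ c)) :=
    continuous_quot_lift _ (continuous_quotient_mk'.comp (continuous_inclusion (piece_subset J μ c)))
  refine ⟨⟨le_antisymm hcont.le_induced fun O hO => ?_⟩, ?_⟩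
  · have h1 : IsOpen (Quotient.mk (orbitSetoid (StabMu G μ) (piece J μ c)) ⁻¹' O) :=
      hO.preimage continuous_quotient_mk'
    obtain ⟨O', hO', hOO'⟩ := (IsEmbedding.inclusion (piece_subset J μ c)).isInducing.isOpen_iff.1 h1
    refine isOpen_induced_iff.2 ⟨_, R.isOpenMap_level O' hO', ?_⟩
    ext q
    obtain ⟨p, rfl⟩ := Quotient.exists_rep q
    constructor
    · rintro ⟨x, hx, hxp⟩
      have hx' : x ∈ range (Set.inclusion (piece_subset J μ c)) := by
        rw [← R.preimage_range_orbitInclusion]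
        exact ⟨_, hxp.symm⟩
      obtain ⟨x, rfl⟩ := hx'
      have h2 : x ∈ Set.inclusion (piece_subset J μ c) ⁻¹' O' := hx
      rw [hOO'] at h2
      have h3 : Quotient.mk (orbitSetoid (StabMu G μ) (piece J μ c)) x = Quotient.mk _ p := by
        have h4 : orbitSetoid (StabMu G μ) (J ⁻¹' {μ})
          (Set.inclusion (piece_subset J μ c) x) (Set.inclusion (piece_subset J μ c) p) :=
          Quotient.exact hxp
        exact Quotient.sound h4
      rw [← h3]
      exact h2
    · intro hp
      have h2 : p ∈ Set.inclusion (piece_subset J μ c) ⁻¹' O' := by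
        rw [hOO']
        exact hp
      exact ⟨_, h2, rfl⟩
  · intro q q' h
    obtain ⟨p, rfl⟩ := Quotient.exists_rep q
    obtain ⟨p', rfl⟩ := Quotient.exists_rep q'
    have h4 : orbitSetoid (StabMu G μ) (J ⁻¹' {μ})
      (Set.inclusion (piece_subset J μ c) p) (Set.inclusion (piece_subset J μ c) p') :=
      Quotient.exact h
    exact Quotient.sound h4

theorem isStratification_quotient (R : ReductionData ω κ J μ) (hT : HasStrongTubes ω κ J μ) :
    IsStratification (OrbitQuotient (StabMu G μ) (J ⁻¹' {μ}))
      (fun c : {c // IsLevelType G J μ c} => (R.structureOn c.1).Carrier)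
      (fun c q => orbitInclusion (StabMu G μ) (piece_subset J μ c.1)
        ((R.structureOn c.1).out q)) := by
  set π := Quotient.mk (orbitSetoid (StabMu G μ) (J ⁻¹' {μ})) with hπdef
  have hπ : IsOpenQuotientMap π :=
    ⟨Quotient.mk_surjective, continuous_quotient_mk', R.isOpenMap_level⟩
  have hrange : ∀ c : {c // IsLevelType G J μ c},
      range (fun q => orbitInclusion (StabMu G μ) (piece_subset J μ c.1)
        ((R.structureOn c.1).out q)) =
      range (orbitInclusion (StabMu G μ) (piece_subset J μ c.1)) := fun c => rfl
  have hmem : ∀ (c : {c // IsLevelType G J μ c}) x,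
      π x ∈ range (orbitInclusion (StabMu G μ) (piece_subset J μ c.1)) ↔
        x ∈ range (Set.inclusion (piece_subset J μ c.1)) := fun c x => by
    rw [← R.preimage_range_orbitInclusion]
    rfl
  have hcl : ∀ (c : {c // IsLevelType G J μ c}) x,
      π x ∈ closure (range (orbitInclusion (StabMu G μ) (piece_subset J μ c.1))) ↔
        x ∈ closure (range (Set.inclusion (piece_subset J μ c.1))) := fun c x => by
    rw [← R.preimage_range_orbitInclusion,
      ← hπ.isOpenMap.preimage_closure_eq_closure_preimage hπ.continuous]
    rfl
  have hL := R.isStratification_level hT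
  have hdisj : ∀ c c' : {c // IsLevelType G J μ c}, c ≠ c' →
      Disjoint (range (orbitInclusion (StabMu G μ) (piece_subset J μ c.1)))
        (range (orbitInclusion (StabMu G μ) (piece_subset J μ c'.1))) := fun c c' h => by
    rw [disjoint_left]
    intro q hq hq'
    obtain ⟨x, rfl⟩ := hπ.surjective q
    exact (hL.disjoint c c' h).ne_of_mem ((hmem c x).1 hq) ((hmem c' x).1 hq') rfl
  refine ⟨?_, ?_, hdisj, ?_, fun c => (R.structureOn c.1).manifold,
    fun c => R.isEmbedding_orbitInclusion c.1, fun c => ?_,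
    frontier_of_antisymm (fun c c' => TypeLE c.1 c'.1) R.typeLE_antisymm hdisj
      (fun c c' q hq hq' => ?_) (fun c c' h q hq => ?_)⟩
  · refine (t2Space_iff_of_isOpenQuotientMap hπ).2 ?_
    convert isClosed_orbitSetoid R.stab_closed R.proper (J ⁻¹' {μ}) using 3
    exact Quotient.eq
  · rintro ⟨c, m, hm, hc⟩
    exact ⟨(R.structureOn c).into (Quotient.mk _ ⟨m, hc, hm⟩)⟩
  · refine eq_univ_of_forall fun q => ?_
    obtain ⟨x, rfl⟩ := hπ.surjective q
    have h1 : x ∈ ⋃ c : {c // IsLevelType G J μ c},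
        range (Set.inclusion (piece_subset J μ c.1)) := hL.cover ▸ mem_univ x
    obtain ⟨c, hc⟩ := mem_iUnion.1 h1
    exact mem_iUnion.2 ⟨c, (hmem c x).2 hc⟩
  · rw [hrange]
    refine isLocallyClosed_of_preimage hπ ?_
    rw [R.preimage_range_orbitInclusion]
    exact hL.locallyClosed c
  · obtain ⟨x, rfl⟩ := hπ.surjective q
    have h1 := (hmem c x).1 hq
    rw [range_inclusion_piece] at h1
    exact R.typeLE_of_mem_closure h1 (mem_closure_range_inclusion.1 ((hcl c' x).1 hq'))
  · obtain ⟨x, rfl⟩ := hπ.surjective q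
    have h1 := (hmem c x).1 hq
    rw [range_inclusion_piece] at h1
    exact (hcl c' x).2 (mem_closure_range_inclusion.2 (mem_closure_of_typeLE hT c'.2 h h1))

end ReductionData

end Stratifications

/-! ### The symplectic form in a tube -/

section TubeForm

theorem HasDirDeriv.congr_line {E E' F : Type*} [AddCommGroup E] [Module ℝ E] [AddCommGroup E']
    [Module ℝ E'] [AddCommGroup F] [Module ℝ F] [TopologicalSpace F] {f : E → F} {g : E' → F}
    {x w : E} {x' w' : E'} {y : F} (h : HasDirDeriv f x w y)
    (hfg : ∀ᶠ τ : ℝ in 𝓝 0, g (x' + τ • w') = f (x + τ • w)) : HasDirDeriv g x' w' y := by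
  have h0 := hfg.self_of_nhds
  simp only [zero_smul, add_zero] at h0
  refine Tendsto.congr' ?_ h
  filter_upwards [nhdsWithin_le_nhds hfg] with τ hτ
  rw [hτ, h0]

section Manifolds

variable {M N : Type u} [TopologicalSpace M] [LCAtlas M] [TopologicalSpace N] [LCAtlas N]
  [IsLCManifold M] [IsLCManifold N]

theorem SmoothOn.hasDirDeriv_chartDeriv {f : M → N} {W : Set M} (hf : SmoothOn f W)
    (hW : IsOpen W) {x : M} (hx : x ∈ W) {φ : LCChart M} {ψ : LCChart N} (hφ : IsSmoothChart φ)
    (hψ : IsSmoothChart ψ) (hxφ : x ∈ φ.hom.source) (hxψ : f x ∈ ψ.hom.source) (w : φ.model) :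
    HasDirDeriv (chartRep φ ψ f) (φ.hom x) w (chartDeriv φ ψ f x w) :=
  hasDirDeriv_dirDeriv ((hf.rep_one hW hφ hψ).2.1 _ (φ.apply_mem_img hxφ ⟨hx, hxψ⟩) w)

theorem SmoothOn.chartDeriv_add {f : M → N} {W : Set M} (hf : SmoothOn f W)
    (hW : IsOpen W) {x : M} (hx : x ∈ W) {φ : LCChart M} {ψ : LCChart N} (hφ : IsSmoothChart φ)
    (hψ : IsSmoothChart ψ) (hxφ : x ∈ φ.hom.source) (hxψ : f x ∈ ψ.hom.source) (w w' : φ.model) :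
    chartDeriv φ ψ f x (w + w') = chartDeriv φ ψ f x w + chartDeriv φ ψ f x w' :=
  map_add (hf.chartDerivL hW hx hφ hψ hxφ hxψ) w w'

theorem chartDeriv_id_left_inverse {φ ψ : LCChart M} (hφ : IsSmoothChart φ)
    (hψ : IsSmoothChart ψ) {x : M} (hxφ : x ∈ φ.hom.source) (hxψ : x ∈ ψ.hom.source)
    (w : ψ.model) : chartDeriv φ ψ (fun y => y) x (chartDeriv ψ φ (fun y => y) x w) = w :=
  (chartDeriv_id_comp hψ hφ hψ hxψ hxφ hxψ w).trans (chartDeriv_id hxψ w)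

theorem localRep_eq (ω : BilinField M) {φ : LCChart M} {x : φ.model} (hx : x ∈ φ.hom.target)
    (w₁ w₂ : φ.model) : localRep ω φ x w₁ w₂ =
      ω (φ.hom.symm x)
        (chartDeriv φ (chartAt (φ.hom.symm x)) (fun y => y) (φ.hom.symm x) w₁)
        (chartDeriv φ (chartAt (φ.hom.symm x)) (fun y => y) (φ.hom.symm x) w₂) := by
  simp only [chartDeriv, φ.hom.right_inv hx]
  rfl

theorem IsSymplectic.self_eq_zero {ω : BilinField M} (hω : IsSymplectic ω) (m : M)
    (w : tangent m) : ω m w w = 0 := by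
  obtain ⟨φ, hφ, hm⟩ := IsLCManifold.cover m
  obtain ⟨x, hx, rfl⟩ : ∃ x ∈ φ.hom.target, φ.hom.symm x = m :=
    ⟨φ.hom m, φ.hom.map_source hm, φ.hom.left_inv hm⟩
  have hφ' := isSmoothChart_of_mem hφ
  have h1 := (hω.closed φ hφ).alternating x hx
    (chartDeriv (chartAt (φ.hom.symm x)) φ (fun y => y) (φ.hom.symm x) w)
  have h2 := chartDeriv_id_left_inverse hφ' (isSmoothChart_chartAt _) hm (mem_chartAt_source _) w
  exact (congrArg₂ (fun v v' : tangent (φ.hom.symm x) => ω (φ.hom.symm x) v v') h2 h2).symm.trans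
    ((localRep_eq ω hx _ _).symm.trans h1)

theorem IsSymplectic.skew {ω : BilinField M} (hω : IsSymplectic ω) (m : M) (w w' : tangent m) :
    ω m w w' = -ω m w' w := by
  have h := hω.self_eq_zero m (w + w')
  rw [map_add, map_add, LinearMap.add_apply, LinearMap.add_apply, hω.self_eq_zero,
    hω.self_eq_zero, zero_add, add_zero] at h
  linarith

end Manifolds

variable {M G Gs : Type u} [TopologicalSpace M] [LCAtlas M] [IsLCManifold M]
  [Group G] [TopologicalSpace G] [LCAtlas G] [IsLCLieGroup G]
  [AddCommGroup Gs] [TopologicalSpace Gs] [LCAtlas Gs] [IsLCAddLieGroup Gs]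
  [MulAction G M] [MulAction G Gs]

theorem IsSymplecticAction.preserves_of_eq {ω : BilinField M} (hω : IsSymplecticAction ω G) {g : G}
    {m p : M} (hp : g • m = p) (w₁ w₂ : tangent m) :
    ω p (tmap (fun x : M => g • x) m p w₁) (tmap (fun x : M => g • x) m p w₂) = ω m w₁ w₂ := by
  subst hp
  exact hω.preserves g m w₁ w₂

variable {ω : BilinField M} {κ : lieAlgAdd Gs →ₗ[ℝ] lieAlg G →ₗ[ℝ] ℝ} {J : M → Gs} {μ : Gs}
  {c : Set (Subgroup (StabMu G μ))}

/-- The orbit directions are orthogonal to the piece, on which the momentum map is constant. -/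
theorem apply_infAct_eq_zero (hJ : IsMomentumMap ω κ J) (hS : IsSubmanifold (piece J μ c))
    (s : piece J μ c) (ξ : lieAlg G) (w : tangent s) :
    ω s (infAct ξ (s : M)) (tmap Subtype.val s (s : M) w) = 0 := by
  have := hS.isLCManifold
  have h1 : tmap J (s : M) (J s) (tmap Subtype.val s (s : M) w) = 0 := by
    have h2 := tmap_comp (f := (Subtype.val : piece J μ c → M)) (g := J) hJ.smooth hS.smooth_val
      isOpen_univ isOpen_univ (mem_univ s) (mem_univ _) w
    refine h2.symm.trans ?_
    have h3 : (fun y : piece J μ c => J y) = fun _ => J s := by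
      funext y
      exact (piece_subset J μ c y.2).trans (piece_subset J μ c s.2).symm
    rw [h3]
    exact dirDeriv_const _ _ _
  have h2 : logDeriv J (s : M) (tmap Subtype.val s (s : M) w) = 0 := by
    rw [logDeriv, h1]
    exact chartDeriv_zero _ _
  have h3 := hJ.momentum s (tmap Subtype.val s (s : M) w) ξ
  rwa [h2, map_zero, LinearMap.zero_apply, add_zero] at h3

namespace NormalTube

variable {m : M} {𝒩 : MGSNormalForm (StabPt G μ m) κ (stabLie G μ m)} (t : NormalTube ω J 𝒩)
  (ha : IsAdapted (piece J μ c) t.chart t.subspace) {s₀ s : piece J μ c} {a : t.A} {b : 𝒩.fixed}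

theorem val_eq (hD : a ∈ t.D) (hb : (b : 𝒩.Ker) ∈ 𝒩.regular)
    (hs : (t.pieceChart ha s₀).hom.symm (show t.A.prod (𝒩.Ker.sub 𝒩.fixed) from (a, b)) = s) :
    t.χ a • t.ι (b, 0) = (s : M) :=
  (t.pieceChart_symm ha hD hb).symm.trans (congrArg Subtype.val hs)

theorem apply_pieceChart (hD : a ∈ t.D) (hb : (b : 𝒩.Ker) ∈ 𝒩.regular)
    (hs : (t.pieceChart ha s₀).hom.symm (show t.A.prod (𝒩.Ker.sub 𝒩.fixed) from (a, b)) = s) :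
    (t.pieceChart ha s₀).hom s = (show t.A.prod (𝒩.Ker.sub 𝒩.fixed) from (a, b)) := by
  rw [← hs]
  exact (t.pieceChart ha s₀).hom.right_inv ((t.mem_pieceChart_target ha).2 ⟨hD, hb⟩)

theorem mem_source (hD : a ∈ t.D) (hb : (b : 𝒩.Ker) ∈ 𝒩.regular)
    (hs : (t.pieceChart ha s₀).hom.symm (show t.A.prod (𝒩.Ker.sub 𝒩.fixed) from (a, b)) = s) :
    s ∈ (t.pieceChart ha s₀).hom.source := by
  rw [← hs]
  exact (t.pieceChart ha s₀).hom.map_target ((t.mem_pieceChart_target ha).2 ⟨hD, hb⟩)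

/-- The first coordinate of the tube runs along the orbits. -/
theorem chartDeriv_val_fst (hact : Smooth fun p : G × M => p.1 • p.2) (hD : a ∈ t.D)
    (hb : (b : 𝒩.Ker) ∈ 𝒩.regular)
    (hs : (t.pieceChart ha s₀).hom.symm (show t.A.prod (𝒩.Ker.sub 𝒩.fixed) from (a, b)) = s)
    (v : t.A) :
    chartDeriv (t.pieceChart ha s₀) (chartAt (s : M)) Subtype.val s
        (show t.A × 𝒩.fixed from (v, 0)) =
      infAct (chartDeriv t.A.chart (chartAt (1 : G)) (fun a' => (t.χ a' : G) * (t.χ a : G)⁻¹) a v)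
        (s : M) := by
  have hp := t.val_eq ha hD hb hs
  have hp' : (t.χ a : G) • t.ι (b, 0) = (s : M) := hp
  have h1 : SmoothOn (fun a' => (t.χ a' : G) * (t.χ a : G)⁻¹) t.D :=
    Smooth.comp_smoothOn (IsLCLieGroup.smooth_mul (G := G))
      (SmoothOn.prodMk t.smooth_χ ((smooth_const _).smoothOn _) t.isOpen_D) t.isOpen_D
  have h2 : Smooth fun g : G => g • (s : M) := hact.comp (smooth_id.prodMk (smooth_const _))
  have h3 : (t.χ a : G) * (t.χ a : G)⁻¹ = 1 := mul_inv_cancel _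
  have h4 : SmoothOn (fun a' => ((t.χ a' : G) * (t.χ a : G)⁻¹) • (s : M)) t.D :=
    Smooth.comp_smoothOn h2 h1 t.isOpen_D
  have h5 : ((t.χ a : G) * (t.χ a : G)⁻¹) • (s : M) = s := by rw [h3, one_smul]
  have h6 := h4.hasDirDeriv_chartDeriv t.isOpen_D hD t.A.isSmoothChart_chart
    (isSmoothChart_chartAt (s : M)) trivial (by rw [h5]; exact mem_chartAt_source _) v
  have h7 := chartDeriv_comp (f := fun a' => (t.χ a' : G) * (t.χ a : G)⁻¹)
    (g := fun g : G => g • (s : M)) h2 h1 t.isOpen_D isOpen_univ hD (mem_univ _)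
    t.A.isSmoothChart_chart (isSmoothChart_chartAt (1 : G)) (isSmoothChart_chartAt (s : M)) trivial
    (by rw [h3]; exact mem_chartAt_source _) (by rw [h5]; exact mem_chartAt_source _) v
  rw [h3] at h7
  refine Eq.trans (HasDirDeriv.dirDeriv_eq ?_) h7
  refine h6.congr_line ?_
  have h8 : ∀ᶠ τ : ℝ in 𝓝 0, a + τ • v ∈ t.D :=
    (tendsto_add_smul a v).eventually (t.isOpen_D.mem_nhds hD)
  filter_upwards [h8] with τ hτ
  rw [t.apply_pieceChart ha hD hb hs]
  have h9 : ((show t.A × 𝒩.fixed from (a, b)) + τ • (show t.A × 𝒩.fixed from (v, 0)) :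
      t.A × 𝒩.fixed) = (a + τ • v, b) := by
    refine Prod.ext rfl ?_
    change b + τ • 0 = b
    rw [smul_zero, add_zero]
  have h10 := t.pieceChart_symm ha (s₀ := s₀) hτ hb
  refine congrArg (chartAt (s : M)).hom ?_
  refine ((congrArg (fun y => (((t.pieceChart ha s₀).hom.symm y : piece J μ c) : M)) h9).trans
    h10).trans ?_
  change (t.χ (a + τ • v) : G) • t.ι (b, 0) = ((t.χ (a + τ • v) : G) * (t.χ a : G)⁻¹) • (s : M)
  rw [mul_smul, ← hp', inv_smul_smul]

/-- The second coordinate of the tube runs through a translate of the slice. -/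
theorem chartDeriv_val_snd (hact : Smooth fun p : G × M => p.1 • p.2) (hD : a ∈ t.D)
    (hb : (b : 𝒩.Ker) ∈ 𝒩.regular)
    (hs : (t.pieceChart ha s₀).hom.symm (show t.A.prod (𝒩.Ker.sub 𝒩.fixed) from (a, b)) = s)
    (v : 𝒩.fixed) :
    chartDeriv (t.pieceChart ha s₀) (chartAt (s : M)) Subtype.val s
        (show t.A × 𝒩.fixed from (0, v)) =
      tmap (fun x : M => (t.χ a : G) • x) (t.ι (b, 0)) (s : M)
        (dirDeriv (fun y : 𝒩.Ker => (chartAt (t.ι (b, 0))).hom (t.ι (y, 0))) b v) := by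
  have hp := t.val_eq ha hD hb hs
  have hp' : (t.χ a : G) • t.ι (b, 0) = (s : M) := hp
  have hi : Continuous fun x : 𝒩.Ker => (x, (0 : 𝒩.Coim)) := Continuous.prodMk_left _
  have hV : IsOpen {x : 𝒩.Ker | (x, (0 : 𝒩.Coim)) ∈ 𝒩.U} := 𝒩.isOpen_U.preimage hi
  have hbV : (b : 𝒩.Ker) ∈ {x : 𝒩.Ker | (x, (0 : 𝒩.Coim)) ∈ 𝒩.U} := 𝒩.mem_U_of_regular hb
  have h1 : SmoothOn (fun x : 𝒩.Ker => t.ι (x, 0)) {x : 𝒩.Ker | (x, (0 : 𝒩.Coim)) ∈ 𝒩.U} :=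
    SmoothOn.comp t.smooth_ι ((smooth_id.prodMk (smooth_const (0 : 𝒩.Coim))).smoothOn _) hV
      𝒩.isOpen_U fun x hx => hx
  have h2 : Smooth fun x : M => (t.χ a : G) • x := hact.comp ((smooth_const _).prodMk smooth_id)
  have h4 := Smooth.comp_smoothOn h2 h1 hV
  have h6 := h4.hasDirDeriv_chartDeriv hV hbV 𝒩.Ker.isSmoothChart_chart
    (isSmoothChart_chartAt (s : M)) trivial (by rw [hp']; exact mem_chartAt_source _) (v : 𝒩.Ker)
  have h7 := chartDeriv_comp (f := fun x : 𝒩.Ker => t.ι (x, 0))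
    (g := fun x : M => (t.χ a : G) • x) h2 h1 hV isOpen_univ hbV (mem_univ _)
    𝒩.Ker.isSmoothChart_chart (isSmoothChart_chartAt (t.ι (b, 0))) (isSmoothChart_chartAt (s : M))
    trivial (mem_chartAt_source _) (by rw [hp']; exact mem_chartAt_source _) (v : 𝒩.Ker)
  refine Eq.trans (HasDirDeriv.dirDeriv_eq ?_) h7
  refine h6.congr_line ?_
  have h8 : ∀ᶠ τ : ℝ in 𝓝 0, ((b + τ • v : 𝒩.fixed) : 𝒩.Ker) ∈ 𝒩.regular :=
    (continuous_subtype_val.continuousAt.tendsto.comp (tendsto_add_smul b v)).eventually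
      (𝒩.isOpen_regular.mem_nhds hb)
  filter_upwards [h8] with τ hτ
  rw [t.apply_pieceChart ha hD hb hs]
  have h9 : ((show t.A × 𝒩.fixed from (a, b)) + τ • (show t.A × 𝒩.fixed from (0, v)) :
      t.A × 𝒩.fixed) = (a, b + τ • v) := by
    refine Prod.ext ?_ rfl
    change a + τ • 0 = a
    rw [smul_zero, add_zero]
  have h10 := t.pieceChart_symm ha (s₀ := s₀) hD hτ
  exact congrArg (chartAt (s : M)).hom
    ((congrArg (fun y => (((t.pieceChart ha s₀).hom.symm y : piece J μ c) : M)) h9).trans h10)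

/-- In the tube, the restriction of `ω` to the piece is the form of the normal form, applied to the
second coordinate. -/
theorem apply_chartDeriv_val (hω : IsSymplecticAction ω G) (hJ : IsMomentumMap ω κ J)
    (hS : IsSubmanifold (piece J μ c)) (hD : a ∈ t.D) (hb : (b : 𝒩.Ker) ∈ 𝒩.regular)
    (hs : (t.pieceChart ha s₀).hom.symm (show t.A.prod (𝒩.Ker.sub 𝒩.fixed) from (a, b)) = s)
    (y y' : t.A × 𝒩.fixed) :
    ω s (chartDeriv (t.pieceChart ha s₀) (chartAt (s : M)) Subtype.val s y)
        (chartDeriv (t.pieceChart ha s₀) (chartAt (s : M)) Subtype.val s y') =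
      𝒩.form b y.2 y'.2 := by
  have := hS.isLCManifold
  have hsrc := t.mem_source ha hD hb hs
  have hθ := t.isSmoothChart_pieceChart ha hS s₀
  set z : t.A × 𝒩.fixed → tangent (s : M) := fun y =>
    chartDeriv (t.pieceChart ha s₀) (chartAt (s : M)) Subtype.val s y with hz
  have hadd : ∀ y, z y = z (y.1, 0) + z (0, y.2) := fun y => by
    have h1 := hS.smooth_val.chartDeriv_add isOpen_univ (mem_univ s) hθ
      (isSmoothChart_chartAt (s : M)) hsrc (mem_chartAt_source _)
      (show t.A × 𝒩.fixed from (y.1, 0)) (show t.A × 𝒩.fixed from (0, y.2))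
    refine Eq.trans (congrArg z ?_) h1
    refine Prod.ext ?_ ?_
    · exact (add_zero y.1).symm
    · exact (zero_add y.2).symm
  have hzt : ∀ y, ∃ w : tangent s, tmap Subtype.val s (s : M) w = z y := fun y => by
    refine ⟨chartDeriv (t.pieceChart ha s₀) (chartAt s) (fun x => x) s y, ?_⟩
    exact (chartDeriv_comp (f := fun x : piece J μ c => x) (g := (Subtype.val : piece J μ c → M))
      hS.smooth_val smooth_id isOpen_univ isOpen_univ (mem_univ s) (mem_univ _) hθ
      (isSmoothChart_chartAt s) (isSmoothChart_chartAt (s : M)) hsrc (mem_chartAt_source _)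
      (mem_chartAt_source _) y).symm
  have horth : ∀ v y, ω s (z (v, 0)) (z y) = 0 := fun v y => by
    obtain ⟨w, hw⟩ := hzt y
    have h1 : z (v, 0) = _ := t.chartDeriv_val_fst ha hω.smooth hD hb hs v
    rw [h1, ← hw]
    exact apply_infAct_eq_zero hJ hS s _ w
  have h2 : ω s (z y) (z y') = ω s (z (0, y.2)) (z (0, y'.2)) := by
    rw [hadd y, map_add, LinearMap.add_apply, horth, zero_add, hω.symplectic.skew, hadd y', map_add,
      LinearMap.add_apply, horth, zero_add, ← hω.symplectic.skew]
  refine h2.trans ?_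
  have h3 : z (0, y.2) = _ := t.chartDeriv_val_snd ha hω.smooth hD hb hs y.2
  have h4 : z (0, y'.2) = _ := t.chartDeriv_val_snd ha hω.smooth hD hb hs y'.2
  rw [h3, h4]
  exact (hω.preserves_of_eq (t.val_eq ha hD hb hs) _ _).trans
    (t.form_eq b (𝒩.mem_U_of_regular hb) y.2 y'.2)

end NormalTube

end TubeForm

/-! ### Non-degeneracy on the fixed vectors -/

section Nondegeneracy

/-- Mackey completeness passes to continuous linear retracts. -/
theorem IsMackeyComplete.of_retract {E F : LCS.{u}} (hF : IsMackeyComplete F) (i : E →L[ℝ] F)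
    (r : F →L[ℝ] E) (h : ∀ x, r (i x) = x) : IsMackeyComplete E := fun γ hγ => by
  obtain ⟨η, hη⟩ := hF (fun t => i (γ t)) (BSmoothOn.clm_comp hγ isOpen_univ i)
  exact ⟨fun t => r (η t), fun t => by simpa only [h] using (hη t).clm_comp r⟩

variable {M G Gs : Type u} [TopologicalSpace M] [LCAtlas M] [IsLCManifold M]
  [Group G] [TopologicalSpace G] [LCAtlas G] [IsLCLieGroup G]
  [AddCommGroup Gs] [TopologicalSpace Gs] [LCAtlas Gs]
  [MulAction G M] [MulAction G Gs]

namespace NormalTube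

variable {ω : BilinField M} {κ : lieAlgAdd Gs →ₗ[ℝ] lieAlg G →ₗ[ℝ] ℝ} {J : M → Gs} {μ : Gs} {m : M}
  {𝒩 : MGSNormalForm (StabPt G μ m) κ (stabLie G μ m)}

theorem isMackeyComplete_Ker (t : NormalTube ω J 𝒩) (h : IsMackeyComplete (tangent m)) :
    IsMackeyComplete 𝒩.Ker := by
  have hc := t.isSmoothChart_chart
  have hm := t.mem_chart_source
  have hm' := mem_chartAt_source m
  let D₁ : (t.A × 𝒩.Ker × 𝒩.Coim) →L[ℝ] tangent m :=
    SmoothOn.chartDerivL smooth_id isOpen_univ (mem_univ m) hc (isSmoothChart_chartAt m) hm hm'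
  let D₂ : tangent m →L[ℝ] (t.A × 𝒩.Ker × 𝒩.Coim) :=
    SmoothOn.chartDerivL smooth_id isOpen_univ (mem_univ m) (isSmoothChart_chartAt m) hc hm' hm
  have hD : ∀ y, D₂ (D₁ y) = y := fun y =>
    chartDeriv_id_left_inverse (isSmoothChart_chartAt m) hc hm' hm y
  let i : 𝒩.Ker →L[ℝ] t.A × 𝒩.Ker × 𝒩.Coim :=
    (ContinuousLinearMap.inr ℝ t.A (𝒩.Ker × 𝒩.Coim)).comp (ContinuousLinearMap.inl ℝ 𝒩.Ker 𝒩.Coim)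
  let r : t.A × 𝒩.Ker × 𝒩.Coim →L[ℝ] 𝒩.Ker :=
    (ContinuousLinearMap.fst ℝ 𝒩.Ker 𝒩.Coim).comp (ContinuousLinearMap.snd ℝ t.A (𝒩.Ker × 𝒩.Coim))
  exact h.of_retract (D₁.comp i) (r.comp D₂) fun x => by
    change r (D₂ (D₁ (i x))) = x
    rw [hD]
    rfl

/-- The linear action on the kernel part is smooth along every orbit, because near `m` it is the
smooth action on the slice. -/
theorem smooth_repKer (t : NormalTube ω J 𝒩) (hact : Smooth fun p : G × M => p.1 • p.2)
    (hμ : IsSubmanifold (MulAction.stabilizer G μ : Set G)) (w : 𝒩.Ker) :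
    Smooth fun h : StabPt G μ m => 𝒩.repKer h w := by
  have := 𝒩.lie
  have : IsLCManifold (StabMu G μ) := hμ.isLCManifold_subgroup
  have hcont : Continuous fun s : ℝ => (s • w, (0 : 𝒩.Coim)) := by fun_prop
  obtain ⟨s, hsU, hs⟩ : ∃ s : ℝ, (s • w, (0 : 𝒩.Coim)) ∈ 𝒩.U ∧ s ≠ 0 := by
    have h1 : ∀ᶠ s : ℝ in 𝓝 0, (s • w, (0 : 𝒩.Coim)) ∈ 𝒩.U :=
      (hcont.tendsto 0).eventually (𝒩.isOpen_U.mem_nhds (by rw [zero_smul]; exact 𝒩.zero_mem))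
    exact ((h1.filter_mono nhdsWithin_le_nhds).and
      (self_mem_nhdsWithin : {(0 : ℝ)}ᶜ ∈ 𝓝[≠] 0)).exists
  have hH : Smooth fun h : StabPt G μ m => ((h : StabMu G μ) : G) :=
    hμ.smooth_coe.comp t.stab_submanifold.smooth_coe
  have hf : Smooth fun h : StabPt G μ m =>
      ((t.χ t.a₀ : StabMu G μ) : G) • ((h : StabMu G μ) : G) • t.ι (s • w, 0) :=
    hact.comp ((smooth_const _).prodMk (hact.comp (hH.prodMk (smooth_const _))))
  have hU : ∀ h, 𝒩.act h (s • w, 0) ∈ 𝒩.U := fun h => 𝒩.invariant_U h _ hsU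
  have he : ∀ h : StabPt G μ m,
      ((t.χ t.a₀ : StabMu G μ) : G) • ((h : StabMu G μ) : G) • t.ι (s • w, 0) =
        t.φ.symm (show t.A.prod (𝒩.Ker.prod 𝒩.Coim) from (t.a₀, 𝒩.act h (s • w, 0))) := fun h => by
    rw [t.symm, t.equivariant h _ hsU]
    rfl
  have hsrc : ∀ h : StabPt G μ m,
      ((t.χ t.a₀ : StabMu G μ) : G) • ((h : StabMu G μ) : G) • t.ι (s • w, 0) ∈ t.φ.source :=
    fun h => by
      rw [he]
      exact t.φ.map_target ((t.target _ _).2 ⟨t.a₀_mem, hU h⟩)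
  have h1 : Smooth fun h : StabPt G μ m =>
      t.φ (((t.χ t.a₀ : StabMu G μ) : G) • ((h : StabMu G μ) : G) • t.ι (s • w, 0)) :=
    SmoothOn.comp t.smooth_φ.smoothOn_hom hf isOpen_univ t.φ.open_source fun h _ => hsrc h
  let r : t.A × 𝒩.Ker × 𝒩.Coim →L[ℝ] 𝒩.Ker := s⁻¹ •
    ((ContinuousLinearMap.fst ℝ 𝒩.Ker 𝒩.Coim).comp (ContinuousLinearMap.snd ℝ t.A (𝒩.Ker × 𝒩.Coim)))
  have hr : Smooth (M := t.A.prod (𝒩.Ker.prod 𝒩.Coim)) (N := 𝒩.Ker) r :=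
    BSmoothOn.smoothOn (E := t.A.prod (𝒩.Ker.prod 𝒩.Coim)) (bSmoothOn_clm r _) isOpen_univ
  have h2 := hr.comp h1
  have h3 : (fun h : StabPt G μ m => 𝒩.repKer h w) = fun h : StabPt G μ m =>
      r (t.φ (((t.χ t.a₀ : StabMu G μ) : G) • ((h : StabMu G μ) : G) • t.ι (s • w, 0))) := by
    funext h
    rw [he, t.φ.right_inv ((t.target _ _).2 ⟨t.a₀_mem, hU h⟩)]
    change 𝒩.repKer h w = s⁻¹ • 𝒩.repKer h (s • w)
    rw [map_smul, smul_smul, inv_mul_cancel₀ hs, one_smul]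
  rw [h3]
  exact h2

/-- The form of the normal form restricts to a non-degenerate form on the fixed vectors: an
invariant functional that vanishes on the averages of all vectors vanishes. -/
theorem eq_zero_of_form_fixed (t : NormalTube ω J 𝒩) (hact : Smooth fun p : G × M => p.1 • p.2)
    (hμ : IsSubmanifold (MulAction.stabilizer G μ : Set G)) (hM : IsMackeyComplete (tangent m))
    {u : 𝒩.Ker} (hu : u ∈ 𝒩.fixed) (h : ∀ y ∈ 𝒩.fixed, 𝒩.form 0 u y = 0) : u = 0 := by
  have := 𝒩.lie
  have := 𝒩.compact
  have h0 : ((0 : 𝒩.Ker), (0 : 𝒩.Coim)) ∈ 𝒩.U := 𝒩.zero_mem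
  refine 𝒩.symplectic_zero u fun w => ?_
  have hcont : Continuous fun w : 𝒩.Ker => 𝒩.form 0 u w := by
    have h1 := 𝒩.closed_form.smooth.continuousOn
    have h2 : Continuous fun w : 𝒩.Ker => ((0 : 𝒩.Ker), u, w) := by fun_prop
    exact h1.comp_continuous h2 fun w => ⟨h0, trivial⟩
  let l : 𝒩.Ker →L[ℝ] ℝ := ⟨𝒩.form 0 u, hcont⟩
  obtain ⟨y, hy, hyw⟩ := (t.isMackeyComplete_Ker hM).exists_average 𝒩.repKer 𝒩.continuous_repKer
    (t.smooth_repKer hact hμ w)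
  have h2 := hyw l fun k => by
    have h3 := 𝒩.invariant_form k 0 h0 u w
    rw [map_zero, hu k] at h3
    exact h3
  exact h2.symm.trans (h y hy)

end NormalTube

end Nondegeneracy

/-! ### The reduced symplectic forms -/

section ReducedForms

/-- The restriction of a closed 2-form to a linear subspace. -/
theorem IsClosedTwoFormOn.restrict {E : LCS.{u}} {U : Set E} {β : E → E → E → ℝ}
    (h : IsClosedTwoFormOn U β) (Y : Submodule ℝ E) {V : Set Y} (hV : IsOpen V)
    (hVU : ∀ y ∈ V, (y : E) ∈ U) {β' : Y → Y → Y → ℝ}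
    (hβ : ∀ y ∈ V, ∀ w₁ w₂ : Y, β' y w₁ w₂ = β y w₁ w₂) : IsClosedTwoFormOn V β' where
  bilinear x hx := by
    obtain ⟨B, hB⟩ := h.bilinear x (hVU x hx)
    refine ⟨B.compl₁₂ Y.subtype Y.subtype, fun w₁ w₂ => ?_⟩
    rw [hβ x hx, hB]
    rfl
  alternating x hx w := by
    rw [hβ x hx, h.alternating x (hVU x hx)]
  smooth := by
    let L : Y × Y × Y →L[ℝ] E × E × E := Y.subtypeL.prodMap (Y.subtypeL.prodMap Y.subtypeL)
    have h1 := BSmoothOn.mono (BSmoothOn.comp_clm h.smooth L)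
      (V := V ×ˢ (univ : Set (Y × Y))) fun p hp => ⟨hVU p.1 hp.1, trivial⟩
    exact h1.congr (hV.prod isOpen_univ) fun p hp => (hβ p.1 hp.1 p.2.1 p.2.2).symm
  closed x hx w₁ w₂ w₃ := by
    have key : ∀ v₁ v₂ v₃ : Y, dirDeriv (fun y => β' y v₂ v₃) x v₁ =
        dirDeriv (fun y => β y v₂ v₃) (x : E) (v₁ : E) := fun v₁ v₂ v₃ => by
      obtain ⟨y, hy⟩ := (h.smooth 1).2.1 ((x : E), (v₂ : E), (v₃ : E)) ⟨hVU x hx, trivial⟩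
        ((v₁ : E), (0 : E), (0 : E))
      have h1 : HasDirDeriv (fun y => β y v₂ v₃) (x : E) (v₁ : E) y :=
        hy.congr_line (Eventually.of_forall fun τ => by simp)
      have h2 : HasDirDeriv (fun y => β' y v₂ v₃) x v₁ y := by
        refine h1.congr_line ?_
        filter_upwards [(tendsto_add_smul x v₁).eventually (hV.mem_nhds hx)] with τ hτ
        rw [hβ _ hτ]
        rfl
      rw [h1.dirDeriv_eq, h2.dirDeriv_eq]
    rw [key, key, key]
    exact h.closed x (hVU x hx) w₁ w₂ w₃

variable {M G Gs : Type u} [TopologicalSpace M] [LCAtlas M] [IsLCManifold M]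
  [Group G] [TopologicalSpace G] [LCAtlas G] [IsLCLieGroup G]
  [AddCommGroup Gs] [TopologicalSpace Gs] [LCAtlas Gs] [IsLCAddLieGroup Gs]
  [MulAction G M] [MulAction G Gs]
  {ω : BilinField M} {κ : lieAlgAdd Gs →ₗ[ℝ] lieAlg G →ₗ[ℝ] ℝ} {J : M → Gs} {μ : Gs}

theorem NormalTube.pieceChart_symm_base {m : M}
    {𝒩 : MGSNormalForm (StabPt G μ m) κ (stabLie G μ m)} (t : NormalTube ω J 𝒩)
    {c : Set (Subgroup (StabMu G μ))} (ha : IsAdapted (piece J μ c) t.chart t.subspace)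
    (hm : m ∈ piece J μ c) :
    (t.pieceChart ha ⟨m, hm⟩).hom.symm
      (show t.A.prod (𝒩.Ker.sub 𝒩.fixed) from (t.a₀, (0 : 𝒩.fixed))) = ⟨m, hm⟩ := by
  refine Subtype.ext ((t.pieceChart_symm ha t.a₀_mem 𝒩.zero_mem_regular).trans ?_)
  have h1 : t.ι (((0 : 𝒩.fixed) : 𝒩.Ker), 0) = m := t.ι_zero
  rw [h1, t.χ_a₀]

namespace ReductionData

variable (R : ReductionData ω κ J μ) {c : Set (Subgroup (StabMu G μ))}

/-- The normal form at a point of a piece. -/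
abbrev normalForm (p : piece J μ c) : MGSNormalForm (StabPt G μ (p : M)) κ (stabLie G μ (p : M)) :=
  R.nf p p.2.2

/-- The chart of the piece around `p`. -/
abbrev pieceChart (p : piece J μ c) : LCChart (piece J μ c) :=
  (R.tube p p.2.2).pieceChart (R.isAdapted p) p

/-- The chart of the orbit space of the piece around the orbit of `p`. -/
def redChart (p : piece J μ c) : LCChart (R.structureOn c).Carrier :=
  have := (R.isSubmanifold_piece c).isLCManifold
  (R.quotChart c p).chart (R.isOpenMap_piece c)

theorem isSmoothChart_redChart (p : piece J μ c) : IsSmoothChart (R.redChart p) :=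
  have : IsLCManifold (R.structureOn c).Carrier := (R.structureOn c).manifold
  isSmoothChart_of_mem ⟨p, rfl⟩

theorem mem_redChart_source {p s : piece J μ c} (hs : s ∈ (R.pieceChart p).hom.source) :
    pieceProj J μ c (R.structureOn c) s ∈ (R.redChart p).hom.source := mem_image_of_mem _ hs

theorem redChart_apply {p s : piece J μ c} (hs : s ∈ (R.pieceChart p).hom.source) :
    (R.redChart p).hom (pieceProj J μ c (R.structureOn c) s) =
      (show (R.tube p p.2.2).A × (R.normalForm p).fixed from (R.pieceChart p).hom s).2 :=
  have := (R.isSubmanifold_piece c).isLCManifold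
  (R.quotChart c p).coord_mk hs

theorem exists_of_mem_redChart_target {p : piece J μ c} {b : (R.normalForm p).fixed}
    (hb : (show (R.normalForm p).Ker.sub (R.normalForm p).fixed from b) ∈
      (R.redChart p).hom.target) :
    ((b : (R.normalForm p).Ker) ∈ (R.normalForm p).regular) ∧
      ∃ (a : (R.tube p p.2.2).A) (s : piece J μ c), a ∈ (R.tube p p.2.2).D ∧
      (R.pieceChart p).hom.symm
        (show (R.tube p p.2.2).A.prod ((R.normalForm p).Ker.sub (R.normalForm p).fixed)
          from (a, b)) = s ∧
      pieceProj J μ c (R.structureOn c) s = (R.redChart p).hom.symm b := by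
  have := (R.isSubmanifold_piece c).isLCManifold
  obtain ⟨a, ha⟩ := hb
  obtain ⟨h1, h2⟩ := ((R.tube p p.2.2).mem_pieceChart_target (R.isAdapted p)).1 ha
  exact ⟨h2, a, _, h1, rfl, ((R.quotChart c p).param_eq ha).symm⟩

/-- The derivative of a chart of the orbit space, as a linear map. -/
def redDeriv (p : piece J μ c) (q : (R.structureOn c).Carrier) :
    tangent q → (R.normalForm p).fixed :=
  chartDeriv (chartAt q) (R.redChart p) (fun y => y) q

/-- In the chart around `p`, the restriction of `ω` to the piece is the pull-back of the form of the
normal form at `p`. -/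
theorem apply_tmap_val (hω : IsSymplecticAction ω G) (hJ : IsMomentumMap ω κ J)
    {p s : piece J μ c} {a : (R.tube p p.2.2).A} {b : (R.normalForm p).fixed}
    (ha : a ∈ (R.tube p p.2.2).D) (hb : (b : (R.normalForm p).Ker) ∈ (R.normalForm p).regular)
    (hs : (R.pieceChart p).hom.symm
      (show (R.tube p p.2.2).A.prod ((R.normalForm p).Ker.sub (R.normalForm p).fixed)
        from (a, b)) = s)
    {q : (R.structureOn c).Carrier} (hq : pieceProj J μ c (R.structureOn c) s = q)
    (w₁ w₂ : tangent s) :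
    ω s (tmap Subtype.val s (s : M) w₁) (tmap Subtype.val s (s : M) w₂) =
      (R.normalForm p).form b
        (R.redDeriv p q (tmap (pieceProj J μ c (R.structureOn c)) s q w₁))
        (R.redDeriv p q (tmap (pieceProj J μ c (R.structureOn c)) s q w₂)) := by
  subst hq
  have hS := R.isSubmanifold_piece c
  have := hS.isLCManifold
  have : IsLCManifold (R.structureOn c).Carrier := (R.structureOn c).manifold
  have hsrc : s ∈ (R.pieceChart p).hom.source := (R.tube p p.2.2).mem_source (R.isAdapted p) ha hb hs
  have hθ : IsSmoothChart (R.pieceChart p) :=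
    (R.tube p p.2.2).isSmoothChart_pieceChart (R.isAdapted p) hS p
  have hπ := (R.isSmoothSubmersion_pieceProj c).1
  have h1 : ∀ w : tangent s, tmap Subtype.val s (s : M) w =
      chartDeriv (R.pieceChart p) (chartAt (s : M)) Subtype.val s
        (chartDeriv (chartAt s) (R.pieceChart p) (fun y => y) s w) := fun w =>
    chartDeriv_comp (f := fun x : piece J μ c => x) (g := (Subtype.val : piece J μ c → M))
      hS.smooth_val smooth_id isOpen_univ isOpen_univ (mem_univ s) (mem_univ _)
      (isSmoothChart_chartAt s) hθ (isSmoothChart_chartAt (s : M)) (mem_chartAt_source _) hsrc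
      (mem_chartAt_source _) w
  have h2 : ∀ y : (R.tube p p.2.2).A × (R.normalForm p).fixed,
      chartDeriv (R.pieceChart p) (R.redChart p) (pieceProj J μ c (R.structureOn c)) s y =
        y.2 := fun y => by
    refine (HasDirDeriv.congr (hasDirDeriv_clm (ContinuousLinearMap.snd ℝ (R.tube p p.2.2).A
      (R.normalForm p).fixed) _ y) ?_).dirDeriv_eq
    filter_upwards [(R.pieceChart p).hom.open_target.mem_nhds
      ((R.pieceChart p).hom.map_source hsrc)] with z hz
    refine Eq.trans ?_ (R.redChart_apply ((R.pieceChart p).hom.map_target hz)).symm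
    rw [(R.pieceChart p).hom.right_inv hz]
    rfl
  have h3 : ∀ w : tangent s,
      (show (R.tube p p.2.2).A × (R.normalForm p).fixed from
        chartDeriv (chartAt s) (R.pieceChart p) (fun y => y) s w).2 =
      R.redDeriv p _ (tmap (pieceProj J μ c (R.structureOn c)) s _ w) := fun w => by
    have h4 := chartDeriv_comp (f := fun x : piece J μ c => x)
      (g := pieceProj J μ c (R.structureOn c)) hπ smooth_id isOpen_univ isOpen_univ (mem_univ s)
      (mem_univ _) (isSmoothChart_chartAt s) hθ (R.isSmoothChart_redChart p) (mem_chartAt_source _)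
      hsrc (R.mem_redChart_source hsrc) w
    have h5 := chartDeriv_comp (f := pieceProj J μ c (R.structureOn c))
      (g := fun x : (R.structureOn c).Carrier => x) smooth_id hπ isOpen_univ isOpen_univ
      (mem_univ s) (mem_univ _) (isSmoothChart_chartAt s) (isSmoothChart_chartAt _)
      (R.isSmoothChart_redChart p) (mem_chartAt_source _) (mem_chartAt_source _)
      (R.mem_redChart_source hsrc) w
    exact ((h2 _).symm.trans h4.symm).trans h5
  have h4 := (R.tube p p.2.2).apply_chartDeriv_val (R.isAdapted p) hω hJ hS ha hb hs
    (chartDeriv (chartAt s) (R.pieceChart p) (fun y => y) s w₁)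
    (chartDeriv (chartAt s) (R.pieceChart p) (fun y => y) s w₂)
  refine (congrArg₂ (fun v v' : tangent (s : M) => ω s v v') (h1 w₁) (h1 w₂)).trans (h4.trans ?_)
  exact congrArg₂ (fun v v' : (R.normalForm p).fixed => (R.normalForm p).form b v v')
    (h3 w₁) (h3 w₂)

theorem redDeriv_linear (p : piece J μ c) {q : (R.structureOn c).Carrier}
    (hq : q ∈ (R.redChart p).hom.source) :
    ∃ D : tangent q →ₗ[ℝ] (R.normalForm p).fixed, ∀ v, D v = R.redDeriv p q v := by
  have : IsLCManifold (R.structureOn c).Carrier := (R.structureOn c).manifold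
  let D : tangent q →L[ℝ] (R.normalForm p).fixed :=
    SmoothOn.chartDerivL (smooth_id (M := (R.structureOn c).Carrier)) isOpen_univ (mem_univ q)
      (isSmoothChart_chartAt q) (R.isSmoothChart_redChart p) (mem_chartAt_source q) hq
  exact ⟨D, fun v => rfl⟩

theorem mem_pieceChart_source (p : piece J μ c) : p ∈ (R.pieceChart p).hom.source :=
  (R.tube p p.2.2).mem_chart_source

theorem pieceProj_surjective (q : (R.structureOn c).Carrier) :
    ∃ s, pieceProj J μ c (R.structureOn c) s = q := Quotient.exists_rep q

/-- A point of the piece over a given point of the orbit space. -/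
def lift (q : (R.structureOn c).Carrier) : piece J μ c := (R.pieceProj_surjective q).choose

theorem pieceProj_lift (q : (R.structureOn c).Carrier) :
    pieceProj J μ c (R.structureOn c) (R.lift q) = q := (R.pieceProj_surjective q).choose_spec

theorem mem_redChart_lift (q : (R.structureOn c).Carrier) :
    q ∈ (R.redChart (R.lift q)).hom.source := by
  have h := R.mem_redChart_source (R.mem_pieceChart_source (R.lift q))
  rwa [R.pieceProj_lift] at h

theorem tmap_pieceProj_surjective {s : piece J μ c} {q : (R.structureOn c).Carrier}
    (hq : pieceProj J μ c (R.structureOn c) s = q) :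
    Function.Surjective (tmap (pieceProj J μ c (R.structureOn c)) s q) := by
  subst hq
  have := (R.isSubmanifold_piece c).isLCManifold
  have : IsLCManifold (R.structureOn c).Carrier := (R.structureOn c).manifold
  exact (R.isSmoothSubmersion_pieceProj c).tmap_surjective s

/-- The reduced form: at each point it is the form of the normal form at a chosen point of the
corresponding orbit. -/
def reducedForm (c : Set (Subgroup (StabMu G μ))) : BilinField (R.structureOn c).Carrier := fun q =>
  let D : tangent q →ₗ[ℝ] (R.normalForm (R.lift q)).Ker :=
    (R.normalForm (R.lift q)).fixed.subtype.comp
      (R.redDeriv_linear (R.lift q) (R.mem_redChart_lift q)).choose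
  ((R.normalForm (R.lift q)).form 0).compl₁₂ D D

theorem reducedForm_apply (q : (R.structureOn c).Carrier) (v v' : tangent q) :
    R.reducedForm c q v v' = (R.normalForm (R.lift q)).form 0 (R.redDeriv (R.lift q) q v)
      (R.redDeriv (R.lift q) q v') := by
  have h := (R.redDeriv_linear (R.lift q) (R.mem_redChart_lift q)).choose_spec
  rw [← h v, ← h v']
  rfl

/-- Tangent vectors may be moved along the orbits. -/
theorem exists_tmap_move (hact : Smooth fun p : G × M => p.1 • p.2) {s p : piece J μ c}
    {g : StabMu G μ} (hg : g • (s : M) = p) {q : (R.structureOn c).Carrier}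
    (hq : pieceProj J μ c (R.structureOn c) s = q) (w : tangent s) :
    ∃ w' : tangent p,
      tmap (pieceProj J μ c (R.structureOn c)) p q w' =
        tmap (pieceProj J μ c (R.structureOn c)) s q w ∧
      tmap Subtype.val p (p : M) w' =
        tmap (fun x : M => (g : G) • x) (s : M) (p : M) (tmap Subtype.val s (s : M) w) := by
  have hS := R.isSubmanifold_piece c
  have := hS.isLCManifold
  have : IsLCManifold (R.structureOn c).Carrier := (R.structureOn c).manifold
  have hM : Smooth fun x : M => (g : G) • x := hact.comp ((smooth_const (g : G)).prodMk smooth_id)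
  let γ : piece J μ c → piece J μ c := fun x => ⟨g • (x : M), smul_mem_piece R.equiv g x.2⟩
  have hγ : Smooth γ := hS.smooth_of_val (hM.comp hS.smooth_val)
  obtain rfl : γ s = p := Subtype.ext hg
  have hπγ : ∀ x, pieceProj J μ c (R.structureOn c) (γ x) = pieceProj J μ c (R.structureOn c) x :=
    fun x => Quotient.sound (show (g • (x : M)) ∈ MulAction.orbit (StabMu G μ) (x : M) from ⟨g, rfl⟩)
  obtain rfl : pieceProj J μ c (R.structureOn c) (γ s) = q := (hπγ s).trans hq
  refine ⟨tmap γ s (γ s) w, ?_, ?_⟩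
  · have h1 := tmap_comp (f := γ) (g := pieceProj J μ c (R.structureOn c))
      (R.isSmoothSubmersion_pieceProj c).1 hγ isOpen_univ isOpen_univ (mem_univ s) (mem_univ _) w
    refine h1.symm.trans ?_
    rw [show (fun y => pieceProj J μ c (R.structureOn c) (γ y)) =
      pieceProj J μ c (R.structureOn c) from funext hπγ]
  · have h1 := tmap_comp (f := γ) (g := (Subtype.val : piece J μ c → M)) hS.smooth_val hγ
      isOpen_univ isOpen_univ (mem_univ s) (mem_univ _) w
    have h2 := tmap_comp (f := (Subtype.val : piece J μ c → M)) (g := fun x : M => (g : G) • x) hM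
      hS.smooth_val isOpen_univ isOpen_univ (mem_univ s) (mem_univ _) w
    exact h1.symm.trans h2

/-- The reduced form pulls back to the restriction of `ω`. -/
theorem reducedForm_tmap (hω : IsSymplecticAction ω G) (hJ : IsMomentumMap ω κ J)
    {s : piece J μ c} {q : (R.structureOn c).Carrier}
    (hq : pieceProj J μ c (R.structureOn c) s = q) (w₁ w₂ : tangent s) :
    R.reducedForm c q (tmap (pieceProj J μ c (R.structureOn c)) s q w₁)
        (tmap (pieceProj J μ c (R.structureOn c)) s q w₂) =
      ω s (tmap Subtype.val s (s : M) w₁) (tmap Subtype.val s (s : M) w₂) := by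
  have hp := R.pieceProj_lift q
  obtain ⟨g, hg⟩ : (R.lift q : M) ∈ MulAction.orbit (StabMu G μ) (s : M) :=
    Quotient.exact (hp.trans hq.symm)
  obtain ⟨w₁', h1, h1'⟩ := R.exists_tmap_move hω.smooth hg hq w₁
  obtain ⟨w₂', h2, h2'⟩ := R.exists_tmap_move hω.smooth hg hq w₂
  have hg' : (g : G) • (s : M) = R.lift q := hg
  rw [← hω.preserves_of_eq hg', ← h1', ← h2', ← h1, ← h2, R.reducedForm_apply]
  exact (R.apply_tmap_val hω hJ (p := R.lift q) (s := R.lift q) (b := 0)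
    (R.tube _ (R.lift q).2.2).a₀_mem (R.normalForm (R.lift q)).zero_mem_regular
    ((R.tube _ (R.lift q).2.2).pieceChart_symm_base (R.isAdapted (R.lift q)) (R.lift q).2) hp
    w₁' w₂').symm

/-- In the charts of the orbit space, the reduced form is the restriction of the form of the normal
form to the fixed vectors. -/
theorem localRep_reducedForm (hω : IsSymplecticAction ω G) (hJ : IsMomentumMap ω κ J)
    (p : piece J μ c) {b : (R.normalForm p).fixed}
    (hb : (show (R.normalForm p).Ker.sub (R.normalForm p).fixed from b) ∈
      (R.redChart p).hom.target) (v₁ v₂ : (R.normalForm p).fixed) :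
    localRep (R.reducedForm c) (R.redChart p) b v₁ v₂ = (R.normalForm p).form b v₁ v₂ := by
  have : IsLCManifold (R.structureOn c).Carrier := (R.structureOn c).manifold
  refine (localRep_eq (R.reducedForm c) hb v₁ v₂).trans ?_
  obtain ⟨hbr, a, s, haD, hs, hq⟩ := R.exists_of_mem_redChart_target hb
  have hqs : (R.redChart p).hom.symm b ∈ (R.redChart p).hom.source :=
    (R.redChart p).hom.map_target hb
  have key : ∀ v : (R.normalForm p).fixed, ∃ w : tangent s,
      tmap (pieceProj J μ c (R.structureOn c)) s _ w = chartDeriv (R.redChart p)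
        (chartAt ((R.redChart p).hom.symm b)) (fun y => y) ((R.redChart p).hom.symm b) v ∧
      R.redDeriv p ((R.redChart p).hom.symm b)
        (tmap (pieceProj J μ c (R.structureOn c)) s _ w) = v := fun v => by
    obtain ⟨w, hw⟩ := R.tmap_pieceProj_surjective hq (chartDeriv (R.redChart p)
        (chartAt ((R.redChart p).hom.symm b)) (fun y => y) ((R.redChart p).hom.symm b) v)
    refine ⟨w, hw, ?_⟩
    rw [hw]
    exact chartDeriv_id_left_inverse (isSmoothChart_chartAt _) (R.isSmoothChart_redChart p)
      (mem_chartAt_source _) hqs v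
  obtain ⟨w₁, h1, h1'⟩ := key v₁
  obtain ⟨w₂, h2, h2'⟩ := key v₂
  have h3 := R.reducedForm_tmap hω hJ hq w₁ w₂
  have h4 := R.apply_tmap_val hω hJ haD hbr hs hq w₁ w₂
  rw [h1', h2'] at h4
  rw [h1, h2] at h3
  exact h3.trans h4

theorem isSymplectic_reducedForm (hω : IsSymplecticAction ω G) (hJ : IsMomentumMap ω κ J)
    (hM : ∀ m : M, IsMackeyComplete (tangent m)) (c : Set (Subgroup (StabMu G μ))) :
    IsSymplectic (R.reducedForm c) where
  closed := by
    rintro _ ⟨p, rfl⟩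
    have h1 : IsOpen (X := (R.normalForm p).fixed) (R.redChart p).hom.target :=
      (R.redChart p).hom.open_target
    exact (R.normalForm p).closed_form.restrict (R.normalForm p).fixed h1
      (fun b hb => (R.normalForm p).mem_U_of_regular (R.exists_of_mem_redChart_target hb).1)
      (fun b hb v₁ v₂ => R.localRep_reducedForm hω hJ p hb v₁ v₂)
  nondegenerate q v hv := by
    have : IsLCManifold (R.structureOn c).Carrier := (R.structureOn c).manifold
    have hq := R.mem_redChart_lift q
    have hc := R.isSmoothChart_redChart (R.lift q)
    have h1 : ((R.redDeriv (R.lift q) q v : (R.normalForm (R.lift q)).fixed) :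
        (R.normalForm (R.lift q)).Ker) = 0 :=
      (R.tube _ (R.lift q).2.2).eq_zero_of_form_fixed R.act R.stab (hM _) (Subtype.prop _)
        fun y hy => by
          have h2 : R.redDeriv (R.lift q) q (chartDeriv (R.redChart (R.lift q)) (chartAt q)
              (fun x => x) q (show (R.normalForm (R.lift q)).fixed from ⟨y, hy⟩)) = ⟨y, hy⟩ :=
            chartDeriv_id_left_inverse (isSmoothChart_chartAt q) hc (mem_chartAt_source q) hq _
          have h3 := (R.reducedForm_apply q v _).symm.trans (hv (chartDeriv
            (R.redChart (R.lift q)) (chartAt q) (fun x => x) q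
            (show (R.normalForm (R.lift q)).fixed from ⟨y, hy⟩)))
          rw [h2] at h3
          exact h3
    have h2 : R.redDeriv (R.lift q) q v = 0 := Subtype.ext h1
    have h3 := chartDeriv_id_left_inverse hc (isSmoothChart_chartAt q) hq (mem_chartAt_source q) v
    refine h3.symm.trans ?_
    exact (congrArg (chartDeriv (R.redChart (R.lift q)) (chartAt q) (fun x => x) q) h2).trans
      (chartDeriv_zero _ _)

theorem eq_reducedForm (hω : IsSymplecticAction ω G) (hJ : IsMomentumMap ω κ J)
    {ω' : BilinField (R.structureOn c).Carrier}
    (h : ∀ (s : piece J μ c) (w₁ w₂ : tangent s),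
      ω' (pieceProj J μ c (R.structureOn c) s) (tmap (pieceProj J μ c (R.structureOn c)) s _ w₁)
          (tmap (pieceProj J μ c (R.structureOn c)) s _ w₂) =
        ω s (tmap Subtype.val s s.1 w₁) (tmap Subtype.val s s.1 w₂)) : ω' = R.reducedForm c := by
  funext q
  obtain ⟨s, rfl⟩ := R.pieceProj_surjective q
  refine LinearMap.ext₂ fun v v' => ?_
  obtain ⟨w, rfl⟩ := R.tmap_pieceProj_surjective rfl v
  obtain ⟨w', rfl⟩ := R.tmap_pieceProj_surjective rfl v'
  rw [h, R.reducedForm_tmap hω hJ rfl]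

end ReductionData

end ReducedForms

end LCRed

end

theorem theorem4p3p5 {M G Gs : Type u}
    [TopologicalSpace M] [LCAtlas M] [IsLCManifold M]
    [Group G] [TopologicalSpace G] [LCAtlas G] [IsLCLieGroup G]
    [AddCommGroup Gs] [TopologicalSpace Gs] [LCAtlas Gs] [IsLCAddLieGroup Gs]
    [MulAction G M] [MulAction G Gs]
    (ω : BilinField M) (hω : IsSymplecticAction ω G)
    (hproper : IsProperMap (fun p : G × M => (p.1 • p.2, p.2)))
    (κ : lieAlgAdd Gs →ₗ[ℝ] lieAlg G →ₗ[ℝ] ℝ) (hκ : IsDualPairing κ) (hcoconj : IsCoconjugation κ)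
    (J : M → Gs) (hJ : IsMomentumMap ω κ J) (hequiv : ∀ (g : G) (m : M), J (g • m) = g • J m)
    (μ : Gs) (hμ : IsSubmanifold (MulAction.stabilizer G μ : Set G))
    (hclosed : ∀ m, J m = μ →
      IsSymplecticallyClosed (ω m) (range (fun ξ : lieAlg G => infAct ξ m)))
    (hNF : ∀ m, J m = μ → ∃ 𝒩 : MGSNormalForm (StabPt G μ m) κ (stabLie G μ m),
      IsBroughtInto ω J 𝒩) :
    -- (i) the pieces are submanifolds
    (∀ c, IsLevelType G J μ c → IsSubmanifold (piece J μ c)) ∧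
    ∃ 𝒮 : ∀ c : {c // IsLevelType G J μ c},
        SmoothStructure (OrbitQuotient (StabMu G μ) (piece J μ c.1)),
      -- (i) the unique manifold structures on their quotients
      (∀ c, IsSmoothSubmersion (pieceProj J μ c.1 (𝒮 c)) ∧
        ∀ 𝒮', IsSmoothSubmersion (pieceProj J μ c.1 𝒮') → (𝒮 c).Same 𝒮') ∧
      -- (ii) the stratifications
      ((∀ m, J m = μ → ∃ 𝒩 : MGSNormalForm (StabPt G μ m) κ (stabLie G μ m),
          IsBroughtInto ω J 𝒩 ∧ 𝒩.IsStrong ∧ HasApproximation J 𝒩) →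
        IsStratification (J ⁻¹' {μ})
          (fun c : {c // IsLevelType G J μ c} => piece J μ c.1)
          (fun c => Set.inclusion (piece_subset J μ c.1)) ∧
        IsStratification (OrbitQuotient (StabMu G μ) (J ⁻¹' {μ}))
          (fun c : {c // IsLevelType G J μ c} => (𝒮 c).Carrier)
          (fun c q => orbitInclusion (StabMu G μ) (piece_subset J μ c.1) ((𝒮 c).out q))) ∧
      -- (iii) the reduced symplectic forms
      ((∀ m : M, IsMackeyComplete (tangent m)) → ∀ c,
        ∃ ω' : BilinField (𝒮 c).Carrier, IsSymplectic ω' ∧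
          (∀ (s : piece J μ c.1) (w₁ w₂ : tangent s),
            ω' (pieceProj J μ c.1 (𝒮 c) s) (tmap (pieceProj J μ c.1 (𝒮 c)) s _ w₁)
                (tmap (pieceProj J μ c.1 (𝒮 c)) s _ w₂) =
              ω s (tmap Subtype.val s s.1 w₁) (tmap Subtype.val s s.1 w₂)) ∧
          ∀ ω'' : BilinField (𝒮 c).Carrier,
            (∀ (s : piece J μ c.1) (w₁ w₂ : tangent s),
              ω'' (pieceProj J μ c.1 (𝒮 c) s) (tmap (pieceProj J μ c.1 (𝒮 c)) s _ w₁)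
                  (tmap (pieceProj J μ c.1 (𝒮 c)) s _ w₂) =
                ω s (tmap Subtype.val s s.1 w₁) (tmap Subtype.val s s.1 w₂)) → ω'' = ω') := by
  have hGs : T2Space Gs := IsLCManifold.t2
  choose 𝒩 h𝒩 using hNF
  let R : ReductionData ω κ J μ :=
    { act := hω.smooth
      proper := hproper
      equiv := hequiv
      stab := hμ
      stab_closed := isClosed_stabilizer hcoconj.smooth.continuous μ
      nf := 𝒩
      tube := fun m hm => ((h𝒩 m hm).nonempty_normalTube hμ).some }
  refine ⟨fun c _ => R.isSubmanifold_piece c, fun c => R.structureOn c.1, fun c =>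
    ⟨R.isSmoothSubmersion_pieceProj c.1, fun _ h => R.same_of_isSmoothSubmersion h⟩,
    fun hstrong => ?_, fun hM c => ⟨R.reducedForm c.1, R.isSymplectic_reducedForm hω hJ hM c.1,
      fun s w₁ w₂ => R.reducedForm_tmap hω hJ rfl w₁ w₂, fun _ h => R.eq_reducedForm hω hJ h⟩⟩
  have hT : HasStrongTubes ω κ J μ := fun m hm => by
    obtain ⟨𝒩', h1, h2, h3⟩ := hstrong m hm
    exact ⟨𝒩', h1.nonempty_normalTube hμ, h2, h3⟩
  exact ⟨R.isStratification_level hT, R.isStratification_quotient hT⟩
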